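/- \textbf{Setting.} Two verifiers $V_0,V_1$ are at positions $v_0<v_1$ on the real line, and a position $p$ with $v_0<p<v_1$ is claimed. Messages travel at speed $1$, and local computations take no time. A position-verification scheme with $N$ steps, possibly interleaved, is as follows. There are times $T_1<\dots<T_N$. In step $j$ verifier $V_0$ sends a register $A_j$ of finitely many qubits together with a classical message $x_j$ from a finite set, and $V_1$ sends a register $B_j$ of finitely many qubits together with a classical message $y_j$ from a finite set. They send these off so that everything arrives at $p$ at time $T_j$. The honest prover at $p$ holds a local register $R$ of finitely many qubits, initially in the default state $|0\cdots0\rangle$. At time $T_j$ he applies a publicly known unitary $U^{(j)}_{x_j,y_j}$ to $A_jB_jR$, returns $A_j$ to $V_0$ and $B_j$ to $V_1$, and keeps $R$. The verifiers may send messages of later steps before replies of earlier steps have arrived. They jointly hold a finite-dimensional system $E$. They start in an arbitrary pure state of $E$ and all message registers. Whenever one of them sends (receives) a register, they apply an arbitrary instrument (quantum operation) to $E$ and that register; the classical message sent is an outcome of that instrument. They accept if and only if, for every $j$, the replies of step $j$ arrive at $V_0$ and $V_1$ exactly at times $T_j+|p-v_0|$ and $T_j+|p-v_1|$, and a final two-outcome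 measurement on all their systems accepts. Let $\rho$ be the final state of the verifiers' systems in the execution with the honest prover. \textbf{Theorem.} Let the data describing the honest prover (the number $N$ of steps, the sizes of the registers, the finite sets of classical messages, and the unitaries $U^{(j)}_{x,y}$) and $\varepsilon>0$ be given. Then there are a number $m$ and a strategy for two dishonest provers $\tilde P_0,\tilde P_1$, who share $m$ EPR pairs and besides hold finite-dimensional workspaces in a fixed product state, of the following form. In step $j$ each $\tilde P_i$, as soon as she receives the register and the classical message sent by $V_i$, applies an instrument to that register and her memory, and sends the classical outcome to the other dishonest prover. As soon as she receives the other's outcome for step $j$, she applies a unitary to the register and her memory, and sends the register to $V_i$. The operations may depend on all classical messages and outcomes that she has received or obtained up to that step. For all verifiers using this prover program (all $E$, initial states, operations and final measurements), all times $T_1<\dots<T_N$, and all positions $v_0<a_0<p<a_1<v_1$, where $a_0,a_1$ are the positions of $\tilde P_0,\tilde P_1$, the following holds. \begin{enumerate} \item (Timing) Every reply arrives at its verifier at exactly the same time as the reply of the honest prover does. \item (Computation) Except with probability $\varepsilon$ the simulation is perfect: the final state $\rho'$ of the verifiers' systems satisfies $\rho'=(1-\varepsilon)\,\rho+\varepsilon\,\tau$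 for some $\tau\ge0$ with $\operatorname{tr}\tau=1$. \item Hence the probability that the verifiers accept differs by at most $\varepsilon$ from the probability that they accept the honest prover at $p$. \end{enumerate} -/

import Mathlib

open scoped Matrix ComplexConjugate ComplexOrder

noncomputable section

namespace PositionVerification

/-- The two ends of the line: `false` is the end of verifier `V₀` (and of the dishonest prover
`P₀`), `true` is the end of `V₁` (and of `P₁`). -/
abbrev Side := Bool

/-- Computational-basis labels of an `n`-qubit register; its state space is `Qubits n → ℂ`. -/
abbrev Qubits (n : ℕ) := Fin n → Fin 2

/-- The matrix `M` applied to one register of a composite system, and the identity to the rest.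
Basis states of the whole are labelled by `I`, those of the register by `S`; `get` reads the label
of the register and `put` overwrites it. -/
def applyTo {I S : Type} [Fintype S] (get : I → S) (put : I → S → I) (M : Matrix S S ℂ)
    (ψ : I → ℂ) : I → ℂ :=
  fun i => ∑ s, M (get i) s * ψ (put i s)

/-! ### The scheme -/

/-- The (public) program of the honest prover in a scheme with `N` steps.  In step `j` he obtains
from the verifier on side `b` a register of `n b j` qubits and a classical message in the finite
set `X b j`; he applies a unitary, which depends on the step and on the two classical messages, to
the two registers and his local register of `r` qubits, and returns the two registers. -/
structure Program (N : ℕ) where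
  n : Side → Fin N → ℕ
  X : Side → Fin N → Type
  [fintypeX : ∀ b j, Fintype (X b j)]
  r : ℕ
  U : (j : Fin N) → ((b : Side) → X b j) →
    Matrix.unitaryGroup (((b : Side) → Qubits (n b j)) × Qubits r) ℂ

attribute [instance] Program.fintypeX

variable {N : ℕ}

/-- Labels of all message registers together. -/
abbrev Program.Msgs (P : Program N) := (b : Side) → (j : Fin N) → Qubits (P.n b j)

/-- What the two verifiers do.  They jointly hold a system `E` of arbitrary finite dimension and
may act on it jointly; anything they want to remember is written into `E`.
When the register `(b, j)` is sent off they apply an instrument to `E` and that register, with Kraus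
operators `send b j x o`: the outcome `x` is the classical message sent along with the register,
`o` is an outcome that they do not send.  When the register comes back they apply an operation with
Kraus operators `recv b j o` to `E` and the register.  At the end they measure all their systems and
the outcome with effect `F` means that they are satisfied with what they received. -/
structure Verifiers (P : Program N) where
  E : Type
  [fintypeE : Fintype E]
  [decEqE : DecidableEq E]
  Ω : Type
  [fintypeΩ : Fintype Ω]
  init : E × P.Msgs → ℂ
  init_norm : ∑ v, ‖init v‖ ^ 2 = 1
  send : (b : Side) → (j : Fin N) → P.X b j → Ω →
    Matrix (E × Qubits (P.n b j)) (E × Qubits (P.n b j)) ℂ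
  send_complete : ∀ b j, ∑ x, ∑ o, (send b j x o)ᴴ * send b j x o = 1
  recv : (b : Side) → (j : Fin N) → Ω →
    Matrix (E × Qubits (P.n b j)) (E × Qubits (P.n b j)) ℂ
  recv_complete : ∀ b j, ∑ o, (recv b j o)ᴴ * recv b j o = 1
  F : Matrix (E × P.Msgs) (E × P.Msgs) ℂ
  F_nonneg : F.PosSemidef
  F_le_one : (1 - F).PosSemidef

attribute [instance] Verifiers.fintypeE Verifiers.decEqE Verifiers.fintypeΩ

/-- Positions on the line and the time table.  The claimed position `pos` lies between the positions
`vpos false` and `vpos true` of the verifiers.  The messages of step `j` reach `pos` at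
time `T j`.  Messages travel at speed one. -/
structure Timetable (N : ℕ) where
  vpos : Side → ℝ
  pos : ℝ
  left_lt : vpos false < pos
  lt_right : pos < vpos true
  T : Fin N → ℝ
  T_strictMono : StrictMono T

/-- Time at which the verifier on side `b` sends off the register `(b, j)`. -/
def Timetable.sendTime (S : Timetable N) (b : Side) (j : Fin N) : ℝ :=
  S.T j - dist (S.vpos b) S.pos

/-- Time at which the reply has to arrive at the verifier on side `b`. -/
def Timetable.deadline (S : Timetable N) (b : Side) (j : Fin N) : ℝ :=
  S.T j + dist S.pos (S.vpos b)

/-- The events of a list in the order of their times (ties are resolved by the given list). -/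
def chronological {Ev : Type} (time : Ev → ℝ) (l : List Ev) : List Ev :=
  open Classical in l.insertionSort (fun e e' => time e ≤ time e')

/-- All pairs of a side and a step. -/
def allPairs (N : ℕ) : List (Side × Fin N) := [false, true] ×ˢ List.finRange N

/-- The classical data that fix one branch of the verifiers' actions. -/
structure VOutcome {P : Program N} (V : Verifiers P) where
  x : (b : Side) → (j : Fin N) → P.X b j
  s : Side → Fin N → V.Ω
  r : Side → Fin N → V.Ω

/-- Basis labels of the verifiers' systems. -/
abbrev Verifiers.Sys {P : Program N} (V : Verifiers P) := V.E × P.Msgs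

/-- A matrix on `E` and the message register `(b, j)`, applied to a state of the verifiers' systems
together with any prover system `Q`. -/
def onVerifiers {P : Program N} (V : Verifiers P) {Q : Type} (b : Side) (j : Fin N)
    (M : Matrix (V.E × Qubits (P.n b j)) (V.E × Qubits (P.n b j)) ℂ) :
    (V.Sys × Q → ℂ) → (V.Sys × Q → ℂ) :=
  applyTo (fun i => (i.1.1, i.1.2 b j))
    (fun i s => ((s.1, Function.update i.1.2 b (Function.update (i.1.2 b) j s.2)), i.2)) M

/-- Unnormalized reduced state of the verifiers' systems, for a vector of the whole system. -/
def reduced {A Q : Type} [Fintype Q] (ψ : A × Q → ℂ) : Matrix A A ℂ :=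
  fun a a' => ∑ q, ψ (a, q) * conj (ψ (a', q))

/-- Probability that the verifiers accept: every reply must arrive in time, and the final
measurement must have the accepting outcome.  `arrival` lists the actual times of arrival and `ρ` is
the final state of the verifiers' systems. -/
def acceptProb {P : Program N} (V : Verifiers P) (S : Timetable N)
    (arrival : Side → Fin N → ℝ) (ρ : Matrix V.Sys V.Sys ℂ) : ℝ :=
  open Classical in if ∀ b j, arrival b j = S.deadline b j then (V.F * ρ).trace.re else 0

/-! ### Execution with the honest prover at the claimed position -/

inductive HonestEvent (N : ℕ) where
  | recv (b : Side) (j : Fin N)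
  | send (b : Side) (j : Fin N)
  | prover (j : Fin N)

/-- Time of arrival, at the verifier on side `b`, of the honest prover's reply. -/
def honestArrival (S : Timetable N) (b : Side) (j : Fin N) : ℝ :=
  S.T j + dist S.pos (S.vpos b)

def honestTime (S : Timetable N) : HonestEvent N → ℝ
  | .send b j => S.sendTime b j
  | .prover j => S.T j
  | .recv b j => honestArrival S b j

def honestEvents (N : ℕ) : List (HonestEvent N) :=
  (allPairs N).map (fun p => .recv p.1 p.2) ++ (allPairs N).map (fun p => .send p.1 p.2) ++
    (List.finRange N).map .prover

/-- The effect of an event, in the branch `o`, on the state of the verifiers' systems and the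
prover's local register. -/
def honestStep {P : Program N} (V : Verifiers P) (o : VOutcome V) :
    HonestEvent N → (V.Sys × Qubits P.r → ℂ) → (V.Sys × Qubits P.r → ℂ)
  | .send b j => onVerifiers V b j (V.send b j (o.x b j) (o.s b j))
  | .recv b j => onVerifiers V b j (V.recv b j (o.r b j))
  | .prover j =>
      applyTo (fun i => ((fun b => i.1.2 b j), i.2))
        (fun i s => ((i.1.1, fun b => Function.update (i.1.2 b) j (s.1 b)), s.2))
        (P.U j (fun b => o.x b j)).1

/-- Initial state: the prover's register is in the default state `|0…0⟩`. -/
def honestInit {P : Program N} (V : Verifiers P) : V.Sys × Qubits P.r → ℂ :=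
  fun i => V.init i.1 * (if i.2 = 0 then 1 else 0)

def honestBranch {P : Program N} (V : Verifiers P) (S : Timetable N) (o : VOutcome V) :
    V.Sys × Qubits P.r → ℂ :=
  (chronological (honestTime S) (honestEvents N)).foldl (fun ψ e => honestStep V o e ψ)
    (honestInit V)

/-- Final state (density matrix) of the verifiers' systems. -/
def honestState {P : Program N} (V : Verifiers P) (S : Timetable N) : Matrix V.Sys V.Sys ℂ :=
  ∑ x : ((b : Side) → (j : Fin N) → P.X b j), ∑ s : (Side → Fin N → V.Ω),
    ∑ r : (Side → Fin N → V.Ω), reduced (honestBranch V S ⟨x, s, r⟩)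

/-! ### Execution with two dishonest provers -/

/-- Two dishonest provers.  They share `m` EPR pairs, the prover on side `b` holding one qubit of
each pair and a workspace `W b` in the default state `w b`.
When the register `(b, j)` and its classical message arrive, the prover on side `b` immediately
applies an instrument to that register and her memory, with Kraus operators `first b j x k c`, and
sends the classical outcome `c` to the other prover; the instrument may depend on the classical
messages `x` received and the outcomes `k` obtained by her so far.  When the other prover's outcome
for step `j` arrives, she applies a unitary `second b j x k l` to the register and her memory and
sends the register to the verifier; it may depend on `x`, `k` and on the other's outcomes `l`. -/
structure Coalition (P : Program N) where
  m : ℕ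
  W : Side → Type
  [fintypeW : ∀ b, Fintype (W b)]
  [decEqW : ∀ b, DecidableEq (W b)]
  w : (b : Side) → W b
  K : Side → Fin N → Type
  [fintypeK : ∀ b j, Fintype (K b j)]
  first : (b : Side) → (j : Fin N) → ((i : Set.Iic j) → P.X b i) → ((i : Set.Iio j) → K b i) →
    K b j → Matrix (Qubits (P.n b j) × (Qubits m × W b)) (Qubits (P.n b j) × (Qubits m × W b)) ℂ
  first_complete : ∀ b j x k, ∑ c, (first b j x k c)ᴴ * first b j x k c = 1
  second : (b : Side) → (j : Fin N) → ((i : Set.Iic j) → P.X b i) → ((i : Set.Iic j) → K b i) →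
    ((i : Set.Iic j) → K (!b) i) →
    Matrix.unitaryGroup (Qubits (P.n b j) × (Qubits m × W b)) ℂ

attribute [instance] Coalition.fintypeW Coalition.decEqW Coalition.fintypeK

/-- Basis labels of the memories of the two dishonest provers. -/
abbrev Coalition.Mem {P : Program N} (C : Coalition P) := (b : Side) → Qubits C.m × C.W b

inductive AttackEvent (N : ℕ) where
  | recv (b : Side) (j : Fin N)
  | send (b : Side) (j : Fin N)
  | second (b : Side) (j : Fin N)
  | first (b : Side) (j : Fin N)

/-- Time at which the register `(b, j)` arrives at the dishonest prover on side `b`, who is at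
position `apos b`. -/
def firstTime (S : Timetable N) (apos : Side → ℝ) (b : Side) (j : Fin N) : ℝ :=
  S.sendTime b j + dist (S.vpos b) (apos b)

/-- Time at which the other prover's outcome for step `j` arrives at the prover on side `b`. -/
def secondTime (S : Timetable N) (apos : Side → ℝ) (b : Side) (j : Fin N) : ℝ :=
  firstTime S apos (!b) j + dist (apos (!b)) (apos b)

/-- Time of arrival, at the verifier on side `b`, of the dishonest provers' reply. -/
def attackArrival (S : Timetable N) (apos : Side → ℝ) (b : Side) (j : Fin N) : ℝ :=
  secondTime S apos b j + dist (apos b) (S.vpos b)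

def attackTime (S : Timetable N) (apos : Side → ℝ) : AttackEvent N → ℝ
  | .send b j => S.sendTime b j
  | .first b j => firstTime S apos b j
  | .second b j => secondTime S apos b j
  | .recv b j => attackArrival S apos b j

def attackEvents (N : ℕ) : List (AttackEvent N) :=
  (allPairs N).map (fun p => .recv p.1 p.2) ++ (allPairs N).map (fun p => .send p.1 p.2) ++
    (allPairs N).map (fun p => .second p.1 p.2) ++ (allPairs N).map (fun p => .first p.1 p.2)

/-- A matrix on the message register `(b, j)` and the memory of the dishonest prover on side `b`. -/
def onProver {P : Program N} (V : Verifiers P) (C : Coalition P) (b : Side) (j : Fin N)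
    (M : Matrix (Qubits (P.n b j) × (Qubits C.m × C.W b))
      (Qubits (P.n b j) × (Qubits C.m × C.W b)) ℂ) :
    (V.Sys × C.Mem → ℂ) → (V.Sys × C.Mem → ℂ) :=
  applyTo (fun i => (i.1.2 b j, i.2 b))
    (fun i s => ((i.1.1, Function.update i.1.2 b (Function.update (i.1.2 b) j s.1)),
      Function.update i.2 b s.2)) M

/-- The effect of an event in the branch in which the verifiers' outcomes are `o` and the outcomes
of the dishonest provers are `k`. -/
def attackStep {P : Program N} (V : Verifiers P) (C : Coalition P) (o : VOutcome V)
    (k : (b : Side) → (j : Fin N) → C.K b j) :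
    AttackEvent N → (V.Sys × C.Mem → ℂ) → (V.Sys × C.Mem → ℂ)
  | .send b j => onVerifiers V b j (V.send b j (o.x b j) (o.s b j))
  | .recv b j => onVerifiers V b j (V.recv b j (o.r b j))
  | .first b j =>
      onProver V C b j (C.first b j (fun i => o.x b i) (fun i => k b i) (k b j))
  | .second b j =>
      onProver V C b j
        (C.second b j (fun i => o.x b i) (fun i => k b i) (fun i => k (!b) i)).1

/-- Amplitudes of `m` EPR pairs, each in the state `(|00⟩ + |11⟩)/√2`. -/
def eprPairs (m : ℕ) (a a' : Qubits m) : ℂ :=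
  if a = a' then (((Real.sqrt 2)⁻¹ ^ m : ℝ) : ℂ) else 0

def attackInit {P : Program N} (V : Verifiers P) (C : Coalition P) : V.Sys × C.Mem → ℂ :=
  fun i => V.init i.1 * eprPairs C.m (i.2 false).1 (i.2 true).1 *
    (if ∀ b, (i.2 b).2 = C.w b then 1 else 0)

def attackBranch {P : Program N} (V : Verifiers P) (C : Coalition P) (S : Timetable N)
    (apos : Side → ℝ) (o : VOutcome V) (k : (b : Side) → (j : Fin N) → C.K b j) :
    V.Sys × C.Mem → ℂ :=
  (chronological (attackTime S apos) (attackEvents N)).foldl (fun ψ e => attackStep V C o k e ψ)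
    (attackInit V C)

/-- Final state (density matrix) of the verifiers' systems. -/
def attackState {P : Program N} (V : Verifiers P) (C : Coalition P) (S : Timetable N)
    (apos : Side → ℝ) : Matrix V.Sys V.Sys ℂ :=
  ∑ x : ((b : Side) → (j : Fin N) → P.X b j), ∑ s : (Side → Fin N → V.Ω),
    ∑ r : (Side → Fin N → V.Ω), ∑ k : ((b : Side) → (j : Fin N) → C.K b j),
      reduced (attackBranch V C S apos ⟨x, s, r⟩ k)

end PositionVerification

end

open scoped Matrix ComplexConjugate ComplexOrder

noncomputable section

namespace PositionVerification

/-! The difficulty in a step is that the joint unitary must act on data in one place before both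
classical messages are known there. `P₀` teleports her register to `P₁`, who then holds all of A, B,
R; but the teleportation error and the message x are known only to `P₀`, while y and the history of
`P₁` are known only to `P₁`. The missing tool is therefore a way for `P₁` to apply, without waiting,
a unitary W that only `P₀` knows.

This tool is `Gadget`. `P₀` projects her half of an entangled state so that the other half becomes a
Choi state of W, and `P₁` teleports his data through it. With probability 1/d² the Bell outcome is
the wanted one, and W has been applied up to an error of a unitary error basis. Otherwise a known
wrong unitary has been applied, and a further round corrects it; as `P₀` does not learn the outcome,
she prepares a resource for every outcome, and `P₁` uses the right one (`Gadget.succ`). Each round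
multiplies the failure probability by 1 - 1/d² (`Gadget.success_succ`), whatever the data and W are,
so `exists_gadget` makes it arbitrarily small.

The same device handles the knowledge of `P₁`: a step has a bank of gadgets, one for each possible
history h of `P₁`, and `P₀` prepares gadget h for the unitary `target` that would be right for h.
`P₁` then teleports A back. The error basis is a product, so after the exchange of outcomes each
prover removes the error on her or his own message register. The error on R is never corrected: it
is undone inside the `target` of the next step. This makes interleaving possible, because the final
operation of a step leaves R alone and commutes with the first operations of other steps.

Hence all events may be put in the order of the honest execution (`foldl_eq_of_perm`,
`attackStep_comm`): events that change places act on disjoint systems. In this order a successful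
branch follows the honest branch step by step, up to a unitary on R and a product state of used-up
entanglement (`local_step`, `attack_step`, `attackBranch_of_success`). Its reduced state is the
honest one times a `weight`, and the weights over all outcomes of the provers sum to the product of
the success probabilities, independently of the verifiers' outcomes. The other branches contribute
positive matrices, so ρ' - (1-ε)ρ is positive (`posSemidef_attackState_sub`). Both states have trace
one by causality of the outcomes (`sum_foldl_chronological`), and τ is this difference divided by ε.
-/

/-! ### Registers of a composite system -/

/-- The laws under which `get` and `put` read and overwrite the label of a register. -/
structure IsLens {I S : Type} (get : I → S) (put : I → S → I) : Prop where
  get_put : ∀ i s, get (put i s) = s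
  put_get : ∀ i, put i (get i) = i
  put_put : ∀ i s t, put (put i s) t = put i t

section Lens

variable {I S T : Type}

/-- Exchanging the label of the register with an external label is an involution of `I × S`. -/
theorem IsLens.sum_put [Fintype I] [Fintype S] {M : Type} [AddCommMonoid M] {get : I → S}
    {put : I → S → I} (hl : IsLens get put) (F : I → S → M) :
    ∑ i, ∑ s, F (put i s) (get i) = ∑ i, ∑ s, F i s := by
  rw [← Fintype.sum_prod_type', ← Fintype.sum_prod_type']
  refine Fintype.sum_bijective (fun p : I × S => (put p.1 p.2, get p.1)) ?_ _ _ fun _ => rfl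
  refine Function.Involutive.bijective fun p => ?_
  simp [hl.get_put, hl.put_put, hl.put_get]

/-- Allows sums over the whole system to be evaluated slice by slice without writing `I` as a
product: overwriting the register in all ways meets each label `card S` times. -/
theorem IsLens.card_nsmul_sum [Fintype I] [Fintype S] {M : Type} [AddCommMonoid M] {get : I → S}
    {put : I → S → I} (hl : IsLens get put) (F : I → M) :
    Fintype.card S • ∑ i, F i = ∑ i, ∑ s, F (put i s) := by
  rw [hl.sum_put (fun i _ => F i)]
  simp [Finset.smul_sum]

theorem applyTo_apply [Fintype S] (get : I → S) (put : I → S → I) (M : Matrix S S ℂ) (ψ : I → ℂ)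
    (i : I) : applyTo get put M ψ i = (M *ᵥ fun s => ψ (put i s)) (get i) := rfl

/-- The hypotheses say that the two registers are disjoint. All exchanges of events below reduce to
this. -/
theorem applyTo_comm [Fintype S] [Fintype T] {get : I → S} {put : I → S → I} {get' : I → T}
    {put' : I → T → I} (h₁ : ∀ i s, get' (put i s) = get' i) (h₂ : ∀ i t, get (put' i t) = get i)
    (h₃ : ∀ i s t, put' (put i s) t = put (put' i t) s) (M : Matrix S S ℂ) (M' : Matrix T T ℂ)
    (ψ : I → ℂ) :
    applyTo get put M (applyTo get' put' M' ψ) = applyTo get' put' M' (applyTo get put M ψ) := by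
  funext i
  simp only [applyTo, h₁, h₂, h₃, Finset.mul_sum]
  rw [Finset.sum_comm]
  exact Finset.sum_congr rfl fun _ _ => Finset.sum_congr rfl fun _ _ => mul_left_comm _ _ _

theorem applyTo_one [Fintype S] [DecidableEq S] {get : I → S} {put : I → S → I}
    (hl : IsLens get put) (ψ : I → ℂ) : applyTo get put 1 ψ = ψ := by
  funext i
  simp [applyTo_apply, hl.put_get]

/-- Completeness of a family of Kraus operators. -/
def Complete {C S T : Type} [Fintype C] [Fintype T] [DecidableEq S] (K : C → Matrix T S ℂ) : Prop :=
  ∑ c, (K c)ᴴ * K c = 1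

theorem complete_iff {C S T : Type} [Fintype C] [Fintype T] [DecidableEq S]
    {K : C → Matrix T S ℂ} :
    Complete K ↔ ∀ s s', ∑ c, ∑ t, conj (K c t s) * K c t s' = if s = s' then 1 else 0 := by
  simp only [Complete, ← Matrix.ext_iff, Matrix.sum_apply, Matrix.mul_apply,
    Matrix.conjTranspose_apply, Matrix.one_apply]
  rfl

theorem Complete.sum_dotProduct {C : Type} [Fintype C] [Fintype S] [DecidableEq S] [Fintype T]
    {K : C → Matrix T S ℂ} (hK : Complete K) (φ ψ : S → ℂ) :
    ∑ c, star (K c *ᵥ φ) ⬝ᵥ (K c *ᵥ ψ) = star φ ⬝ᵥ ψ := by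
  have : ∀ c, star (K c *ᵥ φ) ⬝ᵥ (K c *ᵥ ψ) = star φ ⬝ᵥ (((K c)ᴴ * K c) *ᵥ ψ) := by
    intro c
    rw [Matrix.star_mulVec, ← Matrix.dotProduct_mulVec, Matrix.mulVec_mulVec]
  simp only [this]
  rw [← dotProduct_sum, ← Matrix.sum_mulVec, hK, Matrix.one_mulVec]

/-- On each slice on which only the register varies this is `Complete.sum_dotProduct`; the factor
`card S` put in by `mul_left_cancel₀` pays for summing over slices. -/
theorem Complete.sum_dotProduct_applyTo {C : Type} [Fintype C] [Fintype I] [Fintype S]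
    [DecidableEq S] {get : I → S} {put : I → S → I} (hl : IsLens get put) {K : C → Matrix S S ℂ}
    (hK : Complete K) (φ ψ : I → ℂ) :
    ∑ c, star (applyTo get put (K c) φ) ⬝ᵥ applyTo get put (K c) ψ = star φ ⬝ᵥ ψ := by
  rcases isEmpty_or_nonempty I with hI | ⟨⟨i₀⟩⟩
  · simp [dotProduct]
  have hS : (Fintype.card S : ℂ) ≠ 0 := by
    have : Nonempty S := ⟨get i₀⟩
    exact_mod_cast Fintype.card_ne_zero
  refine mul_left_cancel₀ hS ?_
  simp only [dotProduct]
  rw [Finset.sum_comm, ← nsmul_eq_mul, ← nsmul_eq_mul, hl.card_nsmul_sum, hl.card_nsmul_sum]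
  refine Finset.sum_congr rfl fun i _ => ?_
  have := hK.sum_dotProduct (fun s => φ (put i s)) (fun s => ψ (put i s))
  simp only [dotProduct] at this
  rw [Finset.sum_comm] at this
  simp only [Pi.star_apply, applyTo_apply, hl.get_put, hl.put_put] at this ⊢
  exact this

/-- The matrix on the whole system of a matrix on a register. -/
def embed [Fintype S] [DecidableEq I] (get : I → S) (put : I → S → I) (M : Matrix S S ℂ) :
    Matrix I I ℂ :=
  fun i i' => applyTo get put M (Pi.single i' 1) i

theorem embed_mulVec [Fintype I] [DecidableEq I] [Fintype S] (get : I → S) (put : I → S → I)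
    (M : Matrix S S ℂ) (ψ : I → ℂ) : embed get put M *ᵥ ψ = applyTo get put M ψ := by
  funext i
  simp only [Matrix.mulVec, dotProduct, embed, applyTo, Finset.sum_mul]
  rw [Finset.sum_comm]
  refine Finset.sum_congr rfl fun s _ => ?_
  rw [Finset.sum_eq_single (put i s)]
  · simp
  · intro b _ hb
    simp [hb.symm]
  · simp

/-- The columns of an embedded matrix are images of basis vectors, so completeness is the
preservation of inner products of basis vectors. -/
theorem IsLens.complete_embed {C : Type} [Fintype C] [Fintype I] [DecidableEq I] [Fintype S]
    [DecidableEq S] {get : I → S} {put : I → S → I} (hl : IsLens get put) {K : C → Matrix S S ℂ}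
    (hK : Complete K) : Complete fun c => embed get put (K c) := by
  rw [complete_iff]
  intro i i'
  have := hK.sum_dotProduct_applyTo hl (Pi.single i 1) (Pi.single i' 1)
  simpa [dotProduct, embed, Pi.single_apply, Finset.sum_ite_eq, eq_comm] using this

/-- A register of a register is a register. This turns an operation on one slot of a prover's memory
into an operation on the global state. -/
theorem applyTo_embed [Fintype T] [Fintype S] [DecidableEq S] (get : I → S) (put : I → S → I)
    (get' : S → T) (put' : S → T → S) (M : Matrix T T ℂ) (ψ : I → ℂ) :
    applyTo get put (embed get' put' M) ψ =
      applyTo (fun i => get' (get i)) (fun i t => put i (put' (get i) t)) M ψ := by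
  funext i
  rw [applyTo_apply, embed_mulVec]
  rfl

/-- Two instruments in succession, where the second may depend on the outcome of the first. -/
theorem Complete.mul {C C' S T U : Type} [Fintype C] [Fintype C'] [DecidableEq S] [Fintype T]
    [DecidableEq T] [Fintype U]
    {K : C → Matrix T S ℂ} {L : C → C' → Matrix U T ℂ} (hK : Complete K)
    (hL : ∀ c, Complete (L c)) : Complete fun p : C × C' => L p.1 p.2 * K p.1 := by
  rw [Complete, Fintype.sum_prod_type, ← hK]
  refine Finset.sum_congr rfl fun c _ => ?_
  have : ∀ c', (L c c' * K c)ᴴ * (L c c' * K c) = (K c)ᴴ * ((L c c')ᴴ * L c c') * K c := by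
    intro c'
    rw [Matrix.conjTranspose_mul]
    simp only [Matrix.mul_assoc]
  simp only [this]
  rw [← Matrix.sum_mul, ← Matrix.mul_sum, hL c, Matrix.mul_one]

/-- Projecting onto one of the vectors `bra c` and resetting the system to `post`. -/
theorem complete_of_bra {C : Type} [Fintype C] [Fintype S] [DecidableEq S] (post : S)
    {bra : C → S → ℂ}
    (h : ∀ s s', ∑ c, conj (bra c s) * bra c s' = if s = s' then 1 else 0) :
    Complete fun c => Matrix.of fun t s => if t = post then bra c s else 0 := by
  rw [complete_iff]
  intro s s'
  rw [← h]
  refine Finset.sum_congr rfl fun c _ => ?_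
  rw [Finset.sum_eq_single post] <;> simp +contextual

theorem embed_mem_unitaryGroup [Fintype I] [DecidableEq I] [Fintype S] [DecidableEq S]
    {get : I → S} {put : I → S → I} (hl : IsLens get put) {M : Matrix S S ℂ}
    (hM : M ∈ Matrix.unitaryGroup S ℂ) : embed get put M ∈ Matrix.unitaryGroup I ℂ := by
  rw [Matrix.mem_unitaryGroup_iff']
  have := hl.complete_embed (C := Unit) (K := fun _ => M) (by
    simpa [Complete, Matrix.star_eq_conjTranspose] using Matrix.mem_unitaryGroup_iff'.1 hM)
  simpa [Complete, Matrix.star_eq_conjTranspose] using this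

end Lens

/-! ### Unitary error bases -/

/-- A unitary error basis: a family of unitaries whose normalized Choi vectors resolve the
identity. -/
structure ErrorBasis (S : Type) [Fintype S] [DecidableEq S] where
  Idx : Type
  [fintypeIdx : Fintype Idx]
  [decEqIdx : DecidableEq Idx]
  u : Idx → Matrix.unitaryGroup S ℂ
  complete : ∀ s t s' t', ∑ i, conj ((u i).1 s t) * (u i).1 s' t' =
    if s = s' ∧ t = t' then (Fintype.card S : ℂ) else 0

attribute [instance] ErrorBasis.fintypeIdx ErrorBasis.decEqIdx

/-- The basis of shifts and clocks of a finite abelian group. -/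
def shiftClock (S : Type) [Fintype S] [DecidableEq S] [AddCommGroup S] : ErrorBasis S where
  Idx := S × AddChar S ℂ
  decEqIdx := Classical.decEq _
  u p := ⟨Matrix.of fun s t => if s = t + p.1 then p.2 t else 0, by
    rw [Matrix.mem_unitaryGroup_iff']
    ext t t'
    rw [Matrix.mul_apply, Finset.sum_eq_single (t + p.1)]
    · by_cases h : t = t'
      · subst h
        have h1 := Complex.mul_conj' (p.2 t)
        rw [AddChar.norm_apply, mul_comm] at h1
        simpa [Matrix.star_apply] using h1
      · simp [h]
    · intro s _ hs
      simp [Matrix.star_apply, hs]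
    · simp⟩
  complete s t s' t' := by
    rw [Fintype.sum_prod_type]
    simp only [Matrix.of_apply]
    -- The entry (s, t) vanishes for every shift but s - t; for that shift, orthogonality of
    -- characters evaluates the sum over clocks.
    rw [Finset.sum_eq_single (s - t)]
    · have h1 : ∀ ψ : AddChar S ℂ, conj (ψ t) * ψ t' = ψ (t' - t) := by
        intro ψ
        rw [← AddChar.map_neg_eq_conj, ← AddChar.map_add_eq_mul]
        congr 1
        abel
      by_cases hs : s' = t' + (s - t)
      · simp only [add_sub_cancel, if_true, hs, h1, AddChar.sum_apply_eq_ite, sub_eq_zero]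
        congr 1
        simp only [eq_iff_iff]
        constructor
        · rintro rfl
          simp
        · rintro ⟨_, rfl⟩
          rfl
      · simp only [hs, if_false, mul_zero, Finset.sum_const_zero]
        rw [if_neg]
        rintro ⟨rfl, rfl⟩
        simp at hs
    · intro a _ ha
      refine Finset.sum_eq_zero fun ψ _ => ?_
      rw [if_neg]
      · simp
      · rintro rfl
        simp at ha
    · simp

/-- The product of two unitary error bases. -/
def ErrorBasis.prod {S T : Type} [Fintype S] [DecidableEq S] [Fintype T] [DecidableEq T]
    (β : ErrorBasis S) (γ : ErrorBasis T) : ErrorBasis (S × T) where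
  Idx := β.Idx × γ.Idx
  u p := ⟨Matrix.kroneckerMap (· * ·) (β.u p.1).1 (γ.u p.2).1,
    Matrix.kronecker_mem_unitary (β.u p.1).2 (γ.u p.2).2⟩
  complete s t s' t' := by
    rw [Fintype.sum_prod_type]
    simp only [Matrix.kroneckerMap_apply, map_mul, mul_mul_mul_comm]
    rw [← Finset.sum_mul_sum, β.complete, γ.complete]
    simp only [Prod.ext_iff, Fintype.card_prod, Nat.cast_mul]
    split_ifs <;> simp_all

section

variable {S : Type} [Fintype S] [DecidableEq S] (β : ErrorBasis S)

theorem sum_conj_mul_unitary (W : Matrix.unitaryGroup S ℂ) (s s' : S) :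
    ∑ t, conj (W.1 t s) * W.1 t s' = if s = s' then 1 else 0 := by
  have := congrFun (congrFun (Matrix.mem_unitaryGroup_iff'.1 W.2) s) s'
  simpa [Matrix.mul_apply, Matrix.star_apply, Matrix.one_apply] using this

theorem sum_norm_sq_unitary (W : Matrix.unitaryGroup S ℂ) :
    ∑ s, ∑ t, ‖W.1 s t‖ ^ 2 = Fintype.card S := by
  rw [Finset.sum_comm]
  have h : ∀ t, ∑ s, ‖W.1 s t‖ ^ 2 = 1 := by
    intro t
    have := sum_conj_mul_unitary W t t
    simp only [Complex.conj_mul', if_true] at this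
    exact_mod_cast this
  simp [h]

/-- The squared moduli of all entries are summed in two ways: completeness gives `card S` for each
entry, unitarity gives `card S` for each index. -/
theorem ErrorBasis.card_idx [Nonempty S] : Fintype.card β.Idx = Fintype.card S ^ 2 := by
  have h1 : ∑ s, ∑ t, ∑ i, ‖(β.u i).1 s t‖ ^ 2 = (Fintype.card S : ℝ) ^ 2 * Fintype.card S := by
    have : ∀ s t, ∑ i, ‖(β.u i).1 s t‖ ^ 2 = (Fintype.card S : ℝ) := by
      intro s t
      have := β.complete s t s t
      simp only [Complex.conj_mul', and_self, if_true] at this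
      exact_mod_cast this
    simp [this]
    ring
  have h2 : ∑ s, ∑ t, ∑ i, ‖(β.u i).1 s t‖ ^ 2 = (Fintype.card β.Idx : ℝ) * Fintype.card S := by
    rw [Finset.sum_congr rfl fun s _ => Finset.sum_comm, Finset.sum_comm]
    simp [sum_norm_sq_unitary]
  have h3 : (Fintype.card S : ℝ) ≠ 0 := by exact_mod_cast Fintype.card_ne_zero
  have := mul_right_cancel₀ h3 (h2.symm.trans h1)
  exact_mod_cast this

/-- Bell measurement with respect to the Choi vectors of a rotated error basis. -/
theorem ErrorBasis.complete_mul (W : Matrix.unitaryGroup S ℂ) (s t s' t' : S) :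
    ∑ i, conj ((β.u i * W).1 s t) * (β.u i * W).1 s' t' =
      if s = s' ∧ t = t' then (Fintype.card S : ℂ) else 0 := by
  have h : ∀ i, conj ((β.u i * W).1 s t) * (β.u i * W).1 s' t' =
      ∑ e, ∑ e', (conj ((β.u i).1 s e) * (β.u i).1 s' e') * (conj (W.1 e t) * W.1 e' t') := by
    intro i
    simp only [Matrix.UnitaryGroup.mul_val, Matrix.mul_apply, map_sum, map_mul]
    rw [Finset.sum_mul_sum]
    exact Finset.sum_congr rfl fun _ _ => Finset.sum_congr rfl fun _ _ => by ring
  simp only [h]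
  rw [Finset.sum_comm, Finset.sum_congr rfl fun e _ => Finset.sum_comm]
  simp only [← Finset.sum_mul, β.complete]
  by_cases hs : s = s'
  · simp only [hs, true_and, ite_mul, zero_mul, Finset.sum_ite_eq, Finset.mem_univ, if_true]
    rw [← Finset.mul_sum, sum_conj_mul_unitary]
    simp
  · simp [hs]

end

/-! ### Banks: families of systems indexed by a finite set -/

section Bank

variable {ι : Type} [Fintype ι] [DecidableEq ι]

theorem prod_update_right {H : Type} {R : Type} [CommMonoid R] (g : ι → H → R) (i : ι) (b : ι → H)
    (x : H) :
    ∏ j, g j (Function.update b i x j) = g i x * ∏ j ∈ Finset.univ.erase i, g j (b j) := by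
  rw [← Finset.mul_prod_erase Finset.univ _ (Finset.mem_univ i)]
  congr 1
  · simp
  · refine Finset.prod_congr rfl fun j hj => ?_
    rw [Function.update_of_ne (Finset.ne_of_mem_erase hj)]

theorem prod_update_left {H : Type} {R : Type} [CommMonoid R] (g : ι → H → R) (i : ι) (b : ι → H)
    (f : H → R) :
    ∏ j, Function.update g i f j (b j) = f (b i) * ∏ j ∈ Finset.univ.erase i, g j (b j) := by
  rw [← Finset.mul_prod_erase Finset.univ _ (Finset.mem_univ i)]
  congr 1
  · simp
  · refine Finset.prod_congr rfl fun j hj => ?_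
    rw [Function.update_of_ne (Finset.ne_of_mem_erase hj)]

/-- In a product state of the bank all members but `i` are a common scalar, so an identity for one
resource passes to the whole bank. -/
theorem mulVec_bank {X H : Type} [Fintype X] [Fintype H] {M : Matrix (X × H) (X × H) ℂ}
    {φ φ' : X → ℂ} {g : ι → H → ℂ} {g' : H → ℂ} {i : ι}
    (h : (M *ᵥ fun s => φ s.1 * g i s.2) = fun s => φ' s.1 * g' s.2) (b : ι → H) (x : X) :
    (M *ᵥ fun s => φ s.1 * ∏ j, g j (Function.update b i s.2 j)) (x, b i) =
      φ' x * ∏ j, Function.update g i g' j (b j) := by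
  have h1 : (fun s : X × H => φ s.1 * ∏ j, g j (Function.update b i s.2 j)) =
      (∏ j ∈ Finset.univ.erase i, g j (b j)) • fun s : X × H => φ s.1 * g i s.2 := by
    funext s
    simp only [prod_update_right, Pi.smul_apply, smul_eq_mul]
    ring
  rw [h1, Matrix.mulVec_smul, h, prod_update_left]
  simp only [Pi.smul_apply, smul_eq_mul]
  ring

theorem sum_prod_apply {κ : ι → Type} [∀ i, Fintype (κ i)] {R : Type} [CommSemiring R]
    (g : (i : ι) → κ i → R) : ∑ b : (i : ι) → κ i, ∏ i, g i (b i) = ∏ i, ∑ x, g i x := by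
  rw [Finset.prod_univ_sum, Fintype.piFinset_univ]

theorem sum_norm_sq_prod {κ : ι → Type} [∀ i, Fintype (κ i)] (g : (i : ι) → κ i → ℂ) :
    ∑ b : (i : ι) → κ i, ‖∏ i, g i (b i)‖ ^ 2 = ∏ i, ∑ x, ‖g i x‖ ^ 2 := by
  rw [← sum_prod_apply fun i x => ‖g i x‖ ^ 2]
  simp [Finset.prod_pow]

theorem complete_bra_pi {κ : ι → Type} [∀ i, Fintype (κ i)] {H : Type} [DecidableEq H]
    {bra : (i : ι) → κ i → H → ℂ}
    (h : ∀ i x y, ∑ k, conj (bra i k x) * bra i k y = if x = y then 1 else 0) (b b' : ι → H) :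
    ∑ k : (i : ι) → κ i, conj (∏ i, bra i (k i) (b i)) * ∏ i, bra i (k i) (b' i) =
      if b = b' then 1 else 0 := by
  simp only [map_prod, ← Finset.prod_mul_distrib]
  rw [sum_prod_apply fun i k => conj (bra i k (b i)) * bra i k (b' i)]
  simp only [h, Fintype.prod_ite_zero, Finset.prod_const_one, funext_iff]

end Bank

/-! ### Gate teleportation of a unitary that only one party knows -/

/-- Protocol for applying to a system `D` of one party a unitary that only the other party knows,
without communication.  They share maximally entangled systems with label set `H`.  The party who
knows the unitary `W` projects her half onto one of the vectors `alice W ka` and the other party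
applies an instrument with Kraus operators `bob kb` to `D` and his half.  With weight `w kb` the
unitary is applied up to the known error `key ka kb`. -/
structure Gadget {D : Type} [Fintype D] [DecidableEq D] (β : ErrorBasis D) where
  H : Type
  [fintypeH : Fintype H]
  [decEqH : DecidableEq H]
  h₀ : H
  KA : Type
  [fintypeKA : Fintype KA]
  [nonemptyKA : Nonempty KA]
  KB : Type
  [fintypeKB : Fintype KB]
  [decEqKB : DecidableEq KB]
  kb₀ : KB
  card_H : ∃ m, Fintype.card H = 2 ^ m
  alice : Matrix.unitaryGroup D ℂ → KA → H → ℂ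
  alice_complete : ∀ W x y, ∑ k, conj (alice W k x) * alice W k y = if x = y then 1 else 0
  -- All outcomes of the party who knows the unitary are equally likely, whatever `W` is.
  alice_norm : ∀ W k, ∑ x, ‖alice W k x‖ ^ 2 = (Fintype.card H : ℝ) / Fintype.card KA
  bob : KB → Matrix (D × H) (D × H) ℂ
  bob_complete : Complete bob
  w : KB → ℝ
  w_nonneg : ∀ kb, 0 ≤ w kb
  key : KA → KB → β.Idx
  -- The norm below says that, given `ka`, the outcome `kb` occurs with probability `w kb`,
  -- independently of the data and of `W`. Failed outcomes carry `w kb = 0` and are not constrained.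
  junk : Matrix.unitaryGroup D ℂ → KA → KB → H → ℂ
  junk_norm : ∀ W ka kb, w kb ≠ 0 →
    ∑ x, ‖junk W ka kb x‖ ^ 2 = w kb * ((Fintype.card H : ℝ) / Fintype.card KA)
  correct : ∀ W ka kb, w kb ≠ 0 → ∀ φ : D → ℂ,
    (bob kb *ᵥ fun s => φ s.1 * alice W ka s.2) =
      fun s => ((β.u (key ka kb)).1 *ᵥ (W.1 *ᵥ φ)) s.1 * junk W ka kb s.2

attribute [instance] Gadget.fintypeH Gadget.decEqH Gadget.fintypeKA Gadget.nonemptyKA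
  Gadget.fintypeKB Gadget.decEqKB

/-- The probability that the unitary is applied. -/
def Gadget.success {D : Type} [Fintype D] [DecidableEq D] {β : ErrorBasis D} (g : Gadget β) : ℝ :=
  ∑ kb, g.w kb

section Succ

variable {D : Type} [Fintype D] [DecidableEq D] {β : ErrorBasis D}

/-- The protocol that always fails. -/
def Gadget.zero (i₀ : β.Idx) : Gadget β where
  H := Unit
  h₀ := ()
  KA := Unit
  KB := Unit
  kb₀ := ()
  card_H := ⟨0, by simp⟩
  alice _ _ _ := 1
  alice_complete _ _ _ := by simp
  alice_norm _ _ := by simp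
  bob _ := 1
  bob_complete := by simp [Complete]
  w _ := 0
  w_nonneg _ := le_rfl
  key _ _ := i₀
  junk _ _ _ _ := 0
  junk_norm _ _ _ h := absurd rfl h
  correct _ _ _ h := absurd rfl h

/-- Bell measurement of the data with a half of a Choi state, whose other half becomes the data. -/
def bellRound (β : ErrorBasis D) (d₀ : D) (σ : β.Idx) : Matrix (D × D × D) (D × D × D) ℂ :=
  Matrix.of fun t s => if t = (s.2.2, d₀, d₀) then
    (Real.sqrt (Fintype.card D) : ℂ)⁻¹ * (β.u σ).1 s.2.1 s.1 else 0

theorem sqrt_card_mul_self (S : Type) [Fintype S] :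
    ((Real.sqrt (Fintype.card S) : ℝ) : ℂ)⁻¹ * ((Real.sqrt (Fintype.card S) : ℝ) : ℂ)⁻¹ =
      (Fintype.card S : ℂ)⁻¹ := by
  rw [← mul_inv, ← Complex.ofReal_mul, Real.mul_self_sqrt (Nat.cast_nonneg _), Complex.ofReal_natCast]

theorem norm_sqrt_card_inv_sq (S : Type) [Fintype S] :
    ‖((Real.sqrt (Fintype.card S) : ℝ) : ℂ)⁻¹‖ ^ 2 = (Fintype.card S : ℝ)⁻¹ := by
  rw [norm_inv, Complex.norm_real, Real.norm_eq_abs, inv_pow, sq_abs,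
    Real.sq_sqrt (Nat.cast_nonneg _)]

theorem ErrorBasis.complete_bra (β : ErrorBasis D) (W : Matrix.unitaryGroup D ℂ) (s s' : D × D) :
    ∑ i, conj ((Real.sqrt (Fintype.card D) : ℂ)⁻¹ * (β.u i * W).1 s.1 s.2) *
      ((Real.sqrt (Fintype.card D) : ℂ)⁻¹ * (β.u i * W).1 s'.1 s'.2) = if s = s' then 1 else 0 := by
  have hd : (Fintype.card D : ℂ) ≠ 0 := by
    have : Nonempty D := ⟨s.1⟩
    exact_mod_cast Fintype.card_ne_zero
  have h := sqrt_card_mul_self D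
  simp only [map_mul, map_inv₀, Complex.conj_ofReal, mul_mul_mul_comm, h]
  rw [← Finset.mul_sum, β.complete_mul]
  simp only [Prod.ext_iff]
  split_ifs <;> simp [hd]

/-- The data and one half of the pair are measured in the Bell basis, while the other half moves
unmeasured into the data register; so the Kraus sum is a Bell resolution of the identity times an
identity. -/
theorem complete_bellRound (β : ErrorBasis D) (d₀ : D) : Complete (bellRound β d₀) := by
  rw [complete_iff]
  rintro ⟨d, a, c⟩ ⟨d', a', c'⟩
  have h := β.complete_bra 1 (a, d) (a', d')
  simp only [mul_one] at h
  simp only [bellRound, Matrix.of_apply]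
  by_cases hc : c = c'
  · subst hc
    rw [Finset.sum_congr rfl fun σ _ => Finset.sum_eq_single (c, d₀, d₀) ?_ ?_]
    · simp only [if_true, h, Prod.mk.injEq]
      exact if_congr (by tauto) rfl rfl
    · intro t _ ht
      simp [ht]
    · simp
  · rw [Finset.sum_eq_zero, if_neg (by simp [hc])]
    intro σ _
    refine Finset.sum_eq_zero fun t _ => ?_
    by_cases ht : t = (c, d₀, d₀)
    · subst ht
      simp [hc]
    · simp [ht]

/-- Gate teleportation: the data passes through `β.u σ` and then through the matrix `Y` stored in
the Choi state. The amplitude is 1/d for every outcome. -/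
theorem bellRound_mulVec (β : ErrorBasis D) (d₀ : D) (σ : β.Idx) (φ : D → ℂ) (Y : Matrix D D ℂ) :
    (bellRound β d₀ σ *ᵥ fun s =>
      φ s.1 * ((Real.sqrt (Fintype.card D) : ℂ)⁻¹ * Y s.2.2 s.2.1)) =
      fun s => (Y *ᵥ ((β.u σ).1 *ᵥ φ)) s.1 *
        ((Fintype.card D : ℂ)⁻¹ * if s.2 = (d₀, d₀) then 1 else 0) := by
  funext ⟨d, ac⟩
  simp only [Matrix.mulVec, dotProduct, bellRound, Matrix.of_apply]
  rw [Fintype.sum_prod_type]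
  simp only [Fintype.sum_prod_type (α₁ := D) (α₂ := D), Prod.mk.injEq]
  by_cases h : ac = (d₀, d₀)
  · subst h
    simp only [and_true, ite_mul, zero_mul, if_true, mul_one, Finset.sum_ite_eq, Finset.mem_univ]
    rw [Finset.sum_comm, Finset.sum_mul]
    refine Finset.sum_congr rfl fun a _ => ?_
    rw [Finset.mul_sum, Finset.sum_mul]
    refine Finset.sum_congr rfl fun e _ => ?_
    rw [← sqrt_card_mul_self]
    ring
  · simp [h]

end Succ

/-! ### Recursion over rounds and the success probability -/

section Succ

variable {D : Type} [Fintype D] [DecidableEq D] {β : ErrorBasis D}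

/-- The unitary that remains to be applied after a failed round with outcome `σ`. -/
def residual (β : ErrorBasis D) (σ₀ : β.Idx) (W : Matrix.unitaryGroup D ℂ) (τ σ : β.Idx) :
    Matrix.unitaryGroup D ℂ :=
  W * (β.u τ * (W * (β.u σ₀)⁻¹) * β.u σ)⁻¹

theorem sum_norm_sq_round {ι H : Type} [Fintype ι] [DecidableEq ι] [Fintype H] (d₀ : D)
    (F : ι → H → ℂ) :
    ∑ x : (D × D) × (ι → H), ‖((Fintype.card D : ℂ)⁻¹ * if x.1 = (d₀, d₀) then 1 else 0) *
      ∏ i, F i (x.2 i)‖ ^ 2 = ((Fintype.card D : ℝ) ^ 2)⁻¹ * ∏ i, ∑ x, ‖F i x‖ ^ 2 := by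
  rw [Fintype.sum_prod_type, Finset.sum_eq_single (d₀, d₀)]
  · simp only [norm_mul, mul_pow, if_true, mul_one, norm_inv,
      RCLike.norm_natCast, inv_pow]
    rw [← Finset.mul_sum, sum_norm_sq_prod F]
  · intro b _ hb
    simp [hb]
  · simp

/-- Adding a first round to a protocol; the old protocol is used if that round fails, on a bank of
resources labelled by the outcome of the round. -/
def Gadget.succ (g : Gadget β) (d₀ : D) (σ₀ : β.Idx) (hD : ∃ m, Fintype.card D = 2 ^ m) :
    Gadget β where
  H := (D × D) × (β.Idx → g.H)
  h₀ := ((d₀, d₀), fun _ => g.h₀)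
  KA := β.Idx × (β.Idx → g.KA)
  nonemptyKA := ⟨σ₀, fun _ => Classical.arbitrary _⟩
  KB := β.Idx × g.KB
  kb₀ := (σ₀, g.kb₀)
  card_H := by
    obtain ⟨m, hm⟩ := hD
    obtain ⟨l, hl⟩ := g.card_H
    refine ⟨m + m + l * Fintype.card β.Idx, ?_⟩
    simp [hm, hl, pow_add, pow_mul]
  -- With τ = `k.1`, she stores u_τ W u_σ₀⁻¹: the outcome σ₀ cancels the last factor and leaves u_τ
  -- W. For any other outcome i the data has undergone u_τ W u_σ₀⁻¹ u_i, which she can compute, and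
  -- member i of the bank is prepared for the residual unitary.
  alice W k x := ((Real.sqrt (Fintype.card D) : ℂ)⁻¹ *
      (β.u k.1 * (W * (β.u σ₀)⁻¹)).1 x.1.2 x.1.1) *
    ∏ i, g.alice (residual β σ₀ W k.1 i) (k.2 i) (x.2 i)
  alice_complete W x y := by
    rw [Fintype.sum_prod_type]
    simp only [map_mul (starRingEnd ℂ), mul_mul_mul_comm _ (starRingEnd ℂ (∏ i, _))]
    simp only [← Finset.mul_sum, complete_bra_pi fun i => g.alice_complete _]
    simp only [← map_mul (starRingEnd ℂ)]
    rw [← Finset.sum_mul, β.complete_bra (W * (β.u σ₀)⁻¹) (x.1.2, x.1.1) (y.1.2, y.1.1)]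
    simp only [Prod.ext_iff]
    split_ifs <;> simp_all
  alice_norm W k := by
    have : Nonempty D := ⟨d₀⟩
    have hd : (Fintype.card D : ℝ) ≠ 0 := by exact_mod_cast Fintype.card_ne_zero
    rw [Fintype.sum_prod_type]
    simp only [norm_mul, mul_pow, ← Finset.mul_sum, norm_sqrt_card_inv_sq]
    rw [sum_norm_sq_prod fun i => g.alice (residual β σ₀ W k.1 i) (k.2 i), ← Finset.sum_mul,
      ← Finset.mul_sum, Fintype.sum_prod_type_right]
    rw [sum_norm_sq_unitary (β.u k.1 * (W * (β.u σ₀)⁻¹))]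
    simp only [g.alice_norm, Finset.prod_const, Finset.card_univ, Fintype.card_prod,
      Fintype.card_pi, Nat.cast_mul, Nat.cast_pow, β.card_idx, div_pow]
    field_simp
  -- After σ₀ nothing remains to be done; the identity is attached to the single outcome `kb₀` and
  -- zero to the others, which keeps the family complete.
  bob k := (if k.1 = σ₀ then (if k.2 = g.kb₀ then 1 else 0) else
      embed (fun s : D × ((D × D) × (β.Idx → g.H)) => (s.1, s.2.2 k.1))
        (fun s t => (t.1, (s.2.1, Function.update s.2.2 k.1 t.2))) (g.bob k.2)) *
    embed (fun s : D × ((D × D) × (β.Idx → g.H)) => (s.1, s.2.1))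
      (fun s t => (t.1, (t.2, s.2.2))) (bellRound β d₀ k.1)
  bob_complete := by
    refine Complete.mul (K := fun σ : β.Idx => embed (fun s : D × ((D × D) × (β.Idx → g.H)) =>
      (s.1, s.2.1)) (fun s t => (t.1, (t.2, s.2.2))) (bellRound β d₀ σ))
      (L := fun σ kb => (if σ = σ₀ then (if kb = g.kb₀ then 1 else 0) else
      embed (fun s : D × ((D × D) × (β.Idx → g.H)) => (s.1, s.2.2 σ))
        (fun s t => (t.1, (s.2.1, Function.update s.2.2 σ t.2))) (g.bob kb))) ?_ ?_
    · refine IsLens.complete_embed ⟨?_, ?_, ?_⟩ (complete_bellRound β d₀) <;> intros <;> rfl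
    · intro σ
      by_cases hσ : σ = σ₀
      · simp only [hσ, if_true, Complete]
        rw [Finset.sum_eq_single g.kb₀] <;> simp +contextual
      · simp only [hσ, if_false]
        refine IsLens.complete_embed ⟨?_, ?_, ?_⟩ g.bob_complete <;> intros <;> simp
  -- Each of the d² Bell outcomes has probability 1/d².
  w k := ((Fintype.card D : ℝ) ^ 2)⁻¹ *
    if k.1 = σ₀ then (if k.2 = g.kb₀ then 1 else 0) else g.w k.2
  w_nonneg k := by
    have := g.w_nonneg k.2
    split_ifs <;> positivity
  key k l := if l.1 = σ₀ then k.1 else g.key (k.2 l.1) l.2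
  junk W k l x := ((Fintype.card D : ℂ)⁻¹ * if x.1 = (d₀, d₀) then 1 else 0) *
    ∏ i, (if l.1 = σ₀ then fun i => g.alice (residual β σ₀ W k.1 i) (k.2 i) else
      Function.update (fun i => g.alice (residual β σ₀ W k.1 i) (k.2 i)) l.1
        (g.junk (residual β σ₀ W k.1 l.1) (k.2 l.1) l.2)) i (x.2 i)
  junk_norm W k l hw := by
    have : Nonempty D := ⟨d₀⟩
    have hd : (Fintype.card D : ℝ) ≠ 0 := by exact_mod_cast Fintype.card_ne_zero
    have h1 : ∏ i, ∑ x, ‖(if l.1 = σ₀ then fun i => g.alice (residual β σ₀ W k.1 i) (k.2 i) else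
      Function.update (fun i => g.alice (residual β σ₀ W k.1 i) (k.2 i)) l.1
        (g.junk (residual β σ₀ W k.1 l.1) (k.2 l.1) l.2)) i x‖ ^ 2 =
        (if l.1 = σ₀ then (if l.2 = g.kb₀ then 1 else 0) else g.w l.2) *
          ((Fintype.card g.H : ℝ) / Fintype.card g.KA) ^ Fintype.card β.Idx := by
      by_cases hl : l.1 = σ₀
      · have h2 : l.2 = g.kb₀ := by
          by_contra h
          simp [hl, h] at hw
        simp [hl, h2, g.alice_norm, div_pow]
      · simp only [hl, if_false] at hw ⊢
        rw [← Finset.mul_prod_erase Finset.univ _ (Finset.mem_univ l.1), Function.update_self,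
          g.junk_norm _ _ _ (right_ne_zero_of_mul hw), Finset.prod_congr rfl fun i hi => by
            rw [Function.update_of_ne (Finset.ne_of_mem_erase hi), g.alice_norm]]
        rw [Finset.prod_const, mul_assoc, ← pow_succ', Finset.card_erase_add_one (Finset.mem_univ _),
          Finset.card_univ]
    generalize (if l.1 = σ₀ then fun i => g.alice (residual β σ₀ W k.1 i) (k.2 i) else
      Function.update (fun i => g.alice (residual β σ₀ W k.1 i) (k.2 i)) l.1
        (g.junk (residual β σ₀ W k.1 l.1) (k.2 l.1) l.2)) = F at h1 ⊢
    rw [sum_norm_sq_round d₀ F, h1]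
    simp only [Fintype.card_prod, Fintype.card_pi, Nat.cast_mul, Finset.prod_const,
      Finset.card_univ, Nat.cast_pow, β.card_idx, div_pow]
    field_simp
  correct W k l hw φ := by
    have hb : (embed (fun s : D × ((D × D) × (β.Idx → g.H)) => (s.1, s.2.1))
        (fun s t => (t.1, (t.2, s.2.2))) (bellRound β d₀ l.1) *ᵥ fun s =>
          φ s.1 * (((Real.sqrt (Fintype.card D) : ℂ)⁻¹ *
            (β.u k.1 * (W * (β.u σ₀)⁻¹)).1 s.2.1.2 s.2.1.1) *
            ∏ i, g.alice (residual β σ₀ W k.1 i) (k.2 i) (s.2.2 i))) =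
        fun s => ((β.u k.1 * (W * (β.u σ₀)⁻¹)).1 *ᵥ ((β.u l.1).1 *ᵥ φ)) s.1 *
          (((Fintype.card D : ℂ)⁻¹ * if s.2.1 = (d₀, d₀) then 1 else 0) *
            ∏ i, g.alice (residual β σ₀ W k.1 i) (k.2 i) (s.2.2 i)) := by
      funext s
      rw [embed_mulVec, applyTo_apply]
      have := bellRound_mulVec β d₀ l.1 ((∏ i, g.alice (residual β σ₀ W k.1 i) (k.2 i) (s.2.2 i)) • φ)
        (β.u k.1 * (W * (β.u σ₀)⁻¹)).1
      convert congrFun this (s.1, s.2.1) using 1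
      · congr 1
        funext t
        simp only [Pi.smul_apply, smul_eq_mul]
        ring
      · simp only [Matrix.mulVec_smul, Pi.smul_apply, smul_eq_mul]
        ring
    rw [← Matrix.mulVec_mulVec, hb]
    by_cases hl : l.1 = σ₀
    · have h2 : l.2 = g.kb₀ := by
        by_contra h
        simp [hl, h] at hw
      simp only [hl, h2, if_true, Matrix.one_mulVec]
      funext s
      congr 1
      simp [Matrix.mulVec_mulVec, Matrix.mul_assoc]
    · simp only [hl, if_false] at hw ⊢
      have hg := g.correct (residual β σ₀ W k.1 l.1) (k.2 l.1) l.2 (right_ne_zero_of_mul hw)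
        ((β.u k.1 * (W * (β.u σ₀)⁻¹)).1 *ᵥ ((β.u l.1).1 *ᵥ φ))
      -- The residual undoes what the failed round applied and then applies `W`.
      have hr : (residual β σ₀ W k.1 l.1).1 *ᵥ
          ((β.u k.1 * (W * (β.u σ₀)⁻¹)).1 *ᵥ ((β.u l.1).1 *ᵥ φ)) = W.1 *ᵥ φ := by
        rw [Matrix.mulVec_mulVec, Matrix.mulVec_mulVec, ← Matrix.UnitaryGroup.mul_val,
          ← Matrix.UnitaryGroup.mul_val, residual]
        congr 2
        group
      rw [hr] at hg
      funext s
      rw [embed_mulVec, applyTo_apply]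
      have := mulVec_bank (g := fun i => g.alice (residual β σ₀ W k.1 i) (k.2 i)) hg s.2.2 s.1
      have h3 := congrArg
        (fun z => ((Fintype.card D : ℂ)⁻¹ * if s.2.1 = (d₀, d₀) then 1 else 0) * z) this
      simp only [← smul_eq_mul (a := ((Fintype.card D : ℂ)⁻¹ * _))] at h3
      rw [← Pi.smul_apply, ← Matrix.mulVec_smul] at h3
      convert h3 using 1
      · congr 2
        funext t
        simp only [Pi.smul_apply, smul_eq_mul]
        ring
      · simp only [smul_eq_mul]
        ring

/-- One of the d² equally likely outcomes succeeds at once; each of the others leaves the failure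
probability of `g`. -/
theorem Gadget.success_succ (g : Gadget β) (d₀ : D) (σ₀ : β.Idx)
    (hD : ∃ m, Fintype.card D = 2 ^ m) :
    1 - (g.succ d₀ σ₀ hD).success =
      (1 - ((Fintype.card D : ℝ) ^ 2)⁻¹) * (1 - g.success) := by
  have : Nonempty D := ⟨d₀⟩
  have hd : (Fintype.card D : ℝ) ≠ 0 := by exact_mod_cast Fintype.card_ne_zero
  have h1 : (g.succ d₀ σ₀ hD).success = ∑ k : β.Idx × g.KB, ((Fintype.card D : ℝ) ^ 2)⁻¹ *
    if k.1 = σ₀ then (if k.2 = g.kb₀ then 1 else 0) else g.w k.2 := rfl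
  have h2 : ∀ σ : β.Idx, ∑ kb, (if σ = σ₀ then (if kb = g.kb₀ then 1 else 0) else g.w kb) =
      g.success + if σ = σ₀ then 1 - g.success else 0 := by
    intro σ
    by_cases h : σ = σ₀
    · simp [h]
    · simp [h, Gadget.success]
  rw [h1, ← Finset.mul_sum, Fintype.sum_prod_type, Finset.sum_congr rfl fun σ _ => h2 σ,
    Finset.sum_add_distrib]
  simp only [Finset.sum_const, Finset.card_univ, nsmul_eq_mul, Finset.sum_ite_eq', Finset.mem_univ,
    if_true, β.card_idx, Nat.cast_pow]
  field_simp
  ring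

/-- Protocols with success probability arbitrarily close to one. -/
theorem exists_gadget (β : ErrorBasis D) (d₀ : D) (hD : ∃ m, Fintype.card D = 2 ^ m) (δ : ℝ)
    (hδ : 0 < δ) : ∃ g : Gadget β, 1 - δ ≤ g.success := by
  have : Nonempty D := ⟨d₀⟩
  have hd : (1 : ℝ) ≤ Fintype.card D := by exact_mod_cast Fintype.card_pos
  have : Nonempty β.Idx := by
    rw [← Fintype.card_pos_iff, β.card_idx]
    exact pow_pos Fintype.card_pos _
  obtain ⟨σ₀⟩ := this
  -- The recursion starts at the protocol that always fails, whose failure probability is 1.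
  have h : ∀ L : ℕ, ∃ g : Gadget β, 1 - g.success = (1 - ((Fintype.card D : ℝ) ^ 2)⁻¹) ^ L := by
    intro L
    induction L with
    | zero => exact ⟨Gadget.zero σ₀, by simp [Gadget.success, Gadget.zero]⟩
    | succ L ih =>
      obtain ⟨g, hg⟩ := ih
      exact ⟨g.succ d₀ σ₀ hD, by rw [g.success_succ, hg, ← pow_succ']⟩
  have h1 : 0 ≤ 1 - ((Fintype.card D : ℝ) ^ 2)⁻¹ := by
    rw [sub_nonneg]
    exact inv_le_one_of_one_le₀ (one_le_pow₀ hd)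
  have h2 : 1 - ((Fintype.card D : ℝ) ^ 2)⁻¹ < 1 := by
    have : 0 < ((Fintype.card D : ℝ) ^ 2)⁻¹ := by positivity
    linarith
  obtain ⟨L, hL⟩ := exists_pow_lt_of_lt_one hδ h2
  obtain ⟨g, hg⟩ := h L
  exact ⟨g, by linarith⟩

end Succ

/-! ### Operations of the dishonest provers within one step -/

section Local

variable {A B R Hi H : Type}

/-- Labels of the entangled systems used in one step: one for teleporting the register of `P₀`, one
for returning it, and a bank of resources. -/
abbrev SlotOf (A Hi H : Type) := A × A × (Hi → H)

theorem isLens_bank : IsLens (fun s : A × SlotOf A Hi H => s.2.2.2)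
    (fun s t => (s.1, s.2.1, s.2.2.1, t)) := by
  constructor <;> intros <;> rfl

theorem isLens_tele : IsLens (fun s : A × SlotOf A Hi H => (s.1, s.2.1))
    (fun s t => (t.1, t.2, s.2.2)) := by
  constructor <;> intros <;> rfl

theorem isLens_out : IsLens (fun s : A × SlotOf A Hi H => (s.1, s.2.2.1))
    (fun s t => (t.1, s.2.1, t.2, s.2.2.2)) := by
  constructor <;> intros <;> rfl

theorem isLens_return : IsLens (fun s : B × SlotOf A Hi H × R => (s.2.1.1, s.2.1.2.1))
    (fun s t => (s.1, (t.1, t.2, s.2.1.2.2), s.2.2)) := by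
  constructor <;> intros <;> rfl

theorem isLens_gadget [DecidableEq Hi] (h : Hi) :
    IsLens (fun s : B × SlotOf A Hi H × R => ((s.2.1.1, s.1, s.2.2), s.2.1.2.2 h))
      (fun s t => (t.1.2.1, (t.1.1, s.2.1.2.1, Function.update s.2.1.2.2 h t.2), t.1.2.2)) := by
  constructor <;> intros <;> simp

variable [Fintype A] [DecidableEq A] [Fintype B] [DecidableEq B]
  [Fintype R] [DecidableEq R] [Fintype Hi] [DecidableEq Hi] [Fintype H] [DecidableEq H]

/-- Product of three unitaries. -/
def kron3 (a : Matrix.unitaryGroup A ℂ) (b : Matrix.unitaryGroup B ℂ)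
    (c : Matrix.unitaryGroup R ℂ) : Matrix.unitaryGroup (A × B × R) ℂ :=
  ⟨Matrix.kroneckerMap (· * ·) a.1 (Matrix.kroneckerMap (· * ·) b.1 c.1),
    Matrix.kronecker_mem_unitary a.2 (Matrix.kronecker_mem_unitary b.2 c.2)⟩

theorem kron3_mul (a a' : Matrix.unitaryGroup A ℂ) (b b' : Matrix.unitaryGroup B ℂ)
    (c c' : Matrix.unitaryGroup R ℂ) :
    kron3 a b c * kron3 a' b' c' = kron3 (a * a') (b * b') (c * c') := by
  apply Subtype.ext
  simp [kron3, Matrix.mul_kronecker_mul]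

theorem kron3_left_mulVec (a : Matrix.unitaryGroup A ℂ) (φ : A × B × R → ℂ) (x : A) (y : B × R) :
    ((kron3 a (1 : Matrix.unitaryGroup B ℂ) (1 : Matrix.unitaryGroup R ℂ)).1 *ᵥ φ) (x, y) =
      ∑ x', a.1 x x' * φ (x', y) := by
  simp only [kron3, Matrix.mulVec, dotProduct, Matrix.kroneckerMap_apply,
    Matrix.UnitaryGroup.one_val]
  rw [Fintype.sum_prod_type]
  refine Finset.sum_congr rfl fun x' _ => ?_
  rw [Finset.sum_eq_single y]
  · simp
  · rintro ⟨b, r⟩ _ hy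
    obtain ⟨b', r'⟩ := y
    simp only [Matrix.one_apply]
    split_ifs <;> simp_all
  · simp

theorem kron3_middle_mulVec (b : Matrix.unitaryGroup B ℂ) (φ : A × B × R → ℂ) (x : A) (y : B)
    (z : R) :
    ((kron3 (1 : Matrix.unitaryGroup A ℂ) b (1 : Matrix.unitaryGroup R ℂ)).1 *ᵥ φ) (x, y, z) =
      ∑ y', b.1 y y' * φ (x, y', z) := by
  simp only [kron3, Matrix.mulVec, dotProduct, Matrix.kroneckerMap_apply,
    Matrix.UnitaryGroup.one_val]
  simp [Fintype.sum_prod_type, Matrix.one_apply]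

theorem kron3_right_mulVec (c : Matrix.unitaryGroup R ℂ) (φ : A × B × R → ℂ) (x : A) (y : B)
    (z : R) :
    ((kron3 (1 : Matrix.unitaryGroup A ℂ) (1 : Matrix.unitaryGroup B ℂ) c).1 *ᵥ φ) (x, y, z) =
      ∑ z', c.1 z z' * φ (x, y, z') := by
  simp only [kron3, Matrix.mulVec, dotProduct, Matrix.kroneckerMap_apply,
    Matrix.UnitaryGroup.one_val]
  simp [Fintype.sum_prod_type, Matrix.one_apply]

/-- Kraus operators of a Bell measurement that resets the measured systems. -/
def bellReset (β : ErrorBasis A) (a₀ : A) (i : β.Idx) : Matrix (A × A) (A × A) ℂ :=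
  Matrix.of fun t s => if t = (a₀, a₀) then
    (Real.sqrt (Fintype.card A) : ℂ)⁻¹ * (β.u i).1 s.2 s.1 else 0

theorem complete_bellReset (β : ErrorBasis A) (a₀ : A) : Complete (bellReset β a₀) := by
  refine complete_of_bra (a₀, a₀) fun s s' => ?_
  have := β.complete_bra 1 (s.2, s.1) (s'.2, s'.1)
  simp only [mul_one] at this
  rw [this]
  simp only [Prod.ext_iff, and_comm]

/-- Kraus operators that project every system of a bank and reset the bank. -/
def bankReset (h₀ : H) (bra : Hi → H → ℂ) : Matrix (Hi → H) (Hi → H) ℂ :=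
  Matrix.of fun t s => if t = (fun _ => h₀) then ∏ h, bra h (s h) else 0

theorem complete_bankReset {K : Type} [Fintype K] (h₀ : H) {bra : Hi → K → H → ℂ}
    (hb : ∀ i x y, ∑ k, conj (bra i k x) * bra i k y = if x = y then 1 else 0) :
    Complete fun k : Hi → K => bankReset h₀ fun h => bra h (k h) :=
  complete_of_bra _ (complete_bra_pi hb)

/-- A matrix on the bank. -/
def onBank (M : Matrix (Hi → H) (Hi → H) ℂ) : Matrix (A × SlotOf A Hi H) (A × SlotOf A Hi H) ℂ :=
  embed (fun s => s.2.2.2) (fun s t => (s.1, s.2.1, s.2.2.1, t)) M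

/-- A matrix on the message register of `P₀` and the system for teleporting it. -/
def onTele (M : Matrix (A × A) (A × A) ℂ) : Matrix (A × SlotOf A Hi H) (A × SlotOf A Hi H) ℂ :=
  embed (fun s => (s.1, s.2.1)) (fun s t => (t.1, t.2, s.2.2)) M

/-- A matrix on the message register of `P₀` and the system in which it is returned to her. -/
def onOut (M : Matrix (A × A) (A × A) ℂ) : Matrix (A × SlotOf A Hi H) (A × SlotOf A Hi H) ℂ :=
  embed (fun s => (s.1, s.2.2.1)) (fun s t => (t.1, s.2.1, t.2, s.2.2.2)) M

/-- A matrix on the two systems by which `P₁` receives and returns the register of `P₀`. -/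
def onReturn (M : Matrix (A × A) (A × A) ℂ) :
    Matrix (B × SlotOf A Hi H × R) (B × SlotOf A Hi H × R) ℂ :=
  embed (fun s => (s.2.1.1, s.2.1.2.1)) (fun s t => (s.1, (t.1, t.2, s.2.1.2.2), s.2.2)) M

/-- A matrix on the data of the honest prover, all held by `P₁`, and resource `h` of the bank. -/
def onData (h : Hi) (M : Matrix ((A × B × R) × H) ((A × B × R) × H) ℂ) :
    Matrix (B × SlotOf A Hi H × R) (B × SlotOf A Hi H × R) ℂ :=
  embed (fun s => ((s.2.1.1, s.1, s.2.2), s.2.1.2.2 h))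
    (fun s t => (t.1.2.1, (t.1.1, s.2.1.2.1, Function.update s.2.1.2.2 h t.2), t.1.2.2)) M

/-- The instrument of `P₀`: teleport the register to `P₁`, then measure the bank. -/
def firstFalse (β : ErrorBasis A) (a₀ : A) (h₀ : H) (bra : Hi → H → ℂ) (i : β.Idx) :
    Matrix (A × SlotOf A Hi H) (A × SlotOf A Hi H) ℂ :=
  onBank (bankReset h₀ bra) * onTele (bellReset β a₀ i)

/-- The instrument of `P₁`: use resource `h` of the bank, then teleport one register to `P₀`. -/
def firstTrue (β : ErrorBasis A) (a₀ : A) (h : Hi)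
    (M : Matrix ((A × B × R) × H) ((A × B × R) × H) ℂ) (i : β.Idx) :
    Matrix (B × SlotOf A Hi H × R) (B × SlotOf A Hi H × R) ℂ :=
  onReturn (bellReset β a₀ i) * onData h M

/-- Swapping two systems of the same kind and applying a unitary to the first. -/
def swapCorrect (V : Matrix.unitaryGroup A ℂ) : Matrix (A × A) (A × A) ℂ :=
  Matrix.of fun t s => if t.2 = s.1 then V.1 t.1 s.2 else 0

theorem swapCorrect_mem (V : Matrix.unitaryGroup A ℂ) :
    swapCorrect V ∈ Matrix.unitaryGroup (A × A) ℂ := by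
  rw [Matrix.mem_unitaryGroup_iff']
  ext ⟨s, s'⟩ ⟨r, r'⟩
  rw [Matrix.mul_apply, Fintype.sum_prod_type]
  have h := sum_conj_mul_unitary V s' r'
  by_cases hs : s = r
  · subst hs
    simpa [swapCorrect, Matrix.star_apply, Matrix.one_apply] using h
  · simp [swapCorrect, Matrix.star_apply, hs, Ne.symm hs]

/-- The final operation of `P₀`: swap the returned register out and correct it. -/
def secondFalse (V : Matrix.unitaryGroup A ℂ) :
    Matrix (A × SlotOf A Hi H) (A × SlotOf A Hi H) ℂ :=
  onOut (swapCorrect V)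

theorem complete_firstFalse {K : Type} [Fintype K] (β : ErrorBasis A) (a₀ : A) (h₀ : H)
    {bra : β.Idx → Hi → K → H → ℂ}
    (hb : ∀ a i x y, ∑ k, conj (bra a i k x) * bra a i k y = if x = y then 1 else 0) :
    Complete fun c : β.Idx × (Hi → K) =>
      firstFalse β a₀ h₀ (fun h => bra c.1 h (c.2 h)) c.1 :=
  Complete.mul (K := fun a : β.Idx => (onTele (bellReset β a₀ a) :
      Matrix (A × SlotOf A Hi H) (A × SlotOf A Hi H) ℂ))
    (L := fun a (k : Hi → K) => onBank (bankReset h₀ fun h => bra a h (k h)))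
    (isLens_tele.complete_embed (complete_bellReset β a₀))
    fun a => isLens_bank.complete_embed (complete_bankReset h₀ (hb a))

theorem complete_firstTrue {K : Type} [Fintype K] (β : ErrorBasis A) (a₀ : A) (h : Hi)
    {M : K → Matrix ((A × B × R) × H) ((A × B × R) × H) ℂ} (hM : Complete M) :
    Complete fun c : K × β.Idx => firstTrue β a₀ h (M c.1) c.2 :=
  Complete.mul (K := fun k : K => onData h (M k)) (L := fun _ i => onReturn (bellReset β a₀ i))
    ((isLens_gadget h).complete_embed hM)
    fun _ => isLens_return.complete_embed (complete_bellReset β a₀)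

theorem secondFalse_mem (V : Matrix.unitaryGroup A ℂ) :
    (secondFalse V : Matrix (A × SlotOf A Hi H) (A × SlotOf A Hi H) ℂ) ∈
      Matrix.unitaryGroup (A × SlotOf A Hi H) ℂ :=
  embed_mem_unitaryGroup isLens_out (swapCorrect_mem V)

/-- A matrix applied to the first of two systems. -/
abbrev onFst {S T : Type} [Fintype S] (M : Matrix S S ℂ) : (S × T → ℂ) → (S × T → ℂ) :=
  applyTo (fun s : S × T => s.1) (fun s t => (t, s.2)) M

/-- A matrix applied to the second of two systems. -/
abbrev onSnd {S T : Type} [Fintype T] (M : Matrix T T ℂ) : (S × T → ℂ) → (S × T → ℂ) :=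
  applyTo (fun s : S × T => s.2) (fun s t => (s.1, t)) M

/-- Contracting with the maximally entangled pair moves the register to the half at `P₁`, with the
error `β.u i`; likewise the projections of the bank reappear as vectors on the other halves. The
pair for returning the register stays entangled, which is the last condition on the right. -/
theorem onFst_firstFalse (β : ErrorBasis A) (a₀ : A) (h₀ : H) (bra : Hi → H → ℂ) (i : β.Idx)
    (φ : A × B × R → ℂ) (c : ℂ) :
    onFst (firstFalse β a₀ h₀ bra i) (fun s : (A × SlotOf A Hi H) × (B × SlotOf A Hi H × R) =>
        φ (s.1.1, s.2.1, s.2.2.2) * if s.1.2 = s.2.2.1 then c else 0) =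
      fun s => ((kron3 (β.u i) 1 1).1 *ᵥ φ) (s.2.2.1.1, s.2.1, s.2.2.2) *
        (∏ h, bra h (s.2.2.1.2.2 h)) *
        if s.1.1 = a₀ ∧ s.1.2.1 = a₀ ∧ s.1.2.2.2 = (fun _ => h₀) ∧ s.1.2.2.1 = s.2.2.1.2.1 then
          (Real.sqrt (Fintype.card A) : ℂ)⁻¹ * c else 0 := by
  funext ⟨⟨a, tf, of, bf⟩, b, ⟨tt, ot, bt⟩, r⟩
  rw [kron3_left_mulVec]
  rw [onFst, firstFalse, applyTo_apply, ← Matrix.mulVec_mulVec, onBank, onTele, embed_mulVec,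
    embed_mulVec]
  simp only [applyTo, bankReset, bellReset, Matrix.of_apply, Prod.mk.injEq]
  by_cases h1 : a = a₀ <;> by_cases h2 : tf = a₀ <;> by_cases h3 : bf = fun _ => h₀ <;>
    by_cases h4 : of = ot
  all_goals simp only [h1, h2, h3, h4, and_self, and_true, true_and, and_false, false_and, if_true,
    if_false, zero_mul, mul_zero, Finset.sum_const_zero]
  rw [Finset.sum_eq_single bt]
  · rw [Fintype.sum_prod_type, mul_assoc, Finset.sum_mul, Finset.mul_sum]
    refine Finset.sum_congr rfl fun x _ => ?_
    rw [Finset.sum_eq_single tt]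
    · simp only [and_true, if_true]
      ring
    · intro y _ hy
      simp [hy]
    · simp
  · intro y _ hy
    simp [hy]
  · simp

end Local

/-! ### The state after each operation of a step -/

section Local

variable {A B R Hi H : Type} [Fintype A] [DecidableEq A] [Fintype B] [DecidableEq B]
  [Fintype R] [DecidableEq R] [Fintype Hi] [DecidableEq Hi] [Fintype H] [DecidableEq H]

/-- What is left of the entangled systems of a step. -/
def leftover (a₀ : A) (h₀ : H) (g : Hi → H → ℂ) (c : ℂ) (x y : SlotOf A Hi H) : ℂ :=
  (∏ h, g h (y.2.2 h)) * if x.1 = a₀ ∧ x.2.1 = a₀ ∧ x.2.2 = (fun _ => h₀) ∧ y.1 = a₀ ∧ y.2.1 = a₀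
    then c else 0

/-- `hM` is the correctness of the gadget in use, carried to the bank by `mulVec_bank`. The Bell
measurement then moves the register into the return slot at `P₀`, with one more error. -/
theorem onSnd_firstTrue (β : ErrorBasis A) (a₀ : A) (h₀ : H) (h : Hi)
    {M : Matrix ((A × B × R) × H) ((A × B × R) × H) ℂ} (i : β.Idx) {φ φ' : A × B × R → ℂ}
    {bra : Hi → H → ℂ} {χ : H → ℂ}
    (hM : (M *ᵥ fun s => φ s.1 * bra h s.2) = fun s => φ' s.1 * χ s.2) (c : ℂ) :
    onSnd (firstTrue β a₀ h M i) (fun s : (A × SlotOf A Hi H) × (B × SlotOf A Hi H × R) =>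
        φ (s.2.2.1.1, s.2.1, s.2.2.2) * (∏ h, bra h (s.2.2.1.2.2 h)) *
        if s.1.1 = a₀ ∧ s.1.2.1 = a₀ ∧ s.1.2.2.2 = (fun _ => h₀) ∧ s.1.2.2.1 = s.2.2.1.2.1 then
          c else 0) =
      fun s => ((kron3 (β.u i) 1 1).1 *ᵥ φ') (s.1.2.2.1, s.2.1, s.2.2.2) *
        (∏ k, Function.update bra h χ k (s.2.2.1.2.2 k)) *
        if s.1.1 = a₀ ∧ s.1.2.1 = a₀ ∧ s.1.2.2.2 = (fun _ => h₀) ∧ s.2.2.1.1 = a₀ ∧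
            s.2.2.1.2.1 = a₀ then (Real.sqrt (Fintype.card A) : ℂ)⁻¹ * c else 0 := by
  funext ⟨⟨a, tf, of, bf⟩, b, ⟨tt, ot, bt⟩, r⟩
  -- The gadget does not touch the return pair, so the condition that it is entangled acts as a
  -- scalar.
  have h1 : ∀ (d : ℂ) (t : B × SlotOf A Hi H × R), ((onData h M :
      Matrix (B × SlotOf A Hi H × R) (B × SlotOf A Hi H × R) ℂ) *ᵥ fun t =>
        φ (t.2.1.1, t.1, t.2.2) * (∏ k, bra k (t.2.1.2.2 k)) *
          if of = t.2.1.2.1 then d else 0) t =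
        φ' (t.2.1.1, t.1, t.2.2) * (∏ k, Function.update bra h χ k (t.2.1.2.2 k)) *
          if of = t.2.1.2.1 then d else 0 := by
    intro d t
    rw [onData, embed_mulVec, applyTo_apply]
    have := congrArg (fun z => (if of = t.2.1.2.1 then d else 0) * z)
      (mulVec_bank hM t.2.1.2.2 (t.2.1.1, t.1, t.2.2))
    simp only [← smul_eq_mul (a := if of = t.2.1.2.1 then d else 0)] at this
    rw [← Pi.smul_apply, ← Matrix.mulVec_smul] at this
    convert this using 1
    · congr 1
      funext s
      simp only [Pi.smul_apply, smul_eq_mul]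
      ring
    · simp only [smul_eq_mul]
      ring
  rw [kron3_left_mulVec, onSnd, firstTrue, applyTo_apply, ← Matrix.mulVec_mulVec]
  by_cases h2 : a = a₀ ∧ tf = a₀ ∧ bf = fun _ => h₀
  · simp only [h2, true_and]
    rw [funext (h1 c), onReturn, embed_mulVec]
    simp only [applyTo, bellReset, Matrix.of_apply, Prod.mk.injEq]
    by_cases h3 : tt = a₀ ∧ ot = a₀
    · simp only [h3, and_self, if_true]
      rw [Fintype.sum_prod_type, mul_assoc, Finset.sum_mul]
      refine Finset.sum_congr rfl fun x _ => ?_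
      rw [Finset.sum_eq_single of]
      · simp only [if_true]
        ring
      · intro y _ hy
        simp [hy.symm]
      · simp
    · simp [h3]
  · have h3 : ∀ p : Prop, ¬(a = a₀ ∧ tf = a₀ ∧ (bf = fun _ => h₀) ∧ p) := by tauto
    simp only [h3, if_false, mul_zero]
    rw [← Pi.zero_def, Matrix.mulVec_zero, Matrix.mulVec_zero]
    rfl

/-- The swap exchanges the returned register with the reset message register, so `a₀` ends up in the
return slot. -/
theorem onFst_secondFalse (a₀ : A) (h₀ : H) (V : Matrix.unitaryGroup A ℂ) (φ : A × B × R → ℂ)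
    (g : Hi → H → ℂ) (c : ℂ) :
    onFst (secondFalse V) (fun s : (A × SlotOf A Hi H) × (B × SlotOf A Hi H × R) =>
        φ (s.1.2.2.1, s.2.1, s.2.2.2) * (∏ k, g k (s.2.2.1.2.2 k)) *
        if s.1.1 = a₀ ∧ s.1.2.1 = a₀ ∧ s.1.2.2.2 = (fun _ => h₀) ∧ s.2.2.1.1 = a₀ ∧
            s.2.2.1.2.1 = a₀ then c else 0) =
      fun s => ((kron3 V 1 1).1 *ᵥ φ) (s.1.1, s.2.1, s.2.2.2) *
        leftover a₀ h₀ g c s.1.2 s.2.2.1 := by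
  funext ⟨⟨a, tf, of, bf⟩, b, ⟨tt, ot, bt⟩, r⟩
  rw [kron3_left_mulVec, onFst, secondFalse, applyTo_apply, onOut, embed_mulVec]
  simp only [applyTo, swapCorrect, Matrix.of_apply, leftover]
  rw [Fintype.sum_prod_type, Finset.sum_eq_single of]
  · simp only [if_true]
    rw [Finset.sum_mul]
    refine Finset.sum_congr rfl fun x _ => ?_
    rw [← mul_assoc, ← mul_assoc, mul_assoc]
    congr 2
    exact if_congr (by tauto) rfl rfl
  · intro y _ hy
    simp [hy.symm]
  · simp

theorem onMsg_secondTrue (V : Matrix.unitaryGroup B ℂ) (φ : A × B × R → ℂ)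
    (f : SlotOf A Hi H → SlotOf A Hi H → ℂ) :
    onSnd (embed (fun s => s.1) (fun s t => (t, s.2)) V.1)
      (fun s : (A × SlotOf A Hi H) × (B × SlotOf A Hi H × R) =>
        φ (s.1.1, s.2.1, s.2.2.2) * f s.1.2 s.2.2.1) =
      fun s => ((kron3 1 V 1).1 *ᵥ φ) (s.1.1, s.2.1, s.2.2.2) * f s.1.2 s.2.2.1 := by
  funext ⟨⟨a, sf⟩, b, st, r⟩
  rw [kron3_middle_mulVec, onSnd, applyTo_apply, embed_mulVec]
  simp only [applyTo]
  rw [Finset.sum_mul]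
  exact Finset.sum_congr rfl fun x _ => by ring

/-- A step of the attack on the systems it involves. -/
theorem local_step (βA : ErrorBasis A) (βB : ErrorBasis B) (βR : ErrorBasis R)
    (g : Gadget (βA.prod (βB.prod βR))) (a₀ : A) (h : Hi) (U : Matrix.unitaryGroup (A × B × R) ℂ)
    (w : Hi → Matrix.unitaryGroup (A × B × R) ℂ) (ρ : Matrix.unitaryGroup R ℂ) (i κ : βA.Idx)
    (hw : w h = U * (kron3 (βA.u i) 1 ρ)⁻¹) (ka : Hi → g.KA) (kb : g.KB) (hkb : g.w kb ≠ 0)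
    (τ : βA.Idx × βB.Idx × βR.Idx) (hτ : τ = g.key (ka h) kb) (φ : A × B × R → ℂ) (c : ℂ) :
    onSnd (embed (fun s => s.1) (fun s t => (t, s.2)) ((βB.u τ.2.1)⁻¹).1)
      (onFst (secondFalse (βA.u κ * βA.u τ.1)⁻¹)
        (onSnd (firstTrue βA a₀ h (g.bob kb) κ)
          (onFst (firstFalse βA a₀ g.h₀ (fun k => g.alice (w k) (ka k)) i)
            (fun s : (A × SlotOf A Hi g.H) × (B × SlotOf A Hi g.H × R) =>
              ((kron3 1 1 ρ).1 *ᵥ φ) (s.1.1, s.2.1, s.2.2.2) *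
                if s.1.2 = s.2.2.1 then c else 0)))) =
      fun s => ((kron3 1 1 (βR.u τ.2.2)).1 *ᵥ (U.1 *ᵥ φ)) (s.1.1, s.2.1, s.2.2.2) *
        leftover a₀ g.h₀ (Function.update (fun k => g.alice (w k) (ka k)) h
          (g.junk (w h) (ka h) kb)) ((Fintype.card A : ℂ)⁻¹ * c) s.1.2 s.2.2.1 := by
  rw [onFst_firstFalse]
  -- Since the error basis is a product, the error of the gadget splits into separate errors on the
  -- three registers.
  have hk : ((βA.prod (βB.prod βR)).u (g.key (ka h) kb)) =
      kron3 (βA.u τ.1) (βB.u τ.2.1) (βR.u τ.2.2) := by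
    rw [← hτ]
    rfl
  have hc := g.correct (w h) (ka h) kb hkb ((kron3 (βA.u i) 1 1).1 *ᵥ ((kron3 1 1 ρ).1 *ᵥ φ))
  rw [hk] at hc
  rw [onSnd_firstTrue βA a₀ g.h₀ h κ (bra := fun k => g.alice (w k) (ka k))
    (χ := g.junk (w h) (ka h) kb)
    (φ := (kron3 (βA.u i) 1 1).1 *ᵥ ((kron3 1 1 ρ).1 *ᵥ φ))
    (φ' := (kron3 (βA.u τ.1) (βB.u τ.2.1) (βR.u τ.2.2)).1 *ᵥ ((w h).1 *ᵥ
      ((kron3 (βA.u i) 1 1).1 *ᵥ ((kron3 1 1 ρ).1 *ᵥ φ)))) hc]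
  rw [onFst_secondFalse, onMsg_secondTrue]
  rw [← mul_assoc, sqrt_card_mul_self]
  funext s
  refine congrArg (· * _) (congrFun ?_ _)
  simp only [Matrix.mulVec_mulVec, ← Matrix.UnitaryGroup.mul_val, hw]
  congr 2
  -- The errors on the two message registers are cancelled; the one on the local register survives.
  have : kron3 1 1 (βR.u τ.2.2) = kron3 1 (βB.u τ.2.1)⁻¹ 1 * (kron3 (βA.u κ * βA.u τ.1)⁻¹ 1 1 *
      (kron3 (βA.u κ) 1 1 * kron3 (βA.u τ.1) (βB.u τ.2.1) (βR.u τ.2.2))) := by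
    simp [kron3_mul]
  rw [this]
  -- The teleportation error and the old error of the local register act on different systems, and
  -- the inverse in `hw` removes both.
  have h2 : kron3 (βA.u i) 1 ρ = kron3 (βA.u i) 1 1 * kron3 (1 : Matrix.unitaryGroup A ℂ)
      (1 : Matrix.unitaryGroup B ℂ) ρ := by
    simp [kron3_mul]
  rw [h2]
  group

theorem sum_norm_sq_leftover (a₀ : A) (h₀ : H) (g : Hi → H → ℂ) (c : ℂ) :
    ∑ p : SlotOf A Hi H × SlotOf A Hi H, ‖leftover a₀ h₀ g c p.1 p.2‖ ^ 2 =
      ‖c‖ ^ 2 * ∏ h, ∑ x, ‖g h x‖ ^ 2 := by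
  rw [Fintype.sum_prod_type, Finset.sum_eq_single (a₀, a₀, fun _ => h₀)]
  · rw [Fintype.sum_prod_type, Finset.sum_eq_single a₀]
    · rw [Fintype.sum_prod_type, Finset.sum_eq_single a₀]
      · simp only [leftover, and_self, if_true, norm_mul, mul_pow]
        rw [← Finset.sum_mul, sum_norm_sq_prod g, mul_comm]
      · intro y _ hy
        simp [leftover, hy]
      · simp
    · intro y _ hy
      simp [leftover, hy]
    · simp
  · rintro ⟨x, x', b⟩ _ hx
    refine Finset.sum_eq_zero fun y _ => ?_
    rw [leftover, if_neg]
    · simp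
    · rintro ⟨h1, h2, h3, _⟩
      exact hx (Prod.ext h1 (Prod.ext h2 h3))
  · simp

end Local

/-! ### The strategy of the dishonest provers -/

section Strategy

set_option synthInstance.maxSize 1000

variable {N : ℕ} (P : Program N)

/-- The data on which the honest prover acts in a step. -/
abbrev Program.Data (j : Fin N) := Qubits (P.n false j) × Qubits (P.n true j) × Qubits P.r

/-- Error bases of the registers. -/
abbrev qubitBasis (n : ℕ) : ErrorBasis (Qubits n) := shiftClock (Qubits n)

abbrev Program.basis (j : Fin N) : ErrorBasis (P.Data j) :=
  (qubitBasis (P.n false j)).prod ((qubitBasis (P.n true j)).prod (qubitBasis P.r))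

def Program.dataEquiv (j : Fin N) :
    P.Data j ≃ ((b : Side) → Qubits (P.n b j)) × Qubits P.r where
  toFun d := (fun b => match b with | false => d.1 | true => d.2.1, d.2.2)
  invFun d := (d.1 false, d.1 true, d.2)
  left_inv _ := rfl
  right_inv d := Prod.ext (funext fun b => by cases b <;> rfl) rfl

/-- The two classical messages of a step. -/
def Program.both {j : Fin N} (x : P.X false j) (y : P.X true j) : (b : Side) → P.X b j
  | false => x
  | true => y

/-- The unitary of the honest prover. -/
def Program.unitary (j : Fin N) (x : P.X false j) (y : P.X true j) :
    Matrix.unitaryGroup (P.Data j) ℂ :=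
  ⟨(P.U j (P.both x y)).1.submatrix (P.dataEquiv j) (P.dataEquiv j), by
    rw [Matrix.mem_unitaryGroup_iff', Matrix.star_eq_conjTranspose,
      Matrix.conjTranspose_submatrix, Matrix.submatrix_mul_equiv, ← Matrix.star_eq_conjTranspose,
      Matrix.mem_unitaryGroup_iff'.1 (P.U j (P.both x y)).2, Matrix.submatrix_one_equiv]⟩

variable (g : (j : Fin N) → Gadget (P.basis j))

/-- Outcomes of `P₁`; he repeats the classical message that he received. -/
def OutTrue (j : Fin N) : Type := P.X true j × ((g j).KB × (qubitBasis (P.n false j)).Idx)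

instance (j : Fin N) : Fintype (OutTrue P g j) := by unfold OutTrue; infer_instance

/-- What `P₁` knows when he starts a step: labels of the resources in the bank. -/
def Hist (j : Fin N) : Type := ((i : Set.Iio j) → OutTrue P g i) × P.X true j

instance (j : Fin N) : Fintype (Hist P g j) := by unfold Hist; infer_instance

instance (j : Fin N) : DecidableEq (Hist P g j) := Classical.decEq _

def Hist.mk {P : Program N} {g : (j : Fin N) → Gadget (P.basis j)} {j : Fin N}
    (k : (i : Set.Iio j) → OutTrue P g i) (x : P.X true j) : Hist P g j := (k, x)

/-- Outcomes of `P₀`. -/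
def OutFalse (j : Fin N) : Type := (qubitBasis (P.n false j)).Idx × (Hist P g j → (g j).KA)

instance (j : Fin N) : Fintype (OutFalse P g j) := by unfold OutFalse; infer_instance

/-- Labels of the entangled systems of a step. -/
abbrev Slot (j : Fin N) := SlotOf (Qubits (P.n false j)) (Hist P g j) (g j).H

theorem exists_card_slots : ∃ m, Fintype.card ((j : Fin N) → Slot P g j) = 2 ^ m := by
  choose l hl using fun j => (g j).card_H
  refine ⟨∑ j, (P.n false j + (P.n false j + l j * Fintype.card (Hist P g j))), ?_⟩
  rw [Fintype.card_pi, ← Finset.prod_pow_eq_pow_sum]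
  refine Finset.prod_congr rfl fun j _ => ?_
  simp [hl, pow_add, pow_mul]

/-- The number of EPR pairs. -/
def pairCount : ℕ := (exists_card_slots P g).choose

/-- Any bijection of labels serves: it is used at both ends, and the state of the EPR pairs is
diagonal with constant amplitudes, hence invariant under a common relabelling. -/
def slots : Qubits (pairCount P g) ≃ ((j : Fin N) → Slot P g j) :=
  Fintype.equivOfCardEq <| by
    rw [(exists_card_slots P g).choose_spec, Fintype.card_fun, Fintype.card_fin, Fintype.card_fin]
    rfl

variable {P g}

/-- The resource used by `P₁`, from his outcomes. -/
def histOf {j : Fin N} (k : (i : Set.Iic j) → OutTrue P g i) : Hist P g j :=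
  (fun i => k ⟨i, Set.mem_Iic.2 (le_of_lt (Set.mem_Iio.1 i.2))⟩, (k ⟨j, le_refl j⟩).1)

/-- The error after a successful step. -/
def stepKey {j : Fin N} (a : OutFalse P g j) (k : (i : Set.Iic j) → OutTrue P g i) :
    (qubitBasis (P.n false j)).Idx × (qubitBasis (P.n true j)).Idx × (qubitBasis P.r).Idx :=
  (g j).key (a.2 (histOf k)) (k ⟨j, le_refl j⟩).2.1

/-- The error of the local register before a step. -/
def gauge {j : Fin N} (a : (i : Set.Iio j) → OutFalse P g i)
    (k : (i : Set.Iio j) → OutTrue P g i) : Matrix.unitaryGroup (Qubits P.r) ℂ :=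
  -- Only the preceding step matters, because its target has absorbed the error left before it.
  -- Before step 0 there is no error.
  if h : 0 < j.1 then
    let i : Fin N := ⟨j.1 - 1, by omega⟩
    have hi : i < j := by rw [Fin.lt_def]; simp only [i]; omega
    (qubitBasis P.r).u (stepKey (a ⟨i, hi⟩) (fun l => k ⟨l.1, lt_of_le_of_lt l.2 hi⟩)).2.2
  else 1

/-- The unitary to be applied by `P₁` if he uses resource `h`. -/
def target {j : Fin N} (a : (i : Set.Iio j) → OutFalse P g i) (x : P.X false j)
    (α : (qubitBasis (P.n false j)).Idx) (h : Hist P g j) : Matrix.unitaryGroup (P.Data j) ℂ :=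
  -- The inverse removes the teleportation error and the pending error of the local register before
  -- the honest unitary acts. `P₀` knows `a`, `x` and `α`; what she lacks is supplied by the label
  -- `h`.
  P.unitary j x h.2 * (kron3 ((qubitBasis (P.n false j)).u α) 1 (gauge a h.1))⁻¹

variable (P g)

/-- The register and the entangled systems of a step at `P₀`. -/
def getFalse (j : Fin N) (i : Qubits (P.n false j) × (Qubits (pairCount P g) × Qubits P.r)) :
    Qubits (P.n false j) × Slot P g j :=
  (i.1, slots P g i.2.1 j)

def putFalse (j : Fin N) (i : Qubits (P.n false j) × (Qubits (pairCount P g) × Qubits P.r))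
    (s : Qubits (P.n false j) × Slot P g j) :
    Qubits (P.n false j) × (Qubits (pairCount P g) × Qubits P.r) :=
  (s.1, (slots P g).symm (Function.update (slots P g i.2.1) j s.2), i.2.2)

/-- The register, the entangled systems of a step and the local register at `P₁`. -/
def getTrue (j : Fin N) (i : Qubits (P.n true j) × (Qubits (pairCount P g) × Qubits P.r)) :
    Qubits (P.n true j) × Slot P g j × Qubits P.r :=
  (i.1, slots P g i.2.1 j, i.2.2)

def putTrue (j : Fin N) (i : Qubits (P.n true j) × (Qubits (pairCount P g) × Qubits P.r))
    (s : Qubits (P.n true j) × Slot P g j × Qubits P.r) :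
    Qubits (P.n true j) × (Qubits (pairCount P g) × Qubits P.r) :=
  (s.1, (slots P g).symm (Function.update (slots P g i.2.1) j s.2.1), s.2.2)

theorem isLens_false (j : Fin N) : IsLens (getFalse P g j) (putFalse P g j) := by
  constructor <;> intros <;> simp [getFalse, putFalse]

theorem isLens_true (j : Fin N) : IsLens (getTrue P g j) (putTrue P g j) := by
  constructor <;> intros <;> simp [getTrue, putTrue]

theorem isLens_fst {S T : Type} : IsLens (fun s : S × T => s.1) (fun s t => (t, s.2)) := by
  constructor <;> intros <;> rfl

abbrev Out : Side → Fin N → Type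
  | false, j => OutFalse P g j
  | true, j => OutTrue P g j

instance : ∀ b j, Fintype (Out P g b j)
  | false, j => inferInstanceAs (Fintype (OutFalse P g j))
  | true, j => inferInstanceAs (Fintype (OutTrue P g j))

/-- The first operation of `P₀`. -/
def firstOpFalse (j : Fin N) (x : P.X false j) (k : (i : Set.Iio j) → OutFalse P g i)
    (c : OutFalse P g j) :
    Matrix (Qubits (P.n false j) × Slot P g j) (Qubits (P.n false j) × Slot P g j) ℂ :=
  firstFalse (qubitBasis (P.n false j)) 0 (g j).h₀
    (fun h => (g j).alice (target k x c.1 h) (c.2 h)) c.1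

/-- The first operation of `P₁`. -/
def firstOpTrue (j : Fin N) (x : P.X true j) (k : (i : Set.Iio j) → OutTrue P g i)
    (c : OutTrue P g j) :
    Matrix (Qubits (P.n true j) × Slot P g j × Qubits P.r)
      (Qubits (P.n true j) × Slot P g j × Qubits P.r) ℂ :=
  -- Zero Kraus operators for a false announcement make the outcome carry the true message to `P₀`.
  open Classical in if c.1 = x then
    firstTrue (qubitBasis (P.n false j)) 0 (Hist.mk k x) ((g j).bob c.2.1) c.2.2 else 0

theorem complete_firstOpFalse (j : Fin N) (x : P.X false j)
    (k : (i : Set.Iio j) → OutFalse P g i) : Complete (firstOpFalse P g j x k) :=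
  complete_firstFalse (qubitBasis (P.n false j)) 0 (g j).h₀
    (bra := fun α h ka => (g j).alice (target k x α h) ka)
    fun α h => (g j).alice_complete (target k x α h)

theorem complete_firstOpTrue (j : Fin N) (x : P.X true j)
    (k : (i : Set.Iio j) → OutTrue P g i) : Complete (firstOpTrue P g j x k) := by
  have h : Complete fun c : (g j).KB × (qubitBasis (P.n false j)).Idx =>
      (firstTrue (qubitBasis (P.n false j)) 0 (Hist.mk k x) ((g j).bob c.1) c.2 :
        Matrix (Qubits (P.n true j) × Slot P g j × Qubits P.r)
          (Qubits (P.n true j) × Slot P g j × Qubits P.r) ℂ) :=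
    complete_firstTrue (qubitBasis (P.n false j)) 0 (Hist.mk k x) (g j).bob_complete
  unfold Complete at h ⊢
  rw [← h]
  refine (Fintype.sum_prod_type (α₁ := P.X true j)
    (α₂ := (g j).KB × (qubitBasis (P.n false j)).Idx) _).trans ?_
  rw [Finset.sum_eq_single x]
  · simp only [firstOpTrue, if_true]
  · intro y _ hy
    simp [firstOpTrue, hy]
  · simp

/-- The first operations. -/
def firstOp : (b : Side) → (j : Fin N) → ((i : Set.Iic j) → P.X b i) →
    ((i : Set.Iio j) → Out P g b i) → Out P g b j →
    Matrix (Qubits (P.n b j) × (Qubits (pairCount P g) × Qubits P.r))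
      (Qubits (P.n b j) × (Qubits (pairCount P g) × Qubits P.r)) ℂ
  | false, j, x, k, c => embed (getFalse P g j) (putFalse P g j)
      (firstOpFalse P g j (x ⟨j, le_refl j⟩) k c)
  | true, j, x, k, c => embed (getTrue P g j) (putTrue P g j)
      (firstOpTrue P g j (x ⟨j, le_refl j⟩) k c)

theorem complete_firstOp : (b : Side) → (j : Fin N) → (x : (i : Set.Iic j) → P.X b i) →
    (k : (i : Set.Iio j) → Out P g b i) → Complete (firstOp P g b j x k)
  | false, j, x, k =>
    (isLens_false P g j).complete_embed (complete_firstOpFalse P g j (x ⟨j, le_refl j⟩) k)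
  | true, j, x, k =>
    (isLens_true P g j).complete_embed (complete_firstOpTrue P g j (x ⟨j, le_refl j⟩) k)

/-- The second operations. -/
def secondOp : (b : Side) → (j : Fin N) → ((i : Set.Iic j) → P.X b i) →
    ((i : Set.Iic j) → Out P g b i) → ((i : Set.Iic j) → Out P g (!b) i) →
    Matrix.unitaryGroup (Qubits (P.n b j) × (Qubits (pairCount P g) × Qubits P.r)) ℂ
  | false, j, _, k, l => ⟨embed (getFalse P g j) (putFalse P g j)
      (secondFalse ((qubitBasis (P.n false j)).u (l ⟨j, le_refl j⟩).2.2 *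
        (qubitBasis (P.n false j)).u (stepKey (k ⟨j, le_refl j⟩) l).1)⁻¹),
      embed_mem_unitaryGroup (isLens_false P g j) (secondFalse_mem _)⟩
  -- Only the message register is corrected. The local register keeps its error, since the first
  -- operation of a later step may already have acted on it.
  | true, j, _, k, l => ⟨embed (fun s => s.1) (fun s t => (t, s.2))
      ((qubitBasis (P.n true j)).u (stepKey (l ⟨j, le_refl j⟩) k).2.1)⁻¹.1,
      embed_mem_unitaryGroup isLens_fst (Subtype.prop _)⟩

/-- The strategy of the dishonest provers, from a protocol for each step. -/
def coalition : Coalition P where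
  m := pairCount P g
  W _ := Qubits P.r
  w _ := 0
  K := Out P g
  first := firstOp P g
  first_complete := complete_firstOp P g
  second := secondOp P g

end Strategy

/-! ### The effect of a step of the attack -/

/-- `e` parametrizes a slice on which the systems outside the step are frozen; on it the global
operation becomes a local one. -/
theorem applyTo_pull_fst {I S T : Type} [Fintype S] {get : I → S} {put : I → S → I} {e : S × T → I}
    (h₁ : ∀ s, get (e s) = s.1) (h₂ : ∀ s t, put (e s) t = e (t, s.2)) (M : Matrix S S ℂ)
    (ψ : I → ℂ) : (fun s => applyTo get put M ψ (e s)) = onFst M fun s => ψ (e s) := by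
  funext s
  simp [applyTo, h₁, h₂]

theorem applyTo_pull_snd {I S T : Type} [Fintype T] {get : I → T} {put : I → T → I} {e : S × T → I}
    (h₁ : ∀ s, get (e s) = s.2) (h₂ : ∀ s t, put (e s) t = e (s.1, t)) (M : Matrix T T ℂ)
    (ψ : I → ℂ) : (fun s => applyTo get put M ψ (e s)) = onSnd M fun s => ψ (e s) := by
  funext s
  simp [applyTo, h₁, h₂]

section Step

set_option synthInstance.maxSize 1000

variable {N : ℕ} {P : Program N} (g : (j : Fin N) → Gadget (P.basis j)) (V : Verifiers P)

/-- Labels of everything that is involved in a step of the attack. -/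
abbrev Joint (j : Fin N) :=
  (Qubits (P.n false j) × Slot P g j) × (Qubits (P.n true j) × Slot P g j × Qubits P.r)

def jointGet (j : Fin N) (i : V.Sys × (coalition P g).Mem) : Joint g j :=
  ((i.1.2 false j, slots P g (i.2 false).1 j),
    (i.1.2 true j, slots P g (i.2 true).1 j, (i.2 true).2))

/-- The systems of the verifiers with the two message registers of a step overwritten. -/
def putMsgs (j : Fin N) (v : V.Sys) (d : P.Data j) : V.Sys :=
  (v.1, fun b => Function.update (v.2 b) j ((P.dataEquiv j d).1 b))

def jointPut (j : Fin N) (i : V.Sys × (coalition P g).Mem) (s : Joint g j) :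
    V.Sys × (coalition P g).Mem :=
  (putMsgs V j i.1 (s.1.1, s.2.1, s.2.2.2), fun b => match b with
    | false => ((slots P g).symm (Function.update (slots P g (i.2 false).1) j s.1.2), (i.2 false).2)
    | true => ((slots P g).symm (Function.update (slots P g (i.2 true).1) j s.2.2.1), s.2.2.2))

theorem jointPut_jointGet (j : Fin N) (i : V.Sys × (coalition P g).Mem) :
    jointPut g V j i (jointGet g V j i) = i := by
  refine Prod.ext (Prod.ext rfl ?_) ?_
  · funext b
    cases b <;> simp [jointPut, jointGet, putMsgs, Program.dataEquiv]
  · funext b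
    cases b
    · simp only [jointPut, jointGet, Function.update_eq_self]
      exact Prod.ext ((slots P g).symm_apply_apply _) rfl
    · simp only [jointPut, jointGet, Function.update_eq_self]
      exact Prod.ext ((slots P g).symm_apply_apply _) rfl

theorem pull_false (j : Fin N) (i : V.Sys × (coalition P g).Mem)
    (M : Matrix (Qubits (P.n false j) × Slot P g j) (Qubits (P.n false j) × Slot P g j) ℂ)
    (ψ : V.Sys × (coalition P g).Mem → ℂ) :
    (fun s => onProver V (coalition P g) false j (embed (getFalse P g j) (putFalse P g j) M) ψ
      (jointPut g V j i s)) = onFst M fun s => ψ (jointPut g V j i s) := by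
  have := applyTo_embed (fun i : V.Sys × (coalition P g).Mem => (i.1.2 false j, i.2 false))
    (fun i s => ((i.1.1, Function.update i.1.2 false (Function.update (i.1.2 false) j s.1)),
      Function.update i.2 false s.2)) (getFalse P g j) (putFalse P g j) M ψ
  rw [show onProver V (coalition P g) false j (embed (getFalse P g j) (putFalse P g j) M) ψ = _
    from this]
  refine applyTo_pull_fst (fun s => ?_) (fun s t => ?_) M ψ
  · simp [getFalse, jointPut, putMsgs, Program.dataEquiv]
  · refine Prod.ext (Prod.ext rfl ?_) ?_
    · funext b
      cases b <;> simp [putFalse, jointPut, putMsgs, Program.dataEquiv]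
    · funext b
      cases b <;> simp [putFalse, jointPut] <;> rfl

theorem pull_true (j : Fin N) (i : V.Sys × (coalition P g).Mem)
    (M : Matrix (Qubits (P.n true j) × Slot P g j × Qubits P.r)
      (Qubits (P.n true j) × Slot P g j × Qubits P.r) ℂ)
    (ψ : V.Sys × (coalition P g).Mem → ℂ) :
    (fun s => onProver V (coalition P g) true j (embed (getTrue P g j) (putTrue P g j) M) ψ
      (jointPut g V j i s)) = onSnd M fun s => ψ (jointPut g V j i s) := by
  have := applyTo_embed (fun i : V.Sys × (coalition P g).Mem => (i.1.2 true j, i.2 true))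
    (fun i s => ((i.1.1, Function.update i.1.2 true (Function.update (i.1.2 true) j s.1)),
      Function.update i.2 true s.2)) (getTrue P g j) (putTrue P g j) M ψ
  rw [show onProver V (coalition P g) true j (embed (getTrue P g j) (putTrue P g j) M) ψ = _
    from this]
  refine applyTo_pull_snd (fun s => ?_) (fun s t => ?_) M ψ
  · simp [getTrue, jointPut, putMsgs, Program.dataEquiv]
  · refine Prod.ext (Prod.ext rfl ?_) ?_
    · funext b
      cases b <;> simp [putTrue, jointPut, putMsgs, Program.dataEquiv]
    · funext b
      cases b <;> simp [putTrue, jointPut] <;> rfl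

theorem pull_msg (j : Fin N) (i : V.Sys × (coalition P g).Mem)
    (M : Matrix (Qubits (P.n true j)) (Qubits (P.n true j)) ℂ)
    (ψ : V.Sys × (coalition P g).Mem → ℂ) :
    (fun s => onProver V (coalition P g) true j (embed (fun s => s.1) (fun s t => (t, s.2)) M) ψ
      (jointPut g V j i s)) =
      onSnd (embed (fun s => s.1) (fun s t => (t, s.2)) M) fun s => ψ (jointPut g V j i s) := by
  have := applyTo_embed (fun i : V.Sys × (coalition P g).Mem => (i.1.2 true j, i.2 true))
    (fun i s => ((i.1.1, Function.update i.1.2 true (Function.update (i.1.2 true) j s.1)),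
      Function.update i.2 true s.2)) (fun s => s.1) (fun s t => (t, s.2)) M ψ
  rw [show onProver V (coalition P g) true j (embed (fun s => s.1) (fun s t => (t, s.2)) M) ψ = _
    from this]
  rw [onSnd, applyTo_embed]
  funext s
  have h₁ : (jointPut g V j i s).1.2 true j = s.2.1 := by
    simp [jointPut, putMsgs, Program.dataEquiv]
  simp only [applyTo]
  rw [h₁]
  refine Finset.sum_congr rfl fun t _ => ?_
  congr 2
  refine Prod.ext (Prod.ext rfl ?_) ?_
  · funext b
    cases b <;> simp [jointPut, putMsgs, Program.dataEquiv]
  · funext b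
    cases b <;> simp [jointPut]

/-- A matrix on the local register of the honest prover. -/
def onLocal (ρ : Matrix.unitaryGroup (Qubits P.r) ℂ) (ψ : V.Sys × Qubits P.r → ℂ) :
    V.Sys × Qubits P.r → ℂ :=
  applyTo (fun i => i.2) (fun i t => (i.1, t)) ρ.1 ψ

/-- A state of the attack in which `P₁` holds the local register of the honest prover and the
entangled systems of each step are in a state of their own. -/
def productState (ψ : V.Sys × Qubits P.r → ℂ) (f : (j : Fin N) → Slot P g j → Slot P g j → ℂ) :
    V.Sys × (coalition P g).Mem → ℂ :=
  fun i => ψ (i.1, (i.2 true).2) * (if (i.2 false).2 = (coalition P g).w false then 1 else 0) *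
    ∏ l, f l (slots P g (i.2 false).1 l) (slots P g (i.2 true).1 l)

/-- Maximally entangled state of the systems of a step. -/
def entangled (j : Fin N) (x y : Slot P g j) : ℂ :=
  if x = y then (Real.sqrt (Fintype.card (Slot P g j)) : ℂ)⁻¹ else 0

variable {g}

/-- State of the entangled systems after a successful step. -/
def used (k : (b : Side) → (j : Fin N) → Out P g b j) (x : (j : Fin N) → P.X false j)
    (j : Fin N) : Slot P g j → Slot P g j → ℂ :=
  leftover 0 (g j).h₀
    (Function.update
      (fun h => (g j).alice (target (fun i => k false i) (x j) (k false j).1 h) ((k false j).2 h))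
      (histOf fun i => k true i)
      ((g j).junk (target (fun i => k false i) (x j) (k false j).1 (histOf fun i => k true i))
        ((k false j).2 (histOf fun i => k true i)) (k true j).2.1))
    ((Fintype.card (Qubits (P.n false j)) : ℂ)⁻¹ *
      (Real.sqrt (Fintype.card (Slot P g j)) : ℂ)⁻¹)

theorem pull_productState (ψ : V.Sys × Qubits P.r → ℂ)
    (f : (j : Fin N) → Slot P g j → Slot P g j → ℂ) (j : Fin N)
    (i : V.Sys × (coalition P g).Mem) (s : Joint g j) :
    productState g V ψ f (jointPut g V j i s) =
      ψ (putMsgs V j i.1 (s.1.1, s.2.1, s.2.2.2), s.2.2.2) *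
        ((if (i.2 false).2 = (coalition P g).w false then 1 else 0) * (∏ l ∈ Finset.univ.erase j,
          f l (slots P g (i.2 false).1 l) (slots P g (i.2 true).1 l)) * f j s.1.2 s.2.2.1) := by
  have : ∏ l, f l (slots P g ((jointPut g V j i s).2 false).1 l)
      (slots P g ((jointPut g V j i s).2 true).1 l) = f j s.1.2 s.2.2.1 *
      ∏ l ∈ Finset.univ.erase j, f l (slots P g (i.2 false).1 l) (slots P g (i.2 true).1 l) := by
    rw [← Finset.mul_prod_erase Finset.univ _ (Finset.mem_univ j)]
    congr 1
    · simp [jointPut]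
    · refine Finset.prod_congr rfl fun l hl => ?_
      simp [jointPut, Function.update_of_ne (Finset.ne_of_mem_erase hl)]
  rw [productState, this, mul_comm (f j _ _), mul_assoc, mul_assoc]
  rfl

theorem honestStep_putMsgs (o : VOutcome V) (j : Fin N) (ψ : V.Sys × Qubits P.r → ℂ) (v : V.Sys)
    (d : P.Data j) :
    honestStep V o (.prover j) ψ (putMsgs V j v d, d.2.2) =
      ((P.unitary j (o.x false j) (o.x true j)).1 *ᵥ fun d' => ψ (putMsgs V j v d', d'.2.2)) d := by
  have hx : (fun b => o.x b j) = P.both (o.x false j) (o.x true j) := by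
    funext b
    cases b <;> rfl
  rw [honestStep, hx, applyTo_apply]
  simp only [Matrix.mulVec, dotProduct, Program.unitary, Matrix.submatrix_apply]
  rw [← (P.dataEquiv j).sum_comp]
  refine Finset.sum_congr rfl fun d' _ => ?_
  have h₁ : ((fun b => (putMsgs V j v d).2 b j, d.2.2) :
      ((b : Side) → Qubits (P.n b j)) × Qubits P.r) = P.dataEquiv j d := by
    refine Prod.ext (funext fun b => ?_) rfl
    simp [putMsgs]
  have h₂ : (((putMsgs V j v d).1, fun b => Function.update ((putMsgs V j v d).2 b) j
      ((P.dataEquiv j d').1 b)) : V.Sys) = putMsgs V j v d' := by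
    refine Prod.ext rfl (funext fun b => ?_)
    simp [putMsgs]
  rw [h₁, h₂]
  rfl

theorem leftover_mul {A Hi H : Type} [DecidableEq A] [Fintype Hi] [DecidableEq H] (a₀ : A) (h₀ : H)
    (f : Hi → H → ℂ) (c d : ℂ) (x y : SlotOf A Hi H) :
    leftover a₀ h₀ f (c * d) x y = c * leftover a₀ h₀ f d x y := by
  rw [leftover, leftover, mul_left_comm]
  simp only [mul_ite, mul_zero]

/-- The effect of a successful step of the attack. -/
theorem attack_step (o : VOutcome V) (k : (b : Side) → (j : Fin N) → Out P g b j) (j : Fin N)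
    (hx : (k true j).1 = o.x true j) (hw : (g j).w (k true j).2.1 ≠ 0)
    (ψ : V.Sys × Qubits P.r → ℂ) (f : (j : Fin N) → Slot P g j → Slot P g j → ℂ)
    (hf : f j = entangled g j) :
    attackStep V (coalition P g) o k (.second true j)
      (attackStep V (coalition P g) o k (.second false j)
        (attackStep V (coalition P g) o k (.first true j)
          (attackStep V (coalition P g) o k (.first false j)
            (productState g V
              (onLocal V (gauge (fun i : Set.Iio j => k false i) fun i => k true i) ψ) f)))) =
      productState g V
        (onLocal V ((qubitBasis P.r).u (stepKey (k false j) fun i => k true i).2.2)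
          (honestStep V o (.prover j) ψ))
        (Function.update f j (used k (fun j => o.x false j) j)) := by
  -- The equality is checked on the slices `jointPut g V j i`, on which the four events become the
  -- operators of `local_step`. Each label lies on its own slice by `jointPut_jointGet`.
  have key : ∀ i : V.Sys × (coalition P g).Mem,
      (fun s => attackStep V (coalition P g) o k (.second true j)
        (attackStep V (coalition P g) o k (.second false j)
          (attackStep V (coalition P g) o k (.first true j)
            (attackStep V (coalition P g) o k (.first false j)
              (productState g V
                (onLocal V (gauge (fun i : Set.Iio j => k false i) fun i => k true i) ψ) f))))
        (jointPut g V j i s)) = fun s => productState g V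
        (onLocal V ((qubitBasis P.r).u (stepKey (k false j) fun i => k true i).2.2)
          (honestStep V o (.prover j) ψ))
        (Function.update f j (used k (fun j => o.x false j) j)) (jointPut g V j i s) := by
    intro i
    have h1 : ∀ Ψ, (fun s => attackStep V (coalition P g) o k (.first false j) Ψ
        (jointPut g V j i s)) =
        onFst (firstOpFalse P g j (o.x false j) (fun i => k false i) (k false j))
          fun s => Ψ (jointPut g V j i s) := fun Ψ => pull_false g V j i _ Ψ
    have h2 : ∀ Ψ, (fun s => attackStep V (coalition P g) o k (.first true j) Ψ
        (jointPut g V j i s)) =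
        onSnd (firstOpTrue P g j (o.x true j) (fun i => k true i) (k true j))
          fun s => Ψ (jointPut g V j i s) := fun Ψ => pull_true g V j i _ Ψ
    have h3 : ∀ Ψ, (fun s => attackStep V (coalition P g) o k (.second false j) Ψ
        (jointPut g V j i s)) =
        onFst (secondFalse ((qubitBasis (P.n false j)).u (k true j).2.2 *
          (qubitBasis (P.n false j)).u (stepKey (k false j) fun i => k true i).1)⁻¹)
          fun s => Ψ (jointPut g V j i s) := fun Ψ => pull_false g V j i _ Ψ
    have h4 : ∀ Ψ, (fun s => attackStep V (coalition P g) o k (.second true j) Ψ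
        (jointPut g V j i s)) =
        onSnd (embed (fun s => s.1) (fun s t => (t, s.2))
          ((qubitBasis (P.n true j)).u (stepKey (k false j) fun i => k true i).2.1)⁻¹.1)
          fun s => Ψ (jointPut g V j i s) := fun Ψ => pull_msg g V j i _ Ψ
    rw [h4, h3, h2, h1]
    -- As the announced message is the true one, the resource that `P₁` uses is the one that `P₀`
    -- later infers from his outcomes.
    have hh : (Hist.mk (fun i => k true i) (o.x true j) : Hist P g j) =
        histOf fun i => k true i := by
      rw [← hx]
      rfl
    rw [firstOpFalse, firstOpTrue, if_pos hx, hh]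
    have hin : (fun s => productState g V
          (onLocal V (gauge (fun i : Set.Iio j => k false i) fun i => k true i) ψ) f
          (jointPut g V j i s)) = fun s =>
        ((kron3 1 1 (gauge (fun i : Set.Iio j => k false i) fun i => k true i)).1 *ᵥ
          fun d => ψ (putMsgs V j i.1 d, d.2.2)) (s.1.1, s.2.1, s.2.2.2) *
          if s.1.2 = s.2.2.1 then (if (i.2 false).2 = (coalition P g).w false then 1 else 0) *
            (∏ l ∈ Finset.univ.erase j, f l (slots P g (i.2 false).1 l) (slots P g (i.2 true).1 l)) *
            (Real.sqrt (Fintype.card (Slot P g j)) : ℂ)⁻¹ else 0 := by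
      funext s
      rw [pull_productState, hf, entangled, kron3_right_mulVec, mul_ite, mul_zero]
      rfl
    rw [hin]
    refine (local_step (qubitBasis (P.n false j)) (qubitBasis (P.n true j)) (qubitBasis P.r) (g j) 0
      (histOf fun i : Set.Iic j => k true i) (P.unitary j (o.x false j) (o.x true j))
      (target (fun i : Set.Iio j => k false i) (o.x false j) (k false j).1)
      (gauge (fun i : Set.Iio j => k false i) fun i => k true i) (k false j).1 (k true j).2.2 ?_
      (k false j).2 (k true j).2.1 hw (stepKey (k false j) fun i => k true i) rfl
      (fun d => ψ (putMsgs V j i.1 d, d.2.2)) _).trans ?_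
    · rw [target, ← hx]
      rfl
    · funext s
      rw [pull_productState, Function.update_self, kron3_right_mulVec]
      have hprod : ∏ l ∈ Finset.univ.erase j, Function.update f j (used k (fun j => o.x false j) j) l
          (slots P g (i.2 false).1 l) (slots P g (i.2 true).1 l) =
          ∏ l ∈ Finset.univ.erase j, f l (slots P g (i.2 false).1 l) (slots P g (i.2 true).1 l) :=
        Finset.prod_congr rfl fun l hl => by
          rw [Function.update_of_ne (Finset.ne_of_mem_erase hl)]
      rw [hprod]
      rw [mul_left_comm, leftover_mul]
      refine congrArg₂ (· * ·) ?_ ?_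
      · refine Finset.sum_congr rfl fun t _ => ?_
        rw [← honestStep_putMsgs]
        rfl
      · rw [used]
  funext i
  have := congrFun (key i) (jointGet g V j i)
  simpa only [jointPut_jointGet] using this

end Step

/-! ### The order of events -/

section Lists

open List

variable {E : Type}

theorem not_pair_sublist_of_nodup {l : List E} (hn : l.Nodup) {a b : E} (h : [a, b] <+ l)
    (h' : [b, a] <+ l) : False := by
  induction l with
  | nil => simp at h
  | cons c t ih =>
    rw [nodup_cons] at hn
    rw [List.cons_sublist_cons'] at h h'
    rcases h with h | ⟨rfl, h⟩
    · rcases h' with h' | ⟨rfl, h'⟩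
      · exact ih hn.2 h h'
      · exact hn.1 (h.subset (by simp))
    · rcases h' with h' | ⟨rfl, h'⟩
      · exact hn.1 (h'.subset (by simp))
      · exact hn.1 (h.subset (by simp))

theorem pair_sublist_or {l : List E} {a b : E} (ha : a ∈ l) (hb : b ∈ l) (hab : a ≠ b) :
    [a, b] <+ l ∨ [b, a] <+ l := by
  induction l with
  | nil => simp at ha
  | cons c t ih =>
    rcases List.mem_cons.1 ha with rfl | ha'
    · rcases List.mem_cons.1 hb with rfl | hb'
      · exact absurd rfl hab
      · exact Or.inl ((singleton_sublist.2 hb').cons_cons _)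
    · rcases List.mem_cons.1 hb with rfl | hb'
      · exact Or.inr ((singleton_sublist.2 ha').cons_cons _)
      · exact (ih ha' hb').imp (fun h => h.cons _) fun h => h.cons _

/-- Two orders of the same operations have the same effect if operations that change places
commute. -/
theorem foldl_eq_of_perm {Ψ : Type} (step : E → Ψ → Ψ) {l l' : List E} (hp : l ~ l')
    (hn : l.Nodup)
    (hc : ∀ a b, [a, b] <+ l → [b, a] <+ l' → ∀ ψ, step a (step b ψ) = step b (step a ψ)) (ψ : Ψ) :
    l.foldl (fun ψ e => step e ψ) ψ = l'.foldl (fun ψ e => step e ψ) ψ := by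
  induction l generalizing l' ψ with
  | nil => rw [hp.nil_eq]
  | cons a t ih =>
    obtain ⟨s, u, rfl⟩ := List.append_of_mem (hp.subset (mem_cons_self))
    have hp' : t ~ s ++ u := by
      have := hp.trans (perm_middle (l₁ := s) (l₂ := u) (a := a))
      exact this.cons_inv
    -- All of `s` comes after `a` in `l` but before it in `l'`, so `a` may be moved past `s`.
    have hs : ∀ v : List E, v ⊆ s → (∀ x ∈ v, [x, a] <+ s ++ a :: u) → ∀ ψ,
        (v.foldl (fun ψ e => step e ψ) (step a ψ)) = step a (v.foldl (fun ψ e => step e ψ) ψ) := by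
      intro v
      induction v with
      | nil => intros; rfl
      | cons x v ihv =>
        intro hv hx ψ
        have hxt : x ∈ t := hp'.symm.subset (mem_append_left _ (hv mem_cons_self))
        simp only [foldl_cons]
        rw [← hc a x ((singleton_sublist.2 hxt).cons_cons _) (hx x mem_cons_self)]
        exact ihv (fun y hy => hv (mem_cons_of_mem _ hy))
          (fun y hy => hx y (mem_cons_of_mem _ hy)) _
    have hs' := hs s (Subset.refl _) fun x hx => by
      have : [x] ++ [a] <+ s ++ a :: u :=
        (singleton_sublist.2 hx).append (singleton_sublist.2 mem_cons_self)
      exact this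
    rw [foldl_append, foldl_cons, foldl_cons, ← hs', ← foldl_append]
    refine ih hp' (nodup_cons.1 hn).2 (fun x y hxy hyx => hc x y (hxy.cons _) ?_) _
    exact hyx.trans ((Sublist.refl s).append (sublist_cons_self a u))

theorem chronological_perm (time : E → ℝ) (l : List E) : chronological time l ~ l :=
  perm_insertionSort _ _

theorem time_le_of_chronological {time : E → ℝ} {l : List E} {a b : E}
    (h : [a, b] <+ chronological time l) : time a ≤ time b := by
  have : (chronological time l).Pairwise fun e e' => time e ≤ time e' := by
    classical
    have : Std.Total fun e e' : E => time e ≤ time e' := ⟨fun _ _ => le_total _ _⟩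
    have : IsTrans E fun e e' : E => time e ≤ time e' := ⟨fun _ _ _ => le_trans⟩
    exact pairwise_insertionSort _ _
  exact this.forall_sublist h

/-- Insertion sort is stable, so events appear against the order of the given list only if their
times force it. -/
theorem sublist_of_chronological {time : E → ℝ} {l : List E} (hn : l.Nodup) {a b : E}
    (h : [a, b] <+ chronological time l) (hba : time b ≤ time a) : [a, b] <+ l := by
  classical
  have hn' : (chronological time l).Nodup := (chronological_perm time l).nodup_iff.2 hn
  have hmem : ∀ x ∈ [a, b], x ∈ l := fun x hx => (chronological_perm time l).subset (h.subset hx)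
  have hab : a ≠ b := by
    rintro rfl
    exact not_pair_sublist_of_nodup hn' h h
  rcases pair_sublist_or (hmem a (by simp)) (hmem b (by simp)) hab with h' | h'
  · exact h'
  · exact (not_pair_sublist_of_nodup hn' h
      (pair_sublist_insertionSort (r := fun e e' : E => time e ≤ time e') hba h')).elim

end Lists

/-! ### Times of the events and the order inherited from the honest execution -/

section Timing

variable {N : ℕ}

/-- The honest prover's event to which an event of the attack belongs. -/
def AttackEvent.owner : AttackEvent N → HonestEvent N
  | .recv b j => .recv b j
  | .send b j => .send b j
  | .second _ j => .prover j
  | .first _ j => .prover j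

/-- The events of the attack that replace an event of the honest execution. -/
def HonestEvent.expand : HonestEvent N → List (AttackEvent N)
  | .recv b j => [.recv b j]
  | .send b j => [.send b j]
  | .prover j => [.first false j, .first true j, .second false j, .second true j]

theorem mem_expand_iff {x : AttackEvent N} {e : HonestEvent N} : x ∈ e.expand ↔ x.owner = e := by
  cases e <;> rcases x with ⟨b, _⟩ | ⟨b, _⟩ | ⟨b, _⟩ | ⟨b, _⟩ <;>
    simp [HonestEvent.expand, AttackEvent.owner] <;> cases b <;> simp [eq_comm]

/-- Within a step the only order to be remembered is that both first operations precede both second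
ones; the values at the verifiers' events are immaterial. -/
def AttackEvent.rank : AttackEvent N → ℕ
  | .recv _ _ => 0
  | .send _ _ => 0
  | .second _ _ => 1
  | .first _ _ => 0

theorem mem_allPairs (p : Side × Fin N) : p ∈ allPairs N := by
  obtain ⟨b, j⟩ := p
  cases b <;> simp [allPairs]

theorem nodup_allPairs : (allPairs N).Nodup :=
  List.Nodup.product (by simp) (List.nodup_finRange N)

theorem mem_honestEvents (e : HonestEvent N) : e ∈ honestEvents N := by
  cases e <;> simp [honestEvents, mem_allPairs]

theorem mem_attackEvents (e : AttackEvent N) : e ∈ attackEvents N := by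
  cases e <;> simp [attackEvents, mem_allPairs]

theorem nodup_honestEvents : (honestEvents N).Nodup := by
  simp only [honestEvents, List.nodup_append, List.mem_append, List.mem_map]
  refine ⟨⟨?_, ?_, ?_⟩, ?_, ?_⟩
  · exact nodup_allPairs.map fun p q h => by
      injection h with h₁ h₂
      exact Prod.ext h₁ h₂
  · exact nodup_allPairs.map fun p q h => by
      injection h with h₁ h₂
      exact Prod.ext h₁ h₂
  · rintro _ ⟨p, _, rfl⟩ _ ⟨q, _, rfl⟩ h
    cases h
  · exact (List.nodup_finRange N).map fun p q h => by injection h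
  · rintro _ (⟨p, _, rfl⟩ | ⟨p, _, rfl⟩) _ ⟨q, _, rfl⟩ h <;> cases h

theorem nodup_attackEvents : (attackEvents N).Nodup := by
  simp only [attackEvents, List.nodup_append, List.mem_append, List.mem_map]
  refine ⟨⟨⟨?_, ?_, ?_⟩, ?_, ?_⟩, ?_, ?_⟩
  · exact nodup_allPairs.map fun p q h => by
      injection h with h₁ h₂
      exact Prod.ext h₁ h₂
  · exact nodup_allPairs.map fun p q h => by
      injection h with h₁ h₂
      exact Prod.ext h₁ h₂
  · rintro _ ⟨p, _, rfl⟩ _ ⟨q, _, rfl⟩ h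
    cases h
  · exact nodup_allPairs.map fun p q h => by
      injection h with h₁ h₂
      exact Prod.ext h₁ h₂
  · rintro _ (⟨p, _, rfl⟩ | ⟨p, _, rfl⟩) _ ⟨q, _, rfl⟩ h <;> cases h
  · exact nodup_allPairs.map fun p q h => by
      injection h with h₁ h₂
      exact Prod.ext h₁ h₂
  · rintro _ ((⟨p, _, rfl⟩ | ⟨p, _, rfl⟩) | ⟨p, _, rfl⟩) _ ⟨q, _, rfl⟩ h <;> cases h

/-- The events of the attack in the order of the honest execution. -/
def honestOrder (S : Timetable N) : List (AttackEvent N) :=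
  (chronological (honestTime S) (honestEvents N)).flatMap HonestEvent.expand

theorem nodup_chronological_honest (S : Timetable N) :
    (chronological (honestTime S) (honestEvents N)).Nodup :=
  (chronological_perm _ _).nodup_iff.2 nodup_honestEvents

theorem nodup_honestOrder (S : Timetable N) : (honestOrder S).Nodup := by
  rw [honestOrder, List.nodup_flatMap]
  constructor
  · intro e _
    cases e <;> simp [HonestEvent.expand]
  · refine (nodup_chronological_honest S).imp fun {e e'} hne x hx hx' => ?_
    rw [mem_expand_iff] at hx hx'
    exact hne (hx.symm.trans hx')

theorem mem_honestOrder (S : Timetable N) (e : AttackEvent N) : e ∈ honestOrder S := by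
  rw [honestOrder, List.mem_flatMap]
  exact ⟨e.owner, (chronological_perm _ _).mem_iff.2 (mem_honestEvents _), mem_expand_iff.2 rfl⟩

theorem chronological_perm_honestOrder (S : Timetable N) (apos : Side → ℝ) :
    (chronological (attackTime S apos) (attackEvents N)).Perm (honestOrder S) := by
  refine (chronological_perm _ _).trans ?_
  rw [List.perm_ext_iff_of_nodup nodup_attackEvents (nodup_honestOrder S)]
  intro e
  simp [mem_attackEvents, mem_honestOrder]

open List in
theorem owner_of_honestOrder (S : Timetable N) {x y : AttackEvent N}
    (h : [x, y] <+ honestOrder S) :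
    [x.owner, y.owner] <+ chronological (honestTime S) (honestEvents N) ∨
      x.owner = y.owner ∧ x.rank ≤ y.rank := by
  have : (honestOrder S).Pairwise fun x y =>
      [x.owner, y.owner] <+ chronological (honestTime S) (honestEvents N) ∨
        x.owner = y.owner ∧ x.rank ≤ y.rank := by
    rw [honestOrder, List.pairwise_flatMap]
    constructor
    · intro e _
      cases e <;> simp [HonestEvent.expand, AttackEvent.owner, AttackEvent.rank]
    · rw [List.pairwise_iff_forall_sublist]
      intro e e' he x hx y hy
      rw [mem_expand_iff] at hx hy
      left
      rwa [hx, hy]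
  exact this.forall_sublist h

theorem dist_of_mem (S : Timetable N) {apos : Side → ℝ} (h₁ : S.vpos false < apos false)
    (h₂ : apos false < S.pos) (h₃ : S.pos < apos true) (h₄ : apos true < S.vpos true) (b : Side) :
    dist (S.vpos b) S.pos = dist (S.vpos b) (apos b) + dist (apos b) S.pos ∧
      dist (apos (!b)) (apos b) = dist (apos (!b)) S.pos + dist (apos b) S.pos ∧
      0 < dist (apos b) S.pos ∧ 0 < dist (S.vpos b) (apos b) := by
  have e : ∀ x y : ℝ, x < y → dist x y = y - x := fun x y h => by
    rw [Real.dist_eq, abs_sub_comm, abs_of_pos (sub_pos.2 h)]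
  have e' : ∀ x y : ℝ, y < x → dist x y = x - y := fun x y h => by
    rw [Real.dist_eq, abs_of_pos (sub_pos.2 h)]
  cases b
  · rw [e _ _ (h₁.trans h₂), e _ _ h₁, e _ _ h₂, Bool.not_false, e' _ _ (h₂.trans h₃), e' _ _ h₃]
    refine ⟨?_, ?_, ?_, ?_⟩ <;> linarith
  · rw [e' _ _ (h₃.trans h₄), e' _ _ h₄, e' _ _ h₃, Bool.not_true, e _ _ (h₂.trans h₃), e _ _ h₂]
    refine ⟨?_, ?_, ?_, ?_⟩ <;> linarith

/-- Times of the events of the attack relative to the time at which the messages would reach the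
claimed position. -/
theorem attack_times (S : Timetable N) {apos : Side → ℝ} (h₁ : S.vpos false < apos false)
    (h₂ : apos false < S.pos) (h₃ : S.pos < apos true) (h₄ : apos true < S.vpos true) (b : Side) :
    ∃ d δ : ℝ, 0 < d ∧ 0 < δ ∧ ∀ j, S.sendTime b j = S.T j - d - δ ∧
      firstTime S apos b j = S.T j - d ∧ secondTime S apos b j = S.T j + d ∧
      attackArrival S apos b j = S.T j + d + δ ∧ honestArrival S b j = S.T j + d + δ := by
  -- `d` is the distance of the dishonest prover to the claimed position and `δ` that to her
  -- verifier. The other prover starts at T j minus his own distance d', and his outcome travels d'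
  -- + d, so it arrives at T j + d.
  refine ⟨dist (apos b) S.pos, dist (S.vpos b) (apos b), ?_, ?_, fun j => ?_⟩
  · exact (dist_of_mem S h₁ h₂ h₃ h₄ b).2.2.1
  · exact (dist_of_mem S h₁ h₂ h₃ h₄ b).2.2.2
  · obtain ⟨e₁, e₂, _, _⟩ := dist_of_mem S h₁ h₂ h₃ h₄ b
    obtain ⟨e₃, _, _, _⟩ := dist_of_mem S h₁ h₂ h₃ h₄ (!b)
    have e₄ := dist_comm (apos b) (S.vpos b)
    have e₅ := dist_comm S.pos (S.vpos b)
    simp only [Timetable.sendTime, firstTime, secondTime, attackArrival, honestArrival]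
    refine ⟨?_, ?_, ?_, ?_, ?_⟩ <;> linarith

end Timing

/-! ### Operations that commute -/

theorem update_update_of_ne {Y : Type} [DecidableEq Y] {Z : Side → Y → Type}
    (f : (b : Side) → (j : Y) → Z b j) {b b' : Side} {j j' : Y} (h : (b, j) ≠ (b', j')) (x : Z b j) :
    Function.update f b (Function.update (f b) j x) b' j' = f b' j' := by
  by_cases hb : b' = b
  · subst hb
    have : j' ≠ j := fun hj => h (by rw [hj])
    simp [this]
  · simp [hb]

theorem update_update_comm {Y : Type} [DecidableEq Y] {Z : Side → Y → Type}
    (f : (b : Side) → (j : Y) → Z b j) {b b' : Side} {j j' : Y} (h : (b, j) ≠ (b', j')) (x : Z b j)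
    (y : Z b' j') :
    Function.update (Function.update f b (Function.update (f b) j x)) b'
        (Function.update (Function.update f b (Function.update (f b) j x) b') j' y) =
      Function.update (Function.update f b' (Function.update (f b') j' y)) b
        (Function.update (Function.update f b' (Function.update (f b') j' y) b) j x) := by
  by_cases hb : b' = b
  · subst hb
    have : j ≠ j' := fun hj => h (by rw [hj])
    simp [Function.update_comm this]
  · simp [hb, Ne.symm hb, Function.update_comm (Ne.symm hb)]

section Commute

set_option synthInstance.maxSize 1000

variable {N : ℕ} {P : Program N} (V : Verifiers P)

theorem onVerifiers_onProver_comm (C : Coalition P) {b b' : Side} {j j' : Fin N}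
    (h : (b, j) ≠ (b', j')) (M : Matrix (V.E × Qubits (P.n b j)) (V.E × Qubits (P.n b j)) ℂ)
    (M' : Matrix (Qubits (P.n b' j') × (Qubits C.m × C.W b'))
      (Qubits (P.n b' j') × (Qubits C.m × C.W b')) ℂ) (ψ : V.Sys × C.Mem → ℂ) :
    onVerifiers V b j M (onProver V C b' j' M' ψ) =
      onProver V C b' j' M' (onVerifiers V b j M ψ) := by
  refine applyTo_comm ?_ ?_ ?_ _ _ _
  · intro i s
    exact Prod.ext (update_update_of_ne (Z := fun b j => Qubits (P.n b j)) i.1.2 h s.2) rfl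
  · intro i s
    exact Prod.ext rfl (update_update_of_ne (Z := fun b j => Qubits (P.n b j)) i.1.2 h.symm s.1)
  · intro i s t
    exact Prod.ext (Prod.ext rfl
      (update_update_comm (Z := fun b j => Qubits (P.n b j)) i.1.2 h s.2 t.1)) rfl

theorem onProver_comm (C : Coalition P) {b b' : Side} (hb : b ≠ b') (j j' : Fin N)
    (M : Matrix (Qubits (P.n b j) × (Qubits C.m × C.W b))
      (Qubits (P.n b j) × (Qubits C.m × C.W b)) ℂ)
    (M' : Matrix (Qubits (P.n b' j') × (Qubits C.m × C.W b'))
      (Qubits (P.n b' j') × (Qubits C.m × C.W b')) ℂ) (ψ : V.Sys × C.Mem → ℂ) :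
    onProver V C b j M (onProver V C b' j' M' ψ) = onProver V C b' j' M' (onProver V C b j M ψ) := by
  refine applyTo_comm ?_ ?_ ?_ _ _ _
  · intro i s
    simp [hb.symm]
  · intro i s
    simp [hb]
  · intro i s t
    simp [hb, hb.symm, Function.update_comm hb]

variable (g : (j : Fin N) → Gadget (P.basis j))

/-- The register and the entangled systems of a step at `P₀`, in the whole system. -/
def stateGetFalse (j : Fin N) (i : V.Sys × (coalition P g).Mem) :
    Qubits (P.n false j) × Slot P g j :=
  (i.1.2 false j, slots P g (i.2 false).1 j)

def statePutFalse (j : Fin N) (i : V.Sys × (coalition P g).Mem)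
    (t : Qubits (P.n false j) × Slot P g j) : V.Sys × (coalition P g).Mem :=
  ((i.1.1, Function.update i.1.2 false (Function.update (i.1.2 false) j t.1)),
    Function.update i.2 false (putFalse P g j (i.1.2 false j, i.2 false) t).2)

/-- The register, the entangled systems of a step and the local register at `P₁`, in the whole
system. -/
def stateGetTrue (j : Fin N) (i : V.Sys × (coalition P g).Mem) :
    Qubits (P.n true j) × Slot P g j × Qubits P.r :=
  (i.1.2 true j, slots P g (i.2 true).1 j, (i.2 true).2)

def statePutTrue (j : Fin N) (i : V.Sys × (coalition P g).Mem)
    (t : Qubits (P.n true j) × Slot P g j × Qubits P.r) : V.Sys × (coalition P g).Mem :=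
  ((i.1.1, Function.update i.1.2 true (Function.update (i.1.2 true) j t.1)),
    Function.update i.2 true (putTrue P g j (i.1.2 true j, i.2 true) t).2)

def statePutMsg (j : Fin N) (i : V.Sys × (coalition P g).Mem)
    (t : Qubits (P.n true j)) : V.Sys × (coalition P g).Mem :=
  ((i.1.1, Function.update i.1.2 true (Function.update (i.1.2 true) j t)), i.2)

theorem applyTo_false (j : Fin N)
    (M : Matrix (Qubits (P.n false j) × Slot P g j) (Qubits (P.n false j) × Slot P g j) ℂ)
    (ψ : V.Sys × (coalition P g).Mem → ℂ) :
    onProver V (coalition P g) false j (embed (getFalse P g j) (putFalse P g j) M) ψ =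
      applyTo (stateGetFalse V g j) (statePutFalse V g j) M ψ :=
  applyTo_embed (fun i : V.Sys × (coalition P g).Mem => (i.1.2 false j, i.2 false))
    (fun i s => ((i.1.1, Function.update i.1.2 false (Function.update (i.1.2 false) j s.1)),
      Function.update i.2 false s.2)) (getFalse P g j) (putFalse P g j) M ψ

theorem applyTo_true (j : Fin N)
    (M : Matrix (Qubits (P.n true j) × Slot P g j × Qubits P.r)
      (Qubits (P.n true j) × Slot P g j × Qubits P.r) ℂ)
    (ψ : V.Sys × (coalition P g).Mem → ℂ) :
    onProver V (coalition P g) true j (embed (getTrue P g j) (putTrue P g j) M) ψ =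
      applyTo (stateGetTrue V g j) (statePutTrue V g j) M ψ :=
  applyTo_embed (fun i : V.Sys × (coalition P g).Mem => (i.1.2 true j, i.2 true))
    (fun i s => ((i.1.1, Function.update i.1.2 true (Function.update (i.1.2 true) j s.1)),
      Function.update i.2 true s.2)) (getTrue P g j) (putTrue P g j) M ψ

theorem applyTo_msg (j : Fin N) (M : Matrix (Qubits (P.n true j)) (Qubits (P.n true j)) ℂ)
    (ψ : V.Sys × (coalition P g).Mem → ℂ) :
    onProver V (coalition P g) true j (embed (fun s => s.1) (fun s t => (t, s.2)) M) ψ =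
      applyTo (fun i => i.1.2 true j) (statePutMsg V g j) M ψ := by
  refine (applyTo_embed (fun i : V.Sys × (coalition P g).Mem => (i.1.2 true j, i.2 true))
    (fun i s => ((i.1.1, Function.update i.1.2 true (Function.update (i.1.2 true) j s.1)),
      Function.update i.2 true s.2)) (fun s => s.1) (fun s t => (t, s.2)) M ψ).trans ?_
  congr 1
  funext i t
  simp [statePutMsg]

theorem slots_statePutFalse (j : Fin N) (i : V.Sys × (coalition P g).Mem)
    (t : Qubits (P.n false j) × Slot P g j) :
    slots P g ((statePutFalse V g j i t).2 false).1 =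
      Function.update (slots P g (i.2 false).1) j t.2 :=
  (congrArg (fun q : Qubits (pairCount P g) × Qubits P.r => slots P g q.1)
    (Function.update_self (β := fun _ => Qubits (pairCount P g) × Qubits P.r) false
      (putFalse P g j (i.1.2 false j, i.2 false) t).2 i.2)).trans (Equiv.apply_symm_apply _ _)

/-- Different steps use different message registers and different slots. -/
theorem applyTo_false_comm {j j' : Fin N} (h : j ≠ j')
    (M : Matrix (Qubits (P.n false j) × Slot P g j) (Qubits (P.n false j) × Slot P g j) ℂ)
    (M' : Matrix (Qubits (P.n false j') × Slot P g j') (Qubits (P.n false j') × Slot P g j') ℂ)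
    (ψ : V.Sys × (coalition P g).Mem → ℂ) :
    applyTo (stateGetFalse V g j) (statePutFalse V g j) M
        (applyTo (stateGetFalse V g j') (statePutFalse V g j') M' ψ) =
      applyTo (stateGetFalse V g j') (statePutFalse V g j') M'
        (applyTo (stateGetFalse V g j) (statePutFalse V g j) M ψ) := by
  have h' : ((false, j) : Side × Fin N) ≠ (false, j') := fun e => h (Prod.ext_iff.1 e).2
  refine applyTo_comm ?_ ?_ ?_ _ _ _
  · intro i s
    refine Prod.ext (update_update_of_ne (Z := fun b j => Qubits (P.n b j)) i.1.2 h' s.1) ?_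
    exact (congrFun (slots_statePutFalse V g j i s) j').trans (Function.update_of_ne h.symm _ _)
  · intro i s
    refine Prod.ext (update_update_of_ne (Z := fun b j => Qubits (P.n b j)) i.1.2 h'.symm s.1) ?_
    exact (congrFun (slots_statePutFalse V g j' i s) j).trans (Function.update_of_ne h _ _)
  · intro i s t
    refine Prod.ext (Prod.ext rfl
      (update_update_comm (Z := fun b j => Qubits (P.n b j)) i.1.2 h' s.1 t.1)) ?_
    funext b
    cases b
    · refine Prod.ext ((slots P g).injective ?_) ?_
      · rw [slots_statePutFalse, slots_statePutFalse, slots_statePutFalse, slots_statePutFalse,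
          Function.update_comm h]
      · rfl
    · rfl

/-- The correction by `P₁` touches only his message register, so it cannot interfere with the slot
and the local register that another step uses. -/
theorem applyTo_true_comm {j j' : Fin N} (h : j ≠ j')
    (M : Matrix (Qubits (P.n true j)) (Qubits (P.n true j)) ℂ)
    (M' : Matrix (Qubits (P.n true j') × Slot P g j' × Qubits P.r)
      (Qubits (P.n true j') × Slot P g j' × Qubits P.r) ℂ)
    (ψ : V.Sys × (coalition P g).Mem → ℂ) :
    applyTo (fun i => i.1.2 true j) (statePutMsg V g j) M
        (applyTo (stateGetTrue V g j') (statePutTrue V g j') M' ψ) =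
      applyTo (stateGetTrue V g j') (statePutTrue V g j') M'
        (applyTo (fun i => i.1.2 true j) (statePutMsg V g j) M ψ) := by
  have h' : ((true, j) : Side × Fin N) ≠ (true, j') := fun e => h (Prod.ext_iff.1 e).2
  refine applyTo_comm ?_ ?_ ?_ _ _ _
  · intro i s
    simp [stateGetTrue, statePutMsg, h.symm]
  · intro i s
    simp [statePutTrue, h]
  · intro i s t
    refine Prod.ext (Prod.ext rfl
      (update_update_comm (Z := fun b j => Qubits (P.n b j)) i.1.2 h' s t.1)) ?_
    simp [statePutTrue, statePutMsg, putTrue]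

/-- This is where interleaving is dealt with: the message of a later step may reach a prover before
the other's outcome for an earlier one. -/
theorem second_first_comm (o : VOutcome V) (k : (b : Side) → (j : Fin N) → Out P g b j)
    (b : Side) {j j' : Fin N} (h : j ≠ j') (ψ : V.Sys × (coalition P g).Mem → ℂ) :
    attackStep V (coalition P g) o k (.second b j) (attackStep V (coalition P g) o k (.first b j') ψ) =
      attackStep V (coalition P g) o k (.first b j')
        (attackStep V (coalition P g) o k (.second b j) ψ) := by
  cases b with
  | false =>
    have h1 : attackStep V (coalition P g) o k (.first false j') = _ :=
      funext (applyTo_false V g j' _)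
    have h2 : attackStep V (coalition P g) o k (.second false j) = _ :=
      funext (applyTo_false V g j _)
    rw [h1, h2, applyTo_false_comm V g h]
  | true =>
    have h1 : attackStep V (coalition P g) o k (.first true j') = _ :=
      funext (applyTo_true V g j' _)
    have h2 : attackStep V (coalition P g) o k (.second true j) = _ :=
      funext (applyTo_msg V g j _)
    rw [h1, h2, applyTo_true_comm V g h]

end Commute

/-! ### The attack in the order of the honest execution -/

section Reorder

variable {N : ℕ}

/-- The event at a verifier, if it is one. -/
def AttackEvent.msg : AttackEvent N → Option (HonestEvent N)
  | .recv b j => some (.recv b j)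
  | .send b j => some (.send b j)
  | .second _ _ => none
  | .first _ _ => none

def HonestEvent.msg : HonestEvent N → Option (HonestEvent N)
  | .recv b j => some (.recv b j)
  | .send b j => some (.send b j)
  | .prover _ => none

/-- Both lists of events restrict to this one, in the same order, so ties between verifiers' events
are resolved alike in both executions. -/
def msgEvents (N : ℕ) : List (HonestEvent N) :=
  (allPairs N).map (fun p => .recv p.1 p.2) ++ (allPairs N).map (fun p => .send p.1 p.2)

theorem filterMap_attackEvents : (attackEvents N).filterMap AttackEvent.msg = msgEvents N := by
  simp [attackEvents, msgEvents, AttackEvent.msg, List.filterMap_append, List.filterMap_map,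
    Function.comp_def]

theorem filterMap_honestEvents : (honestEvents N).filterMap HonestEvent.msg = msgEvents N := by
  simp [honestEvents, msgEvents, HonestEvent.msg, List.filterMap_append, List.filterMap_map,
    Function.comp_def]

theorem nodup_msgEvents : (msgEvents N).Nodup :=
  nodup_honestEvents.sublist (List.sublist_append_left _ _)

variable {S : Timetable N} {apos : Side → ℝ}

open List

/-- Verifiers' events have equal times in both executions, and a tie between them is decided by the
order in `msgEvents`; so they never change places. -/
theorem msg_order (ha : ∀ b j, attackArrival S apos b j = honestArrival S b j)
    {a b : AttackEvent N} (h : [a, b] <+ chronological (attackTime S apos) (attackEvents N))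
    (h' : [b, a] <+ honestOrder S) (hm : a.msg = some a.owner) (hm' : b.msg = some b.owner) :
    False := by
  have hmsg : ∀ e : AttackEvent N, e.msg = some e.owner →
      attackTime S apos e = honestTime S e.owner ∧ e.owner.msg = some e.owner := by
    rintro (⟨c, j⟩ | ⟨c, j⟩ | ⟨c, j⟩ | ⟨c, j⟩) he
    · exact ⟨ha c j, rfl⟩
    · exact ⟨rfl, rfl⟩
    · cases he
    · cases he
  have ht := time_le_of_chronological h
  rw [(hmsg a hm).1, (hmsg b hm').1] at ht
  rcases owner_of_honestOrder S h' with ho | ⟨ho, _⟩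
  · have ht' := time_le_of_chronological ho
    have e₁ := (sublist_of_chronological nodup_attackEvents h (by
      rw [(hmsg a hm).1, (hmsg b hm').1]
      exact ht')).filterMap AttackEvent.msg
    have e₂ := (sublist_of_chronological nodup_honestEvents ho ht).filterMap HonestEvent.msg
    rw [filterMap_attackEvents, filterMap_cons_some hm, filterMap_cons_some hm',
      filterMap_nil] at e₁
    rw [filterMap_honestEvents, filterMap_cons_some (hmsg b hm').2,
      filterMap_cons_some (hmsg a hm).2, filterMap_nil] at e₂
    exact not_pair_sublist_of_nodup nodup_msgEvents e₁ e₂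
  · have : a = b := by
      rcases a with ⟨c, j⟩ | ⟨c, j⟩ | ⟨c, j⟩ | ⟨c, j⟩ <;>
        rcases b with ⟨c', j'⟩ | ⟨c', j'⟩ | ⟨c', j'⟩ | ⟨c', j'⟩ <;>
        simp_all [AttackEvent.msg, AttackEvent.owner]
    subst this
    exact not_pair_sublist_of_nodup (nodup_honestOrder S) h' h'

variable {P : Program N} (g : (j : Fin N) → Gadget (P.basis j)) (V : Verifiers P)

-- Sending, first operation, second operation and receipt of one register have strictly increasing
-- times, in agreement with the honest order; so an event at a verifier can only change places with
-- one on another register. Between events at the provers, different sides act on disjoint systems,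
-- and on one side only a first and a second operation of different steps can be exchanged.
set_option synthInstance.maxSize 1000 in
theorem attackStep_comm (h₁ : S.vpos false < apos false) (h₂ : apos false < S.pos)
    (h₃ : S.pos < apos true) (h₄ : apos true < S.vpos true) (o : VOutcome V)
    (k : (b : Side) → (j : Fin N) → Out P g b j) {a b : AttackEvent N}
    (h : [a, b] <+ chronological (attackTime S apos) (attackEvents N))
    (h' : [b, a] <+ honestOrder S) (ψ : V.Sys × (coalition P g).Mem → ℂ) :
    attackStep V (coalition P g) o k a (attackStep V (coalition P g) o k b ψ) =
      attackStep V (coalition P g) o k b (attackStep V (coalition P g) o k a ψ) := by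
  have times := attack_times S h₁ h₂ h₃ h₄
  have ha : ∀ b j, attackArrival S apos b j = honestArrival S b j := fun b j => by
    obtain ⟨d, δ, _, _, ht⟩ := times b
    exact (ht j).2.2.2.1.trans (ht j).2.2.2.2.symm
  have ht := time_le_of_chronological h
  have hne : a ≠ b := by
    rintro rfl
    exact not_pair_sublist_of_nodup (nodup_honestOrder S) h' h'
  have ho : honestTime S b.owner ≤ honestTime S a.owner ∧
      (b.owner = a.owner → b.rank ≤ a.rank) := by
    rcases owner_of_honestOrder S h' with ho | ⟨ho, hr⟩
    · refine ⟨time_le_of_chronological ho, fun e => ?_⟩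
      rw [e] at ho
      exact (not_pair_sublist_of_nodup (nodup_chronological_honest S) ho ho).elim
    · exact ⟨(congrArg _ ho).le, fun _ => hr⟩
  have hT := S.T_strictMono
  rcases a with ⟨c, j⟩ | ⟨c, j⟩ | ⟨c, j⟩ | ⟨c, j⟩ <;>
    rcases b with ⟨c', j'⟩ | ⟨c', j'⟩ | ⟨c', j'⟩ | ⟨c', j'⟩ <;>
    simp only [attackTime, honestTime, AttackEvent.owner, AttackEvent.rank] at ht ho
  iterate 2
    iterate 2 exact (msg_order ha h h' rfl rfl).elim
    iterate 2
      refine onVerifiers_onProver_comm V _ (fun e => ?_) _ _ ψ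
      obtain ⟨rfl, rfl⟩ := Prod.mk.inj e
      obtain ⟨d, δ, hd, hδ, t⟩ := times c
      obtain ⟨t₁, t₂, t₃, t₄, t₅⟩ := t j
      linarith [ho.1]
  iterate 2
    refine (onVerifiers_onProver_comm V _ (fun e => ?_) _ _ ψ).symm
    obtain ⟨rfl, rfl⟩ := Prod.mk.inj e
    obtain ⟨d, δ, hd, hδ, t⟩ := times c'
    obtain ⟨t₁, t₂, t₃, t₄, t₅⟩ := t j'
    linarith [ho.1]
  · rcases ne_or_eq c c' with hc | rfl
    · exact onProver_comm V _ hc j j' _ _ ψ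
    · obtain ⟨d, δ, hd, hδ, t⟩ := times c
      rw [(t j).2.2.1, (t j').2.2.1] at ht
      exact (hne (by rw [hT.injective (le_antisymm (by linarith) ho.1)])).elim
  -- On one side the exchange would require both T j + d ≤ T j' - d and T j' ≤ T j.
  · rcases ne_or_eq c c' with hc | rfl
    · exact onProver_comm V _ hc j j' _ _ ψ
    · obtain ⟨d, δ, hd, hδ, t⟩ := times c
      rw [(t j).2.2.1, (t j').2.1] at ht
      linarith [ho.1]
  iterate 2
    refine (onVerifiers_onProver_comm V _ (fun e => ?_) _ _ ψ).symm
    obtain ⟨rfl, rfl⟩ := Prod.mk.inj e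
    obtain ⟨d, δ, hd, hδ, t⟩ := times c'
    obtain ⟨t₁, t₂, t₃, t₄, t₅⟩ := t j'
    linarith [ho.1]
  -- The genuine exchange; the rank excludes that both operations belong to the same step.
  · rcases ne_or_eq c c' with hc | rfl
    · exact onProver_comm V _ hc j j' _ _ ψ
    · refine (second_first_comm V g o k c (fun e => ?_) ψ).symm
      have := ho.2 (by rw [e])
      omega
  · rcases ne_or_eq c c' with hc | rfl
    · exact onProver_comm V _ hc j j' _ _ ψ
    · obtain ⟨d, δ, hd, hδ, t⟩ := times c
      rw [(t j).2.1, (t j').2.1] at ht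
      exact (hne (by rw [hT.injective (le_antisymm (by linarith) ho.1)])).elim

theorem attackBranch_eq (h₁ : S.vpos false < apos false) (h₂ : apos false < S.pos)
    (h₃ : S.pos < apos true) (h₄ : apos true < S.vpos true) (o : VOutcome V)
    (k : (b : Side) → (j : Fin N) → Out P g b j) :
    attackBranch V (coalition P g) S apos o k =
      (honestOrder S).foldl (fun ψ e => attackStep V (coalition P g) o k e ψ)
        (attackInit V (coalition P g)) :=
  foldl_eq_of_perm _ (chronological_perm_honestOrder S apos)
    ((chronological_perm _ _).nodup_iff.2 nodup_attackEvents)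
    (fun _ _ h h' ψ => attackStep_comm g V h₁ h₂ h₃ h₄ o k h h' ψ) _

end Reorder

/-! ### The final state of a successful attack -/

section Final

set_option synthInstance.maxSize 1000

variable {N : ℕ} {P : Program N} (g : (j : Fin N) → Gadget (P.basis j)) (V : Verifiers P)

theorem onVerifiers_mul {Q R : Type} (p : Q → R) (c d : Q → ℂ) (b : Side) (j : Fin N)
    (M : Matrix (V.E × Qubits (P.n b j)) (V.E × Qubits (P.n b j)) ℂ) (ψ : V.Sys × R → ℂ) :
    onVerifiers V b j M (fun i : V.Sys × Q => ψ (i.1, p i.2) * c i.2 * d i.2) =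
      fun i => onVerifiers V b j M ψ (i.1, p i.2) * c i.2 * d i.2 := by
  funext i
  simp only [onVerifiers, applyTo, Finset.sum_mul, mul_assoc]

theorem onVerifiers_productState (b : Side) (j : Fin N)
    (M : Matrix (V.E × Qubits (P.n b j)) (V.E × Qubits (P.n b j)) ℂ)
    (ψ : V.Sys × Qubits P.r → ℂ) (f : (j : Fin N) → Slot P g j → Slot P g j → ℂ) :
    onVerifiers V b j M (productState g V ψ f) = productState g V (onVerifiers V b j M ψ) f :=
  onVerifiers_mul V (fun q : (coalition P g).Mem => (q true).2)
    (fun q => if (q false).2 = (coalition P g).w false then 1 else 0)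
    (fun q => ∏ l, f l (slots P g (q false).1 l) (slots P g (q true).1 l)) b j M ψ

theorem onVerifiers_onLocal (b : Side) (j : Fin N)
    (M : Matrix (V.E × Qubits (P.n b j)) (V.E × Qubits (P.n b j)) ℂ)
    (ρ : Matrix.unitaryGroup (Qubits P.r) ℂ) (ψ : V.Sys × Qubits P.r → ℂ) :
    onVerifiers V b j M (onLocal V ρ ψ) = onLocal V ρ (onVerifiers V b j M ψ) := by
  unfold onVerifiers onLocal
  refine applyTo_comm ?_ ?_ ?_ _ _ _ <;> intros <;> rfl

variable {g}

/-- The error of the local register after `n` steps. -/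
def gaugeAt (k : (b : Side) → (j : Fin N) → Out P g b j) (n : ℕ) :
    Matrix.unitaryGroup (Qubits P.r) ℂ :=
  if h : 0 < n ∧ n - 1 < N then
    (qubitBasis P.r).u (stepKey (k false ⟨n - 1, h.2⟩) fun i => k true i).2.2
  else 1

theorem gauge_eq (k : (b : Side) → (j : Fin N) → Out P g b j) (j : Fin N) :
    gauge (fun i : Set.Iio j => k false i) (fun i => k true i) = gaugeAt k j := by
  by_cases h : 0 < j.1
  · rw [gauge, gaugeAt, dif_pos h, dif_pos ⟨h, by omega⟩]
  · rw [gauge, gaugeAt, dif_neg h, dif_neg fun h' => h h'.1]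

theorem gaugeAt_succ (k : (b : Side) → (j : Fin N) → Out P g b j) (j : Fin N) :
    gaugeAt k (j + 1) = (qubitBasis P.r).u (stepKey (k false j) fun i => k true i).2.2 := by
  rw [gaugeAt, dif_pos ⟨Nat.succ_pos _, j.2⟩]
  rfl

/-- State of the entangled systems after `n` successful steps. -/
def slotsAt (k : (b : Side) → (j : Fin N) → Out P g b j) (x : (j : Fin N) → P.X false j) (n : ℕ)
    (l : Fin N) : Slot P g l → Slot P g l → ℂ :=
  if l.1 < n then used k x l else entangled g l

theorem slotsAt_succ (k : (b : Side) → (j : Fin N) → Out P g b j)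
    (x : (j : Fin N) → P.X false j) (j : Fin N) :
    Function.update (slotsAt k x j) j (used k x j) = slotsAt k x (j + 1) := by
  funext l
  by_cases h : l = j
  · subst h
    simp [slotsAt]
  · have : l.1 ≠ j.1 := fun e => h (Fin.ext e)
    rw [Function.update_of_ne h, slotsAt, slotsAt]
    exact if_congr (by omega) rfl rfl

/-- The event at the honest prover, if it is one. -/
def HonestEvent.step : HonestEvent N → Option (Fin N)
  | .recv _ _ => none
  | .send _ _ => none
  | .prover j => some j

/-- A simulation argument: `F n` carries a state of the honest execution to the state of the attack
after `n` completed steps. Verifiers' events preserve the relation, and a prover event advances `n`;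
`hl` says that the steps still to come occur in their order. -/
theorem foldl_expand {Φ Ψ : Type} (A : AttackEvent N → Φ → Φ) (B : HonestEvent N → Ψ → Ψ)
    (F : ℕ → Ψ → Φ) (hr : ∀ n b j ψ, A (.recv b j) (F n ψ) = F n (B (.recv b j) ψ))
    (hs : ∀ n b j ψ, A (.send b j) (F n ψ) = F n (B (.send b j) ψ))
    (hp : ∀ (j : Fin N) ψ, A (.second true j) (A (.second false j) (A (.first true j)
      (A (.first false j) (F j ψ)))) = F (j + 1) (B (.prover j) ψ))
    (l : List (HonestEvent N)) (n : ℕ) (hn : n ≤ N)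
    (hl : l.filterMap HonestEvent.step = (List.finRange N).drop n) (ψ : Ψ) :
    (l.flatMap HonestEvent.expand).foldl (fun ψ e => A e ψ) (F n ψ) =
      F N (l.foldl (fun ψ e => B e ψ) ψ) := by
  induction l generalizing n ψ with
  | nil =>
    have := congrArg List.length hl
    simp only [List.filterMap_nil, List.length_nil, List.length_drop, List.length_finRange] at this
    obtain rfl : n = N := by omega
    rfl
  | cons e l ih =>
    cases e with
    | recv b j =>
      rw [List.foldl_cons, ← ih n hn hl, ← hr]
      rfl
    | send b j =>
      rw [List.foldl_cons, ← ih n hn hl, ← hs]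
      rfl
    | prover j =>
      have hlt : n < N := by
        by_contra h
        rw [List.drop_eq_nil_of_le (by simpa using h)] at hl
        simp [HonestEvent.step] at hl
      rw [List.drop_eq_getElem_cons (by simpa using hlt), List.getElem_finRange,
        List.filterMap_cons_some (show HonestEvent.step (.prover j) = some j from rfl),
        List.cons.injEq] at hl
      obtain rfl : n = j.1 := by
        rw [hl.1]
        rfl
      rw [List.foldl_cons, ← ih (j + 1) hlt hl.2, ← hp]
      rfl

/-- The times `T` increase strictly, and a sorted permutation of a sorted list is that list. -/
theorem filterMap_chronological (S : Timetable N) :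
    (chronological (honestTime S) (honestEvents N)).filterMap HonestEvent.step =
      List.finRange N := by
  refine List.Perm.eq_of_pairwise (le := fun i j : Fin N => i ≤ j) ?_ ?_ ?_ ?_
  · intro a b _ _ h h'
    exact le_antisymm h h'
  · rw [List.pairwise_filterMap]
    have : (chronological (honestTime S) (honestEvents N)).Pairwise
        fun e e' => honestTime S e ≤ honestTime S e' :=
      List.pairwise_iff_forall_sublist.2 fun h => time_le_of_chronological h
    refine this.imp fun {e e'} h i hi i' hi' => ?_
    cases e <;> cases hi
    cases e' <;> cases hi'
    exact S.T_strictMono.le_iff_le.1 h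
  · exact List.pairwise_le_finRange N
  · refine ((chronological_perm _ _).filterMap _).trans (List.Perm.of_eq ?_)
    simp [honestEvents, HonestEvent.step, List.filterMap_append, List.filterMap_map,
      Function.comp_def]

theorem prod_sqrt_card : ∏ l, ((Real.sqrt (Fintype.card (Slot P g l)) : ℝ) : ℂ)⁻¹ =
    (((Real.sqrt 2)⁻¹ ^ pairCount P g : ℝ) : ℂ) := by
  rw [← Complex.ofReal_inj.2 (?_ : ∏ l, (Real.sqrt (Fintype.card (Slot P g l)))⁻¹ = _)]
  · push_cast
    rfl
  · rw [Finset.prod_inv_distrib, inv_pow]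
    congr 1
    refine (pow_left_inj₀ (Finset.prod_nonneg fun _ _ => Real.sqrt_nonneg _)
      (pow_nonneg (Real.sqrt_nonneg _) _) two_ne_zero).1 ?_
    rw [← Finset.prod_pow, ← pow_mul, mul_comm, pow_mul, Real.sq_sqrt zero_le_two]
    simp only [Real.sq_sqrt (Nat.cast_nonneg _)]
    rw [← Nat.cast_prod, ← Fintype.card_pi, (exists_card_slots P g).choose_spec]
    push_cast
    rfl

theorem prod_entangled (a a' : Qubits (pairCount P g)) :
    ∏ l, entangled g l (slots P g a l) (slots P g a' l) = eprPairs (pairCount P g) a a' := by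
  simp only [entangled, eprPairs]
  by_cases h : a = a'
  · simp only [h, if_true]
    exact prod_sqrt_card
  · obtain ⟨l, hl⟩ := Function.ne_iff.1 fun e => h ((slots P g).injective e)
    rw [if_neg h, Finset.prod_eq_zero (Finset.mem_univ l) (if_neg hl)]

theorem attackInit_eq : attackInit V (coalition P g) =
    productState g V (honestInit V) fun l => entangled g l := by
  funext i
  have h₁ : ∏ l, entangled g l (slots P g (i.2 false).1 l) (slots P g (i.2 true).1 l) =
      eprPairs (pairCount P g) (i.2 false).1 (i.2 true).1 := prod_entangled _ _
  have h₂ : (if ∀ b, (i.2 b).2 = (coalition P g).w b then (1 : ℂ) else 0) =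
      (if (i.2 true).2 = (coalition P g).w true then 1 else 0) *
        if (i.2 false).2 = (coalition P g).w false then 1 else 0 := by
    by_cases h : (i.2 true).2 = (coalition P g).w true <;>
      by_cases h' : (i.2 false).2 = (coalition P g).w false <;> simp [h, h']
  rw [attackInit, h₂, productState, h₁, mul_right_comm, ← mul_assoc]
  rfl

/-- The state of the attack after `n` successful steps, from the state of the honest execution. -/
def stateAt (o : VOutcome V) (k : (b : Side) → (j : Fin N) → Out P g b j) (n : ℕ)
    (ψ : V.Sys × Qubits P.r → ℂ) : V.Sys × (coalition P g).Mem → ℂ :=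
  productState g V (onLocal V (gaugeAt k n) ψ) (slotsAt k (fun j => o.x false j) n)

theorem onVerifiers_stateAt (o : VOutcome V) (k : (b : Side) → (j : Fin N) → Out P g b j) (n : ℕ)
    (b : Side) (j : Fin N) (M : Matrix (V.E × Qubits (P.n b j)) (V.E × Qubits (P.n b j)) ℂ)
    (ψ : V.Sys × Qubits P.r → ℂ) :
    onVerifiers V b j M (stateAt V o k n ψ) = stateAt V o k n (onVerifiers V b j M ψ) := by
  rw [stateAt, stateAt, ← onVerifiers_onLocal]
  exact onVerifiers_productState g V b j M _ _

theorem attackStep_stateAt (o : VOutcome V) (k : (b : Side) → (j : Fin N) → Out P g b j)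
    (hk : ∀ j, (k true j).1 = o.x true j ∧ (g j).w (k true j).2.1 ≠ 0) (j : Fin N)
    (ψ : V.Sys × Qubits P.r → ℂ) :
    attackStep V (coalition P g) o k (.second true j)
      (attackStep V (coalition P g) o k (.second false j)
        (attackStep V (coalition P g) o k (.first true j)
          (attackStep V (coalition P g) o k (.first false j) (stateAt V o k j ψ)))) =
      stateAt V o k (j + 1) (honestStep V o (.prover j) ψ) := by
  rw [stateAt, stateAt, ← gauge_eq, ← slotsAt_succ, gaugeAt_succ]
  exact attack_step V o k j (hk j).1 (hk j).2 ψ (slotsAt k (fun j => o.x false j) j)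
    (by simp [slotsAt])

theorem isLens_snd {A B : Type} : IsLens (fun i : A × B => i.2) (fun i t => (i.1, t)) := by
  constructor <;> intros <;> rfl

theorem onLocal_one (ψ : V.Sys × Qubits P.r → ℂ) : onLocal V 1 ψ = ψ := by
  rw [onLocal, Matrix.UnitaryGroup.one_val]
  exact applyTo_one isLens_snd ψ

theorem stateAt_zero (o : VOutcome V) (k : (b : Side) → (j : Fin N) → Out P g b j) :
    stateAt V o k 0 (honestInit V) = attackInit V (coalition P g) := by
  have h : gaugeAt k 0 = 1 := by simp [gaugeAt]
  rw [attackInit_eq, stateAt, h, onLocal_one]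
  congr 1

/-- The reordered attack simulates the honest branch. What differs is a unitary on the local
register and a product state of the slots, neither of which the verifiers hold. -/
theorem attackBranch_of_success {S : Timetable N} {apos : Side → ℝ} (h₁ : S.vpos false < apos false)
    (h₂ : apos false < S.pos) (h₃ : S.pos < apos true) (h₄ : apos true < S.vpos true)
    (o : VOutcome V) (k : (b : Side) → (j : Fin N) → Out P g b j)
    (hk : ∀ j, (k true j).1 = o.x true j ∧ (g j).w (k true j).2.1 ≠ 0) :
    attackBranch V (coalition P g) S apos o k =
      productState g V (onLocal V (gaugeAt k N) (honestBranch V S o))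
        (fun j => used k (fun j => o.x false j) j) := by
  have key : (honestOrder S).foldl (fun ψ e => attackStep V (coalition P g) o k e ψ)
      (stateAt V o k 0 (honestInit V)) = stateAt V o k N (honestBranch V S o) :=
    foldl_expand (attackStep V (coalition P g) o k) (honestStep V o) (stateAt V o k)
      (fun n b j ψ => onVerifiers_stateAt V o k n b j _ ψ)
      (fun n b j ψ => onVerifiers_stateAt V o k n b j _ ψ) (attackStep_stateAt V o k hk)
      (chronological (honestTime S) (honestEvents N)) 0 (Nat.zero_le _) (filterMap_chronological S)
      (honestInit V)
  rw [attackBranch_eq g V h₁ h₂ h₃ h₄, ← stateAt_zero V o k, key, stateAt]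
  congr 1
  funext l
  simp [slotsAt]

end Final

/-! ### The reduced state after a successful attack -/

/-- Disposes of the error that remains on the local register after the last step. -/
theorem reduced_applyTo {A Q : Type} [Fintype Q] [DecidableEq Q] (ρ : Matrix.unitaryGroup Q ℂ)
    (ψ : A × Q → ℂ) :
    reduced (applyTo (fun i : A × Q => i.2) (fun i t => (i.1, t)) ρ.1 ψ) = reduced ψ := by
  have hc : Complete fun _ : Unit => ρ.1 := by
    simpa [Complete, Matrix.star_eq_conjTranspose] using Matrix.mem_unitaryGroup_iff'.1 ρ.2
  ext a a'
  have := hc.sum_dotProduct (fun q => ψ (a', q)) fun q => ψ (a, q)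
  simp only [Finset.univ_unique, Finset.sum_singleton] at this
  simp only [dotProduct, Pi.star_apply] at this
  refine Eq.trans ?_ (this.trans ?_)
  · exact Finset.sum_congr rfl fun q _ => mul_comm _ _
  · exact Finset.sum_congr rfl fun q _ => mul_comm _ _

theorem posSemidef_reduced {A Q : Type} [Fintype A] [Fintype Q] (ψ : A × Q → ℂ) :
    (reduced ψ).PosSemidef := by
  have : reduced ψ = (Matrix.of fun a q => ψ (a, q)) * (Matrix.of fun a q => ψ (a, q))ᴴ := by
    ext a a'
    rfl
  rw [this]
  exact Matrix.posSemidef_self_mul_conjTranspose _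

/-! ### Weights of the successful branches -/

section Weight

set_option synthInstance.maxSize 1000

variable {N : ℕ} {P : Program N} {g : (j : Fin N) → Gadget (P.basis j)} (V : Verifiers P)

variable (g) in
/-- The memories of the dishonest provers, arranged by steps. -/
def memEquiv : (Qubits P.r × Qubits P.r × ((j : Fin N) → Slot P g j × Slot P g j)) ≃
    (coalition P g).Mem where
  toFun p b := match b with
    | false => ((slots P g).symm fun l => (p.2.2 l).1, p.2.1)
    | true => ((slots P g).symm fun l => (p.2.2 l).2, p.1)
  invFun i := ((i true).2, (i false).2,
    fun l => (slots P g (i false).1 l, slots P g (i true).1 l))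
  left_inv p := by
    refine Prod.ext rfl (Prod.ext rfl (funext fun l => Prod.ext ?_ ?_))
    · exact congrFun ((slots P g).apply_symm_apply _) l
    · exact congrFun ((slots P g).apply_symm_apply _) l
  right_inv i := by
    funext b
    cases b
    · exact Prod.ext ((slots P g).symm_apply_apply _) rfl
    · exact Prod.ext ((slots P g).symm_apply_apply _) rfl

theorem productState_memEquiv (ψ : V.Sys × Qubits P.r → ℂ)
    (f : (j : Fin N) → Slot P g j → Slot P g j → ℂ) (v : V.Sys)
    (p : Qubits P.r × Qubits P.r × ((j : Fin N) → Slot P g j × Slot P g j)) :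
    productState g V ψ f (v, memEquiv g p) =
      ψ (v, p.1) * (if p.2.1 = 0 then 1 else 0) * ∏ l, f l (p.2.2 l).1 (p.2.2 l).2 := by
  have h : ∀ l, f l (slots P g (memEquiv g p false).1 l) (slots P g (memEquiv g p true).1 l) =
      f l (p.2.2 l).1 (p.2.2 l).2 := fun l => by
    have := congrFun (congrArg (fun q => q.2.2) ((memEquiv g).symm_apply_apply p)) l
    exact congrArg (fun q => f l q.1 q.2) this
  rw [productState, Finset.prod_congr rfl fun l _ => h l]
  rfl

theorem reduced_productState (ψ : V.Sys × Qubits P.r → ℂ)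
    (f : (j : Fin N) → Slot P g j → Slot P g j → ℂ) :
    reduced (productState g V ψ f) =
      ((∏ l, ∑ p : Slot P g l × Slot P g l, ‖f l p.1 p.2‖ ^ 2 : ℝ) : ℂ) • reduced ψ := by
  ext v v'
  rw [reduced, ← (memEquiv g).sum_comp, Fintype.sum_prod_type]
  simp only [productState_memEquiv, Matrix.smul_apply, reduced, smul_eq_mul, Finset.mul_sum]
  refine Finset.sum_congr rfl fun t _ => ?_
  rw [Fintype.sum_prod_type, Finset.sum_eq_single 0]
  · rw [← sum_norm_sq_prod fun l (p : Slot P g l × Slot P g l) => f l p.1 p.2]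
    rw [Complex.ofReal_sum, Finset.sum_mul]
    refine Finset.sum_congr rfl fun p _ => ?_
    rw [Complex.ofReal_pow, ← Complex.mul_conj']
    simp only [if_true, mul_one, map_mul]
    ring
  · intro u _ hu
    simp only [if_neg hu, mul_zero, zero_mul, Finset.sum_const_zero]
  · exact fun h => (h (Finset.mem_univ _)).elim

/-- Probability of a pair of outcomes of a step together with success. -/
def weight (g : (j : Fin N) → Gadget (P.basis j)) (j : Fin N) (y : P.X true j) (k : OutTrue P g j) :
    ℝ :=
  -- The outcomes of `P₀` and of the Bell measurement returning her register are uniformly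
  -- distributed.
  open Classical in (if k.1 = y then (g j).w k.2.1 else 0) /
    (Fintype.card (OutFalse P g j) * Fintype.card (qubitBasis (P.n false j)).Idx)

theorem card_outFalse (j : Fin N) : Fintype.card (OutFalse P g j) =
    Fintype.card (Qubits (P.n false j)) ^ 2 *
      Fintype.card (g j).KA ^ Fintype.card (Hist P g j) := by
  rw [← (qubitBasis (P.n false j)).card_idx]
  exact (Fintype.card_prod _ _).trans (by rw [Fintype.card_fun])

theorem sum_weight (j : Fin N) (y : P.X true j) :
    ∑ _a : OutFalse P g j, ∑ k : OutTrue P g j, weight g j y k = (g j).success := by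
  have h : ∑ k : OutTrue P g j, weight g j y k = (g j).success / Fintype.card (OutFalse P g j) := by
    refine (Fintype.sum_prod_type (α₁ := P.X true j)
      (α₂ := (g j).KB × (qubitBasis (P.n false j)).Idx) _).trans ?_
    rw [Finset.sum_eq_single y]
    · rw [Fintype.sum_prod_type]
      simp only [weight, if_true, Finset.sum_const, Finset.card_univ, nsmul_eq_mul]
      rw [Gadget.success, Finset.sum_div]
      refine Finset.sum_congr rfl fun kb _ => ?_
      have : (Fintype.card (qubitBasis (P.n false j)).Idx : ℝ) ≠ 0 := by
        rw [(qubitBasis (P.n false j)).card_idx]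
        exact_mod_cast (pow_pos Fintype.card_pos 2).ne'
      field_simp
    · intro x _ hx
      simp [weight, hx]
    · simp
  rw [Finset.sum_const, h, Finset.card_univ, nsmul_eq_mul]
  have : (Fintype.card (OutFalse P g j) : ℝ) ≠ 0 := by
    rw [card_outFalse]
    have h₁ : 0 < Fintype.card (g j).KA := Fintype.card_pos
    have h₂ : 0 < Fintype.card (Qubits (P.n false j)) := Fintype.card_pos
    exact_mod_cast (by positivity)
  field_simp

/-- Let d be the dimension of the register of `P₀` and n the size of the bank. The amplitude
contributes 1/(d² · d²|H|ⁿ) and the bank w(|H|/|KA|)ⁿ; the powers of |H| cancel, and d⁴|KA|ⁿ is the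
number of uniform outcomes. -/
theorem sum_norm_sq_used (k : (b : Side) → (j : Fin N) → Out P g b j)
    (x : (j : Fin N) → P.X false j) (j : Fin N) (hw : (g j).w (k true j).2.1 ≠ 0) :
    ∑ p : Slot P g j × Slot P g j, ‖used k x j p.1 p.2‖ ^ 2 =
      weight g j (k true j).1 (k true j) := by
  simp only [used]
  rw [sum_norm_sq_leftover, weight, if_pos rfl, card_outFalse, (qubitBasis (P.n false j)).card_idx]
  rw [← Finset.mul_prod_erase Finset.univ _ (Finset.mem_univ (histOf fun i => k true i)),
    Function.update_self, (g j).junk_norm _ _ _ hw, norm_mul, mul_pow, norm_sqrt_card_inv_sq]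
  rw [Finset.prod_congr rfl fun h hh => by
    rw [Function.update_of_ne (Finset.ne_of_mem_erase hh), (g j).alice_norm]]
  rw [Finset.prod_const, Finset.card_erase_of_mem (Finset.mem_univ _), Finset.card_univ,
    show Fintype.card (Slot P g j) = Fintype.card (Qubits (P.n false j)) *
      (Fintype.card (Qubits (P.n false j)) * Fintype.card (g j).H ^ Fintype.card (Hist P g j)) by
      rw [← Fintype.card_fun (α := Hist P g j) (β := (g j).H), Fintype.card_prod,
        Fintype.card_prod], norm_inv, Complex.norm_natCast]
  have hA : (Fintype.card (Qubits (P.n false j)) : ℝ) ≠ 0 := by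
    exact_mod_cast Fintype.card_ne_zero
  have hK : (Fintype.card (g j).KA : ℝ) ≠ 0 := by exact_mod_cast Fintype.card_ne_zero
  have : Nonempty (g j).H := ⟨(g j).h₀⟩
  have hH : (Fintype.card (g j).H : ℝ) ≠ 0 := by exact_mod_cast Fintype.card_ne_zero
  have : Nonempty (Hist P g j) := ⟨histOf fun i => k true i⟩
  -- The bank is nonempty, so the used resource can be split off from the n - 1 untouched ones.
  obtain ⟨m, hm⟩ := Nat.exists_eq_succ_of_ne_zero (Fintype.card_ne_zero (α := Hist P g j))
  rw [hm, Nat.succ_sub_one]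
  push_cast
  generalize (Fintype.card (Qubits (P.n false j)) : ℝ) = a at *
  generalize (Fintype.card (g j).KA : ℝ) = b at *
  generalize (Fintype.card (g j).H : ℝ) = c at *
  rw [div_pow]
  field_simp
  rw [Nat.succ_eq_add_one]
  ring

theorem sum_prod_weight (x : (j : Fin N) → P.X true j) :
    ∑ k : (b : Side) → (j : Fin N) → Out P g b j, ∏ j, weight g j (x j) (k true j) =
      ∏ j, (g j).success := by
  let e : ((j : Fin N) → OutFalse P g j × OutTrue P g j) ≃
      ((b : Side) → (j : Fin N) → Out P g b j) :=
    { toFun := fun p b => match b with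
        | false => fun j => (p j).1
        | true => fun j => (p j).2
      invFun := fun k j => (k false j, k true j)
      left_inv := fun _ => rfl
      right_inv := fun k => by funext b; cases b <;> rfl }
  rw [← e.sum_comp]
  refine (sum_prod_apply fun j (p : OutFalse P g j × OutTrue P g j) =>
    weight g j (x j) p.2).trans ?_
  refine Finset.prod_congr rfl fun j _ => ?_
  rw [Fintype.sum_prod_type]
  exact sum_weight j (x j)

/-- In a successful branch the difference is zero. In any other branch one factor of the weight
vanishes, and a reduced state is positive. -/
theorem posSemidef_sub {S : Timetable N} {apos : Side → ℝ} (h₁ : S.vpos false < apos false)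
    (h₂ : apos false < S.pos) (h₃ : S.pos < apos true) (h₄ : apos true < S.vpos true)
    (o : VOutcome V) (k : (b : Side) → (j : Fin N) → Out P g b j) :
    (reduced (attackBranch V (coalition P g) S apos o k) -
      ((∏ j, weight g j (o.x true j) (k true j) : ℝ) : ℂ) •
        reduced (honestBranch V S o)).PosSemidef := by
  by_cases hk : ∀ j, (k true j).1 = o.x true j ∧ (g j).w (k true j).2.1 ≠ 0
  · rw [attackBranch_of_success V h₁ h₂ h₃ h₄ o k hk, reduced_productState,
      Finset.prod_congr rfl fun j _ => sum_norm_sq_used k (fun j => o.x false j) j (hk j).2,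
      Finset.prod_congr rfl fun j _ => by rw [(hk j).1], onLocal, reduced_applyTo, sub_self]
    exact Matrix.PosSemidef.zero
  · push Not at hk
    obtain ⟨j, hj⟩ := hk
    have : weight g j (o.x true j) (k true j) = 0 := by
      rw [weight]
      split_ifs with h
      · rw [hj h, zero_div]
      · rw [zero_div]
    rw [Finset.prod_eq_zero (Finset.mem_univ j) this, Complex.ofReal_zero, zero_smul, sub_zero]
    exact posSemidef_reduced _

end Weight

/-! ### Normalization -/

theorem isLens_eval {E : Type} [DecidableEq E] {α : E → Type} (e : E) : IsLens (fun o : (e : E) → α e => o e) (Function.update · e) := by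
  constructor <;> intros <;> simp

/-! ### Conservation of the total squared norm -/

section Branches

open List

variable {E Ψ : Type} [Fintype E] [DecidableEq E] {α : E → Type} [∀ e, Fintype (α e)]
  [∀ e, Nonempty (α e)]

/-- If events happen in the order of their times and each of them depends on its own outcome and on
outcomes of earlier events, then the squared norms of the branches add up. -/
theorem sum_foldl_chronological (time : E → ℝ) {L : List E} (hL : ∀ e, e ∈ L) (hn : L.Nodup)
    (step : ((e : E) → α e) → E → Ψ → Ψ) (nsq : Ψ → ℂ)
    (hd : ∀ o o' e, o e = o' e → (∀ e', time e' < time e → o e' = o' e') → step o e = step o' e)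
    (hs : ∀ o e ψ, ∑ v, nsq (step (Function.update o e v) e ψ) = nsq ψ) (ψ : Ψ) :
    ∑ o, nsq ((chronological time L).foldl (fun ψ e => step o e ψ) ψ) = nsq ψ := by
  have hmem : ∀ e, e ∈ chronological time L := fun e => (chronological_perm _ _).mem_iff.2 (hL e)
  have hn' : (chronological time L).Nodup := (chronological_perm _ _).nodup_iff.2 hn
  have earlier : ∀ l e r, chronological time L = l ++ e :: r → ∀ e', time e' < time e → e' ∈ l := by
    intro l e r hl e' he'
    have h := hmem e'
    rw [hl, mem_append, mem_cons] at h
    rcases h with h | rfl | h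
    · exact h
    · exact absurd he' (lt_irrefl _)
    · refine absurd (time_le_of_chronological (l := L) ?_) (not_le.2 he')
      rw [hl]
      exact ((singleton_sublist.2 h).cons_cons e).trans (sublist_append_right _ _)
  have indep : ∀ l r, chronological time L = l ++ r → ∀ o o', (∀ e ∈ l, o e = o' e) →
      l.foldl (fun ψ e => step o e ψ) ψ = l.foldl (fun ψ e => step o' e ψ) ψ := by
    intro l
    induction l using reverseRecOn with
    | nil => intros; rfl
    | append_singleton l e ih =>
      intro r hl o o' ho
      rw [append_assoc, singleton_append] at hl
      rw [foldl_append, foldl_append, ih _ hl o o' fun x hx => ho x (mem_append_left _ hx)]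
      simp only [foldl_cons, foldl_nil]
      rw [hd o o' e (ho e (by simp)) fun x hx => ho x (mem_append_left _ (earlier l e r hl x hx))]
  -- Families `o` also list outcomes of events not yet performed. The cardinalities compensate for
  -- this overcounting, so that the prefix can be built up event by event.
  have main : ∀ l r, chronological time L = l ++ r →
      ((l.map fun e => Fintype.card (α e)).prod : ℂ) *
        ∑ o, nsq (l.foldl (fun ψ e => step o e ψ) ψ) =
      Fintype.card ((e : E) → α e) * nsq ψ := by
    intro l
    induction l using reverseRecOn with
    | nil => intros; simp
    | append_singleton l e ih =>
      intro r hl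
      rw [append_assoc, singleton_append] at hl
      rw [← ih _ hl, map_append, prod_append]
      simp only [map_cons, map_nil, prod_cons, prod_nil, mul_one]
      push_cast
      rw [mul_assoc, ← nsmul_eq_mul (Fintype.card (α e)),
        (isLens_eval e).card_nsmul_sum fun o => nsq ((l ++ [e]).foldl (fun ψ e => step o e ψ) ψ)]
      congr 1
      refine Finset.sum_congr rfl fun o _ => ?_
      rw [← hs o e]
      refine Finset.sum_congr rfl fun v _ => ?_
      -- The outcome of `e` does not influence the prefix, so summing over it is conservation of
      -- norm for the last event alone.
      rw [foldl_append, indep l _ hl (Function.update o e v) o]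
      · rfl
      · intro x hx
        refine Function.update_of_ne ?_ _ _
        rintro rfl
        rw [hl] at hn'
        exact (nodup_append.1 hn').2.2 x hx x mem_cons_self rfl
  have h := main _ [] (append_nil _).symm
  have hc : ((chronological time L).map fun e => Fintype.card (α e)).prod =
      Fintype.card ((e : E) → α e) := by
    rw [Fintype.card_pi, ← prod_toFinset _ hn']
    congr 1
    ext e
    simp [hmem]
  rw [← hc] at h
  refine mul_left_cancel₀ ?_ h
  rw [hc]
  exact_mod_cast Fintype.card_ne_zero

end Branches

theorem trace_reduced {A Q : Type} [Fintype A] [Fintype Q] (ψ : A × Q → ℂ) :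
    (reduced ψ).trace = star ψ ⬝ᵥ ψ := by
  simp only [Matrix.trace, Matrix.diag, reduced, dotProduct, Fintype.sum_prod_type]
  exact Finset.sum_congr rfl fun _ _ => Finset.sum_congr rfl fun _ _ => mul_comm _ _

/-! ### Trace of the honest final state -/

section Honest

variable {N : ℕ} {P : Program N} (V : Verifiers P)

theorem isLens_onVerifiers {Q : Type} (b : Side) (j : Fin N) :
    IsLens (fun i : V.Sys × Q => (i.1.1, i.1.2 b j)) (fun i s =>
      ((s.1, Function.update i.1.2 b (Function.update (i.1.2 b) j s.2)), i.2)) := by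
  constructor <;> intros <;> simp

theorem sum_send {Q : Type} [Fintype Q] (b : Side) (j : Fin N) (ψ : V.Sys × Q → ℂ) :
    ∑ p : P.X b j × V.Ω, star (onVerifiers V b j (V.send b j p.1 p.2) ψ) ⬝ᵥ
      onVerifiers V b j (V.send b j p.1 p.2) ψ = star ψ ⬝ᵥ ψ := by
  have h : Complete fun p : P.X b j × V.Ω => V.send b j p.1 p.2 := by
    rw [Complete, Fintype.sum_prod_type]
    exact V.send_complete b j
  exact h.sum_dotProduct_applyTo (isLens_onVerifiers V b j) ψ ψ

theorem sum_recv {Q : Type} [Fintype Q] (b : Side) (j : Fin N) (ψ : V.Sys × Q → ℂ) :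
    ∑ v, star (onVerifiers V b j (V.recv b j v) ψ) ⬝ᵥ onVerifiers V b j (V.recv b j v) ψ =
      star ψ ⬝ᵥ ψ := by
  have h : Complete fun v => V.recv b j v := V.recv_complete b j
  exact h.sum_dotProduct_applyTo (isLens_onVerifiers V b j) ψ ψ

theorem dotProduct_applyTo_unitary {I S : Type} [Fintype I] [Fintype S] [DecidableEq S]
    {get : I → S} {put : I → S → I} (hl : IsLens get put) (U : Matrix.unitaryGroup S ℂ)
    (ψ : I → ℂ) : star (applyTo get put U.1 ψ) ⬝ᵥ applyTo get put U.1 ψ = star ψ ⬝ᵥ ψ := by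
  have hc : Complete fun _ : Unit => U.1 := by
    simpa [Complete, Matrix.star_eq_conjTranspose] using Matrix.mem_unitaryGroup_iff'.1 U.2
  simpa using hc.sum_dotProduct_applyTo hl ψ ψ

theorem Verifiers.nonempty_E : Nonempty V.E := by
  by_contra h
  rw [not_nonempty_iff] at h
  have := V.init_norm
  simp at this

/-- An empty Kraus family would sum to zero and not to the identity of a nonzero space. Nonempty
outcome sets are needed to cancel cardinalities in `sum_foldl_chronological`. -/
theorem Verifiers.nonempty_send (b : Side) (j : Fin N) : Nonempty (P.X b j × V.Ω) := by
  have := V.nonempty_E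
  by_contra h
  have hc : ∑ p : P.X b j × V.Ω, (V.send b j p.1 p.2)ᴴ * V.send b j p.1 p.2 = 1 := by
    rw [Fintype.sum_prod_type]
    exact V.send_complete b j
  rw [not_nonempty_iff] at h
  rw [Finset.univ_eq_empty, Finset.sum_empty] at hc
  exact zero_ne_one hc

instance : Fintype (HonestEvent N) := ⟨⟨honestEvents N, nodup_honestEvents⟩, mem_honestEvents⟩

instance : Fintype (AttackEvent N) := ⟨⟨attackEvents N, nodup_attackEvents⟩, mem_attackEvents⟩

/-- The outcomes of an event of the honest execution. -/
def HonestOut : HonestEvent N → Type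
  | .recv _ _ => V.Ω
  | .send b j => P.X b j × V.Ω
  | .prover _ => Unit

instance : ∀ e, Fintype (HonestOut V e)
  | .recv _ _ => inferInstanceAs (Fintype V.Ω)
  | .send b j => inferInstanceAs (Fintype (P.X b j × V.Ω))
  | .prover _ => inferInstanceAs (Fintype Unit)

instance : ∀ e, Nonempty (HonestOut V e)
  | .recv b j => (V.nonempty_send b j).map Prod.snd
  | .send b j => V.nonempty_send b j
  | .prover _ => ⟨()⟩

/-- The outcomes of all events of the honest execution. -/
def honestOut : (((b : Side) → (j : Fin N) → P.X b j) × (Side → Fin N → V.Ω) ×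
    (Side → Fin N → V.Ω)) ≃ ((e : HonestEvent N) → HonestOut V e) where
  toFun p e := match e with
    | .recv b j => p.2.2 b j
    | .send b j => (p.1 b j, p.2.1 b j)
    | .prover _ => ()
  invFun o := (fun b j => (o (.send b j)).1, fun b j => (o (.send b j)).2, fun b j => o (.recv b j))
  left_inv _ := rfl
  right_inv o := by
    funext e
    cases e <;> rfl

/-- The outcomes of the verifiers, from those of all events. -/
def toVOutcome (o : (e : HonestEvent N) → HonestOut V e) : VOutcome V where
  x b j := (o (.send b j)).1
  s b j := (o (.send b j)).2
  r b j := o (.recv b j)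

theorem sendTime_lt (S : Timetable N) (b : Side) (j : Fin N) : S.sendTime b j < S.T j := by
  have : 0 < dist (S.vpos b) S.pos := by
    cases b
    · exact dist_pos.2 S.left_lt.ne
    · exact dist_pos.2 S.lt_right.ne'
  rw [Timetable.sendTime]
  linarith

theorem trace_honestInit : star (honestInit V) ⬝ᵥ honestInit V = 1 := by
  rw [← Complex.ofReal_one, ← V.init_norm, ← trace_reduced]
  simp only [Matrix.trace, Matrix.diag, reduced, honestInit]
  push_cast
  refine Finset.sum_congr rfl fun v _ => ?_
  rw [Finset.sum_eq_single 0]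
  · simp [Complex.mul_conj']
  · intro q _ hq
    simp [hq]
  · simp

/-- The honest unitary depends only on messages sent strictly before T j, so
`sum_foldl_chronological` applies. -/
theorem trace_honestState (S : Timetable N) : (honestState V S).trace = 1 := by
  classical
  have key := sum_foldl_chronological (α := HonestOut V) (honestTime S) mem_honestEvents
    nodup_honestEvents (fun o => honestStep V (toVOutcome V o)) (fun ψ => star ψ ⬝ᵥ ψ) ?_ ?_
    (honestInit V)
  · rw [← (honestOut V).sum_comp, Fintype.sum_prod_type] at key
    simp only [Fintype.sum_prod_type] at key
    rw [← trace_honestInit V, ← key, honestState]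
    simp only [Matrix.trace_sum, trace_reduced]
    rfl
  · intro o o' e he hlt
    funext ψ
    cases e with
    | recv b j => simp only [honestStep, toVOutcome, he]
    | send b j => simp only [honestStep, toVOutcome, he]
    | prover j =>
      have : (fun b => (toVOutcome V o).x b j) = fun b => (toVOutcome V o').x b j := by
        funext b
        exact congrArg Prod.fst (hlt (.send b j) (sendTime_lt S b j))
      simp only [honestStep, this]
  · intro o e ψ
    cases e with
    | recv b j =>
      refine Eq.trans (Finset.sum_congr rfl fun v _ => ?_) (sum_recv V b j ψ)
      simp only [honestStep, toVOutcome, Function.update_self]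
    | send b j =>
      refine Eq.trans (Finset.sum_congr rfl fun v _ => ?_) (sum_send V b j ψ)
      simp only [honestStep, toVOutcome, Function.update_self]
    | prover j =>
      refine (Fintype.sum_unique (ι := Unit) _).trans ?_
      refine dotProduct_applyTo_unitary ?_ _ ψ
      constructor <;> intros <;> simp

end Honest

/-! ### Trace of the final state of the attack -/

section Attack

set_option synthInstance.maxSize 1000

variable {N : ℕ} {P : Program N} (V : Verifiers P) (C : Coalition P)

/-- The outcomes of an event of the attack. -/
def AttackOut : AttackEvent N → Type
  | .recv _ _ => V.Ω
  | .send b j => P.X b j × V.Ω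
  | .second _ _ => Unit
  | .first b j => C.K b j

instance : ∀ e, Fintype (AttackOut V C e)
  | .recv _ _ => inferInstanceAs (Fintype V.Ω)
  | .send b j => inferInstanceAs (Fintype (P.X b j × V.Ω))
  | .second _ _ => inferInstanceAs (Fintype Unit)
  | .first b j => inferInstanceAs (Fintype (C.K b j))

theorem nonempty_attackOut (hK : ∀ b j, Nonempty (C.K b j)) : ∀ e, Nonempty (AttackOut V C e)
  | .recv b j => (V.nonempty_send b j).map Prod.snd
  | .send b j => V.nonempty_send b j
  | .second _ _ => ⟨()⟩
  | .first b j => hK b j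

/-- The outcomes of all events of the attack. -/
def attackOut : (((b : Side) → (j : Fin N) → P.X b j) × (Side → Fin N → V.Ω) ×
    (Side → Fin N → V.Ω) × ((b : Side) → (j : Fin N) → C.K b j)) ≃
    ((e : AttackEvent N) → AttackOut V C e) where
  toFun p e := match e with
    | .recv b j => p.2.2.1 b j
    | .send b j => (p.1 b j, p.2.1 b j)
    | .second _ _ => ()
    | .first b j => p.2.2.2 b j
  invFun o := (fun b j => (o (.send b j)).1, fun b j => (o (.send b j)).2,
    fun b j => o (.recv b j), fun b j => o (.first b j))
  left_inv _ := rfl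
  right_inv o := by
    funext e
    cases e <;> rfl

/-- The outcomes of the verifiers, from those of all events. -/
def attackVOutcome (o : (e : AttackEvent N) → AttackOut V C e) : VOutcome V where
  x b j := (o (.send b j)).1
  s b j := (o (.send b j)).2
  r b j := o (.recv b j)

def attackKOutcome (o : (e : AttackEvent N) → AttackOut V C e) (b : Side) (j : Fin N) : C.K b j :=
  o (.first b j)

theorem isLens_onProver (b : Side) (j : Fin N) :
    IsLens (fun i : V.Sys × C.Mem => (i.1.2 b j, i.2 b)) (fun i s =>
      ((i.1.1, Function.update i.1.2 b (Function.update (i.1.2 b) j s.1)),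
        Function.update i.2 b s.2)) := by
  constructor <;> intros <;> simp

/-- Causality again: whatever an operation of a prover depends on, apart from its own outcome, was
sent or obtained strictly earlier. For the other prover's outcomes of steps i ≤ j this is T i - d' <
T j + d. -/
theorem trace_attackState {S : Timetable N} {apos : Side → ℝ} (h₁ : S.vpos false < apos false)
    (h₂ : apos false < S.pos) (h₃ : S.pos < apos true) (h₄ : apos true < S.vpos true)
    (hK : ∀ b j, Nonempty (C.K b j)) :
    (attackState V C S apos).trace = star (attackInit V C) ⬝ᵥ attackInit V C := by
  classical
  have := nonempty_attackOut V C hK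
  have times := attack_times S h₁ h₂ h₃ h₄
  have hT := S.T_strictMono
  have key := sum_foldl_chronological (α := AttackOut V C) (attackTime S apos) mem_attackEvents
    nodup_attackEvents (fun o => attackStep V C (attackVOutcome V C o) (attackKOutcome V C o))
    (fun ψ => star ψ ⬝ᵥ ψ) ?_ ?_ (attackInit V C)
  · rw [← (attackOut V C).sum_comp, Fintype.sum_prod_type] at key
    simp only [Fintype.sum_prod_type] at key
    rw [← key, attackState]
    simp only [Matrix.trace_sum, trace_reduced]
    rfl
  · intro o o' e he hlt
    have hx : ∀ b (i : Fin N), S.sendTime b i < attackTime S apos e →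
        (attackVOutcome V C o).x b i = (attackVOutcome V C o').x b i := fun b i h =>
      congrArg Prod.fst (hlt (.send b i) h)
    have hk : ∀ b (i : Fin N), firstTime S apos b i < attackTime S apos e →
        attackKOutcome V C o b i = attackKOutcome V C o' b i := fun b i h => hlt (.first b i) h
    funext ψ
    cases e with
    | recv b j => simp only [attackStep, attackVOutcome, he]
    | send b j => simp only [attackStep, attackVOutcome, he]
    | first b j =>
      obtain ⟨d, δ, hd, hδ, t⟩ := times b
      have e₁ : (fun i : Set.Iic j => (attackVOutcome V C o).x b i) =
          fun i : Set.Iic j => (attackVOutcome V C o').x b i := funext fun i => hx b i (by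
        have := hT.monotone (Set.mem_Iic.1 i.2)
        rw [attackTime, (t i).1, (t j).2.1]
        linarith)
      have e₂ : (fun i : Set.Iio j => attackKOutcome V C o b i) =
          fun i : Set.Iio j => attackKOutcome V C o' b i := funext fun i => hk b i (by
        have := hT (Set.mem_Iio.1 i.2)
        rw [attackTime, (t i).2.1, (t j).2.1]
        linarith)
      have e₃ : attackKOutcome V C o b j = attackKOutcome V C o' b j := he
      simp only [attackStep, e₁, e₂, e₃]
    | second b j =>
      obtain ⟨d, δ, hd, hδ, t⟩ := times b
      obtain ⟨d', δ', hd', hδ', t'⟩ := times (!b)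
      have e₁ : (fun i : Set.Iic j => (attackVOutcome V C o).x b i) =
          fun i : Set.Iic j => (attackVOutcome V C o').x b i := funext fun i => hx b i (by
        have := hT.monotone (Set.mem_Iic.1 i.2)
        rw [attackTime, (t i).1, (t j).2.2.1]
        linarith)
      have e₂ : (fun i : Set.Iic j => attackKOutcome V C o b i) =
          fun i : Set.Iic j => attackKOutcome V C o' b i := funext fun i => hk b i (by
        have := hT.monotone (Set.mem_Iic.1 i.2)
        rw [attackTime, (t i).2.1, (t j).2.2.1]
        linarith)
      have e₃ : (fun i : Set.Iic j => attackKOutcome V C o (!b) i) =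
          fun i : Set.Iic j => attackKOutcome V C o' (!b) i := funext fun i => hk (!b) i (by
        have := hT.monotone (Set.mem_Iic.1 i.2)
        rw [attackTime, (t' i).2.1, (t j).2.2.1]
        linarith)
      simp only [attackStep, e₁, e₂, e₃]
  · intro o e ψ
    cases e with
    | recv b j =>
      refine Eq.trans (Finset.sum_congr rfl fun v _ => ?_) (sum_recv V b j ψ)
      simp only [attackStep, attackVOutcome, Function.update_self]
    | send b j =>
      refine Eq.trans (Finset.sum_congr rfl fun v _ => ?_) (sum_send V b j ψ)
      simp only [attackStep, attackVOutcome, Function.update_self]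
    | first b j =>
      have hc : Complete fun c => C.first b j (fun i => (attackVOutcome V C o).x b i)
        (fun i => attackKOutcome V C o b i) c := C.first_complete b j _ _
      refine Eq.trans (Finset.sum_congr rfl fun v _ => ?_)
        (hc.sum_dotProduct_applyTo (isLens_onProver V C b j) ψ ψ)
      have e₁ : (attackVOutcome V C (Function.update o (.first b j) v)).x =
          (attackVOutcome V C o).x := by
        funext b' i
        simp [attackVOutcome]
      have e₂ : (fun i : Set.Iio j => attackKOutcome V C (Function.update o (.first b j) v) b i) =
          fun i : Set.Iio j => attackKOutcome V C o b i := by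
        funext i
        have : i.1 ≠ j := (Set.mem_Iio.1 i.2).ne
        exact Function.update_of_ne (fun h => this (by injection h)) _ _
      have e₃ : attackKOutcome V C (Function.update o (.first b j) v) b j = v :=
        Function.update_self _ _ _
      simp only [attackStep, e₁, e₂, e₃]
      rfl
    | second b j =>
      refine (Fintype.sum_unique (ι := Unit) _).trans ?_
      exact dotProduct_applyTo_unitary (isLens_onProver V C b j) _ ψ

theorem sum_norm_sq_entangled (g : (j : Fin N) → Gadget (P.basis j)) (j : Fin N) :
    ∑ p : Slot P g j × Slot P g j, ‖entangled g j p.1 p.2‖ ^ 2 = 1 := by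
  have : Nonempty (g j).H := ⟨(g j).h₀⟩
  have hc : (Fintype.card (Slot P g j) : ℝ) ≠ 0 := by exact_mod_cast Fintype.card_ne_zero
  rw [Fintype.sum_prod_type]
  have : ∀ x : Slot P g j, ∑ y, ‖entangled g j x y‖ ^ 2 = (Fintype.card (Slot P g j) : ℝ)⁻¹ := by
    intro x
    rw [Finset.sum_eq_single x, entangled, if_pos rfl, norm_sqrt_card_inv_sq]
    · intro y _ hy
      simp [entangled, hy.symm]
    · simp
  rw [Finset.sum_congr rfl fun x _ => this x, Finset.sum_const, Finset.card_univ, nsmul_eq_mul,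
    mul_inv_cancel₀ hc]

theorem trace_attackInit (g : (j : Fin N) → Gadget (P.basis j)) :
    star (attackInit V (coalition P g)) ⬝ᵥ attackInit V (coalition P g) = 1 := by
  rw [← trace_reduced, attackInit_eq, reduced_productState,
    Finset.prod_congr rfl fun j _ => sum_norm_sq_entangled g j, Finset.prod_const_one,
    Complex.ofReal_one, one_smul, trace_reduced, trace_honestInit]

theorem nonempty_out (V : Verifiers P) (g : (j : Fin N) → Gadget (P.basis j)) : ∀ b j, Nonempty (Out P g b j)
  | false, j => by
    rw [← Fintype.card_pos_iff]
    refine (card_outFalse (g := g) j).symm ▸ ?_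
    have h₁ : 0 < Fintype.card (g j).KA := Fintype.card_pos
    have h₂ : 0 < Fintype.card (Qubits (P.n false j)) := Fintype.card_pos
    positivity
  | true, j => by
    -- The program alone does not exclude an empty set of messages; the existence of verifiers does.
    obtain ⟨x, _⟩ := V.nonempty_send true j
    have : 0 < Fintype.card (qubitBasis (P.n false j)).Idx := by
      rw [(qubitBasis (P.n false j)).card_idx]
      exact pow_pos Fintype.card_pos _
    obtain ⟨i⟩ := Fintype.card_pos_iff.1 this
    exact ⟨(x, (g j).kb₀, i)⟩

end Attack

/-! ### The theorem -/

-- Writing F = B*B turns the trace into that of the positive matrix BρB*.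
open scoped MatrixOrder Matrix.Norms.L2Operator in
theorem trace_mul_nonneg {n : Type} [Fintype n] [DecidableEq n] {F ρ : Matrix n n ℂ}
    (hF : F.PosSemidef) (hρ : ρ.PosSemidef) : 0 ≤ (F * ρ).trace.re := by
  obtain ⟨B, rfl⟩ := CStarAlgebra.nonneg_iff_eq_star_mul_self.1 hF.nonneg
  have := (hρ.mul_mul_conjTranspose_same B).trace_nonneg
  rw [Matrix.mul_assoc, Matrix.trace_mul_comm, Matrix.star_eq_conjTranspose]
  exact (Complex.le_def.1 this).1

theorem trace_mul_mem {n : Type} [Fintype n] [DecidableEq n] {F ρ : Matrix n n ℂ}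
    (hF : F.PosSemidef) (hF' : (1 - F).PosSemidef) (hρ : ρ.PosSemidef) (h : ρ.trace = 1) :
    0 ≤ (F * ρ).trace.re ∧ (F * ρ).trace.re ≤ 1 := by
  refine ⟨trace_mul_nonneg hF hρ, ?_⟩
  have := trace_mul_nonneg hF' hρ
  rw [Matrix.sub_mul, Matrix.one_mul, Matrix.trace_sub, h, Complex.sub_re, Complex.one_re] at this
  linarith

section Main

set_option synthInstance.maxSize 1000

variable {N : ℕ} {P : Program N}

theorem posSemidef_honestState (V : Verifiers P) (S : Timetable N) :
    (honestState V S).PosSemidef :=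
  Matrix.posSemidef_sum _ fun _ _ => Matrix.posSemidef_sum _ fun _ _ =>
    Matrix.posSemidef_sum _ fun _ _ => posSemidef_reduced _

-- Each step is allowed the failure probability δ = min ε 1 / (N + 1), and Bernoulli's inequality
-- bounds (1 - δ)^N. The minimum with 1 keeps the factors nonnegative when ε is large.
variable (P) in
theorem exists_gadgets {ε : ℝ} (hε : 0 < ε) :
    ∃ g : (j : Fin N) → Gadget (P.basis j), 1 - ε ≤ ∏ j, (g j).success := by
  have hδ : 0 < min ε 1 / (N + 1) := by positivity
  have hδ₁ : min ε 1 / (N + 1) ≤ 1 := by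
    rw [div_le_one (by positivity)]
    have : (0 : ℝ) ≤ N := Nat.cast_nonneg _
    linarith [min_le_right ε 1]
  choose g hg using fun j : Fin N => exists_gadget (P.basis j) (0, 0, 0)
    ⟨P.n false j + (P.n true j + P.r), by simp [pow_add]⟩ _ hδ
  refine ⟨g, ?_⟩
  calc 1 - ε ≤ 1 + (N : ℝ) * (-(min ε 1 / (N + 1))) := by
        have : (N : ℝ) * (min ε 1 / (N + 1)) ≤ min ε 1 := by
          rw [mul_div_assoc', div_le_iff₀ (by positivity)]
          have : 0 < min ε 1 := by positivity
          nlinarith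
        linarith [min_le_left ε 1]
    _ ≤ (1 + -(min ε 1 / (N + 1))) ^ N := one_add_mul_le_pow (by linarith) N
    _ = ∏ _j : Fin N, (1 - min ε 1 / (N + 1)) := by simp [sub_eq_add_neg]
    _ ≤ ∏ j, (g j).success :=
        Finset.prod_le_prod (fun _ _ => sub_nonneg.2 hδ₁) fun j _ => hg j

theorem posSemidef_attackState_sub (g : (j : Fin N) → Gadget (P.basis j)) (V : Verifiers P)
    {S : Timetable N} {apos : Side → ℝ} (h₁ : S.vpos false < apos false)
    (h₂ : apos false < S.pos) (h₃ : S.pos < apos true) (h₄ : apos true < S.vpos true) :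
    (attackState V (coalition P g) S apos -
      ((∏ j, (g j).success : ℝ) : ℂ) • honestState V S).PosSemidef := by
  have : attackState V (coalition P g) S apos -
      ((∏ j, (g j).success : ℝ) : ℂ) • honestState V S =
      ∑ x : ((b : Side) → (j : Fin N) → P.X b j), ∑ s : (Side → Fin N → V.Ω),
        ∑ r : (Side → Fin N → V.Ω), ∑ k : ((b : Side) → (j : Fin N) → Out P g b j),
          (reduced (attackBranch V (coalition P g) S apos ⟨x, s, r⟩ k) -
            ((∏ j, weight g j (x true j) (k true j) : ℝ) : ℂ) •
              reduced (honestBranch V S ⟨x, s, r⟩)) := by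
    -- The total weight over the provers' outcomes is the same for all outcomes of the verifiers, so
    -- it leaves the sum as a constant.
    simp only [Finset.sum_sub_distrib, ← Finset.sum_smul]
    simp only [← Complex.ofReal_sum, sum_prod_weight, ← Finset.smul_sum]
    rfl
  rw [this]
  exact Matrix.posSemidef_sum _ fun x _ => Matrix.posSemidef_sum _ fun s _ =>
    Matrix.posSemidef_sum _ fun r _ => Matrix.posSemidef_sum _ fun k _ =>
      posSemidef_sub V h₁ h₂ h₃ h₄ ⟨x, s, r⟩ k

end Main

end PositionVerification

end

open PositionVerification in
theorem mainTheorem3 (N : ℕ) (P : Program N) (ε : ℝ) (hε : 0 < ε) :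
    ∃ C : Coalition P,
      ∀ (V : Verifiers P) (S : Timetable N) (apos : Side → ℝ),
        S.vpos false < apos false → apos false < S.pos →
        S.pos < apos true → apos true < S.vpos true →
        (∀ b j, attackArrival S apos b j = honestArrival S b j) ∧
        (∃ τ : Matrix V.Sys V.Sys ℂ, τ.PosSemidef ∧ τ.trace = 1 ∧
          attackState V C S apos = ((1 - ε : ℝ) : ℂ) • honestState V S + (ε : ℂ) • τ) ∧
        |acceptProb V S (attackArrival S apos) (attackState V C S apos) -
          acceptProb V S (honestArrival S) (honestState V S)| ≤ ε := by
  obtain ⟨g, hg⟩ := exists_gadgets P hε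
  refine ⟨coalition P g, fun V S apos h₁ h₂ h₃ h₄ => ?_⟩
  have ha : ∀ b j, attackArrival S apos b j = honestArrival S b j := fun b j => by
    obtain ⟨d, δ, _, _, t⟩ := attack_times S h₁ h₂ h₃ h₄ b
    exact (t j).2.2.2.1.trans (t j).2.2.2.2.symm
  have hε' : (ε : ℂ) ≠ 0 := Complex.ofReal_ne_zero.2 hε.ne'
  have hh := posSemidef_honestState V S
  have hht := trace_honestState V S
  have hat : (attackState V (coalition P g) S apos).trace = 1 :=
    (trace_attackState V (coalition P g) h₁ h₂ h₃ h₄ (nonempty_out V g)).trans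
      (trace_attackInit V g)
  -- The success probability may exceed 1 - ε; the surplus is a nonnegative multiple of the honest
  -- state.
  have hp : (attackState V (coalition P g) S apos -
      ((1 - ε : ℝ) : ℂ) • honestState V S).PosSemidef := by
    have h := (posSemidef_attackState_sub g V h₁ h₂ h₃ h₄).add
      (hh.smul (a := ((∏ j, (g j).success - (1 - ε) : ℝ) : ℂ))
        (Complex.zero_le_real.2 (sub_nonneg.2 hg)))
    rwa [Complex.ofReal_sub, sub_smul, sub_add_sub_cancel] at h
  obtain ⟨τ, hτ, hτt, h⟩ : ∃ τ : Matrix V.Sys V.Sys ℂ, τ.PosSemidef ∧ τ.trace = 1 ∧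
      attackState V (coalition P g) S apos =
        ((1 - ε : ℝ) : ℂ) • honestState V S + (ε : ℂ) • τ := by
    -- The equation forces τ, and its trace is (1 - (1 - ε))/ε = 1.
    refine ⟨(ε : ℂ)⁻¹ • (attackState V (coalition P g) S apos -
      ((1 - ε : ℝ) : ℂ) • honestState V S), hp.smul ?_, ?_, ?_⟩
    · rw [← Complex.ofReal_inv]
      exact Complex.zero_le_real.2 (inv_nonneg.2 hε.le)
    · rw [Matrix.trace_smul, Matrix.trace_sub, Matrix.trace_smul, hat, hht, smul_eq_mul,
        smul_eq_mul, mul_one, Complex.ofReal_sub, Complex.ofReal_one, sub_sub_cancel,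
        inv_mul_cancel₀ hε']
    · rw [smul_smul, mul_inv_cancel₀ hε', one_smul, add_sub_cancel]
  refine ⟨ha, ⟨τ, hτ, hτt, h⟩, ?_⟩
  have hF := trace_mul_mem V.F_nonneg V.F_le_one hτ hτt
  have hF' := trace_mul_mem V.F_nonneg V.F_le_one hh hht
  rw [acceptProb, acceptProb, if_pos fun b j => show _ = S.deadline b j from ha b j,
    if_pos fun b j => show honestArrival S b j = S.deadline b j from rfl, h, Matrix.mul_add,
    Matrix.mul_smul, Matrix.mul_smul, Matrix.trace_add, Matrix.trace_smul, Matrix.trace_smul,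
    Complex.add_re, smul_eq_mul, smul_eq_mul, Complex.re_ofReal_mul, Complex.re_ofReal_mul]
  -- All replies are in time in both executions, so the acceptance probabilities differ by ε times a
  -- difference of two numbers in [0, 1].
  have : (1 - ε) * (V.F * honestState V S).trace.re + ε * (V.F * τ).trace.re -
      (V.F * honestState V S).trace.re =
      ε * ((V.F * τ).trace.re - (V.F * honestState V S).trace.re) := by ring
  rw [this, abs_mul, abs_of_pos hε]
  refine mul_le_of_le_one_right hε.le (abs_le.2 ⟨?_, ?_⟩) <;> linarith [hF.1, hF.2, hF'.1, hF'.2]
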